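/- Let $d,N\ge 1$ be integers, $\lambda,\mu\ge 0$, $\beta>0$, and let $\rho$ be a Borel probability measure on the unit sphere $\mathbb S^{d-1}\subset\mathbb R^d$ with $\int_{\mathbb S^{d-1}}\sigma\otimes\sigma\,d\rho(\sigma)=\frac1d\,\mathbb 1_d$. Write $\mathbf v=(v_1,\dots,v_N)\in\mathbb R^{dN}$ with $v_i\in\mathbb R^d$, and let $$\gamma_n(\mathbf u)=\Big(\frac{\beta}{2\pi}\Big)^{dn/2}e^{-\frac\beta2|\mathbf u|^2}\quad(\mathbf u\in\mathbb R^{dn}),\qquad \gamma=\gamma_N .$$ For $\sigma\in\mathbb S^{d-1}$ and indices $i\ne j$ let $M^{(i,j)}_\sigma$ be the reflection collision that replaces $v_i$ by $v_i-(\sigma\cdot(v_i-v_j))\,\sigma$ and $v_j$ by $v_j+(\sigma\cdot(v_i-v_j))\,\sigma$ and leaves the other velocities unchanged. On $L^1(\mathbb R^{dN})$ define $$Q[f](\mathbf v)=\binom N2^{-1}\sum_{1\le i<j\le N}\int_{\mathbb S^{d-1}}f\big(M^{(i,j)}_\sigma\mathbf v\big)\,d\rho(\sigma)\qquad(Q=\mathbb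 1\text{ if }N=1),$$ $$R=\frac1N\sum_{j=1}^N R_j,\qquad R_j[f](\mathbf v)=\int_{\mathbb R^d}dw\int_{\mathbb S^{d-1}}d\rho(\sigma)\;\gamma_1(w^*)\,f(\mathbf v^*),\qquad (\mathbf v^*,w^*)=M^{(j,N+1)}_\sigma(\mathbf v,w)\in\mathbb R^{dN}\times\mathbb R^d,$$ $$\mathcal L=\lambda N(Q-\mathbb 1)+\mu N(R-\mathbb 1).$$ Let $(f_t)_{t\ge0}\subset L^1(\mathbb R^{dN})$ be a solution of the master equation $\frac{d}{dt}f_t=\mathcal L f_t$ for $t\ge 0$ (the derivative being taken in $L^1$, one-sided at $t=0$) such that $f_0$ is a probability density, $\sqrt{f_0}\in H^1(\mathbb R^{dN})$, and the initial kinetic energy $\frac12\int|\mathbf v|^2f_0(\mathbf v)\,d\mathbf v$ is finite. Then for every $t\ge0$ the relative entropies $$S(f_t|\gamma)=\int_{\mathbb R^{dN}}f_t(\mathbf v)\ln\frac{f_t(\mathbf v)}{\gamma(\mathbf v)}\,d\mathbf v$$ and $S(f_0|\gamma)$ are finite (their integrands are integrable), and $$S(f_t|\gamma)\le e^{-\frac1d\mu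 t}\,S(f_0|\gamma).$$ In particular the rate does not depend on $N$, $\lambda$, $\beta$ or on the choice of $\rho$. -/

import Mathlib

open MeasureTheory Set Filter Topology
open scoped ENNReal NNReal ContDiff

namespace KacThermostat

/-- The velocity space `ℝ^d` of one particle, with its Euclidean structure. -/
abbrev Velocity (d : ℕ) : Type := EuclideanSpace ℝ (Fin d)

/-- Master vectors `v = (v_1, …, v_N)` with `v_i ∈ ℝ^d`. The measure `volume` on this type is
Lebesgue measure on `ℝ^{dN}`. The norm of a master vector is never used below: `v ^ 2` is always
written as `∑ i, ‖v i‖ ^ 2`. -/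
abbrev Config (N d : ℕ) : Type := Fin N → Velocity d

/-- Scattering angles: the unit sphere of `ℝ^d`. -/
abbrev Angle (d : ℕ) : Type := Metric.sphere (0 : Velocity d) 1

/-- The squared Euclidean length `v ^ 2 = ∑ i, |v_i| ^ 2` of a master vector. -/
noncomputable def sqLength {N d : ℕ} (v : Config N d) : ℝ := ∑ i, ‖v i‖ ^ 2

/-- The collision (reflection) of the particles `i ≠ j` with scattering angle `σ`:
`v_i ↦ v_i - (σ · (v_i - v_j)) σ`, `v_j ↦ v_j + (σ · (v_i - v_j)) σ`, all other
velocities being unchanged. -/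
noncomputable def collide {N d : ℕ} (σ : Angle d) (i j : Fin N) (v : Config N d) : Config N d :=
  Function.update
    (Function.update v i (v i - inner ℝ (σ : Velocity d) (v i - v j) • (σ : Velocity d)))
    j (v j + inner ℝ (σ : Velocity d) (v i - v j) • (σ : Velocity d))

/-- The Maxwell density of a single particle at inverse temperature `β`. -/
noncomputable def maxwell {d : ℕ} (β : ℝ) (w : Velocity d) : ℝ :=
  (β / (2 * Real.pi)) ^ ((d : ℝ) / 2) * Real.exp (-(β / 2) * ‖w‖ ^ 2)

/-- The Maxwell density `γ` of `N` particles at inverse temperature `β`. -/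
noncomputable def maxwellN {N d : ℕ} (β : ℝ) (v : Config N d) : ℝ :=
  (β / (2 * Real.pi)) ^ ((d : ℝ) * N / 2) * Real.exp (-(β / 2) * sqLength v)

/-- The operator `Q` of the collisions inside the Kac system: the average over all pairs `i < j`
and over the scattering angle; `Q` is the identity if there is no pair. -/
noncomputable def collisionOp {N d : ℕ} (ρ : Measure (Angle d)) (f : Config N d → ℝ)
    (v : Config N d) : ℝ :=
  if N < 2 then f v
  else ((N.choose 2 : ℕ) : ℝ)⁻¹ *
    ∑ p : Fin N × Fin N with p.1 < p.2, ∫ σ, f (collide σ p.1 p.2 v) ∂ρ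

/-- The operator `R_j` of the collisions of particle `j` with the thermostat. A thermostat
particle with velocity `w` is appended to `v` as last particle. -/
noncomputable def thermostatOpAt {N d : ℕ} (β : ℝ) (ρ : Measure (Angle d)) (j : Fin N)
    (f : Config N d → ℝ) (v : Config N d) : ℝ :=
  ∫ w : Velocity d, ∫ σ,
    maxwell β (collide σ j.castSucc (Fin.last N)
        (Fin.snoc (α := fun _ => Velocity d) v w) (Fin.last N)) *
      f (Fin.init (α := fun _ => Velocity d) (collide σ j.castSucc (Fin.last N)
        (Fin.snoc (α := fun _ => Velocity d) v w))) ∂ρ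

/-- The operator `R = N⁻¹ ∑_j R_j` of the interaction with the thermostat. -/
noncomputable def thermostatOp {N d : ℕ} (β : ℝ) (ρ : Measure (Angle d))
    (f : Config N d → ℝ) (v : Config N d) : ℝ :=
  (N : ℝ)⁻¹ * ∑ j, thermostatOpAt β ρ j f v

/-- The generator `𝓛 = lam N (Q - 1) + μ N (R - 1)` of the Kac master equation. -/
noncomputable def generator {N d : ℕ} (lam μ β : ℝ) (ρ : Measure (Angle d))
    (f : Config N d → ℝ) (v : Config N d) : ℝ :=
  lam * N * (collisionOp ρ f v - f v) + μ * N * (thermostatOp β ρ f v - f v)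

/-- `(f_t)_{t ≥ 0}` solves the Kac master equation `d/dt f_t = 𝓛 f_t` in `L^1(ℝ^{dN})`:
for every `t ≥ 0` the curve has an `L^1`-derivative (one-sided at `t = 0`), and this derivative
is the class of `𝓛 f_t`. The values of `f` at negative times play no role. Collisions preserve
Lebesgue measure, hence the class of `𝓛 f_t` does not depend on the representative of `f_t`. -/
def IsSolution {N d : ℕ} (lam μ β : ℝ) (ρ : Measure (Angle d))
    (f : ℝ → Lp ℝ 1 (volume : Measure (Config N d))) : Prop :=
  ∀ t : ℝ, 0 ≤ t → ∃ g : Lp ℝ 1 (volume : Measure (Config N d)),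
    HasDerivWithinAt f g (Ici 0) t ∧ g =ᵐ[volume] generator lam μ β ρ (f t)

/-- The symmetry condition `∫ σ ⊗ σ dρ(σ) = d⁻¹ 1_d`. -/
def SymmetryCondition {d : ℕ} (ρ : Measure (Angle d)) : Prop :=
  Matrix.of (fun k l : Fin d => ∫ σ : Angle d, (σ : Velocity d) k * (σ : Velocity d) l ∂ρ) =
    (1 / (d : ℝ)) • (1 : Matrix (Fin d) (Fin d) ℝ)

/-- `f` is a probability density with respect to Lebesgue measure. -/
def IsProbabilityDensity {N d : ℕ} (f : Config N d → ℝ) : Prop :=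
  Integrable f ∧ 0 ≤ᵐ[volume] f ∧ ∫ v, f v = 1

/-- The coordinate vector of `ℝ^{dN}` for the `k`-th velocity component of particle `i`. -/
noncomputable def coordVector {N d : ℕ} (i : Fin N) (k : Fin d) : Config N d :=
  Pi.single i (EuclideanSpace.single k (1 : ℝ))

/-- `g` is the weak partial derivative of `u` in the `k`-th velocity component of particle `i`. -/
def IsWeakPartial {N d : ℕ} (u : Config N d → ℝ) (i : Fin N) (k : Fin d)
    (g : Config N d → ℝ) : Prop :=
  ∀ φ : Config N d → ℝ, ContDiff ℝ ∞ φ → HasCompactSupport φ →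
    ∫ v, u v * fderiv ℝ φ v (coordVector i k) = - ∫ v, g v * φ v

/-- The Sobolev space `H^1(ℝ^{dN})`: `u` and all its first weak partial derivatives are
square-integrable. -/
def MemH1 {N d : ℕ} (u : Config N d → ℝ) : Prop :=
  MemLp u 2 volume ∧ ∀ (i : Fin N) (k : Fin d), ∃ g : Config N d → ℝ,
    MemLp g 2 volume ∧ IsWeakPartial u i k g

/-- The total kinetic energy `(1/2) ∫ v ^ 2 f(v) dv` of a density `f`, possibly infinite. -/
noncomputable def kineticEnergy {N d : ℕ} (f : Config N d → ℝ) : ℝ≥0∞ :=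
  ∫⁻ v, ENNReal.ofReal (1 / 2 * sqLength v * f v)

/-- The integrand `f ln (f / γ)` of the relative entropy; it is `0` where `f` vanishes. -/
noncomputable def entropyDensity {N d : ℕ} (f γ : Config N d → ℝ) (v : Config N d) : ℝ :=
  f v * Real.log (f v / γ v)

/-- The relative entropy `S(f | γ) = ∫ f ln (f / γ) dv`. -/
noncomputable def relEntropy {N d : ℕ} (f γ : Config N d → ℝ) : ℝ :=
  ∫ v, entropyDensity f γ v

end KacThermostat

set_option linter.unusedSectionVars false

/-! Write `h = f / γ`. In terms of `h` every collision is an average over random maps that preserve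
the Gaussian. For the collisions inside the system Jensen's inequality shows that the entropy does
not increase. A collision of particle `j` with the thermostat at angle `σ` replaces the
`σ`-component of `v_j` by an independent Gaussian one, so it is the conditional expectation of `h`
given all velocity components except that one, that is, given the projection `removeProj j σ`. By
the symmetry condition these projections average to `(1 - 1/(N d))` times the identity.

The core is the subadditivity of entropy for such tight frames of projections,
`lintegral_klEntropy_proj_le`: if the `P e` average to `c` times the identity, then the entropies of
the conditional expectations given `P e` average to at most `c` times the entropy of `h`. It is
proved by information theory. The conditional expectation is first regularised by an
Ornstein–Uhlenbeck flow on the range of `P` (`mehler`). Its entropy is then a determinant term, a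
second moment, and the relative entropy of the output of a Gaussian channel `τ P Y + Z`
(`mehler_entropy`). This last entropy is convex in `τ`, and its slope is `τ` times the mean square
of the best estimate of `P Y` from the output (`chanEntropy_tangent`). The estimate loses accuracy
when only the projected output is seen, so its mean square is at most that of the projection of the
full estimate (`chanInfo_map_le`). That bound is linear in `P` and can be averaged. Riemann sums of
the slopes take the place of an integral in `τ`, and the regularisation is removed by lower
semicontinuity of entropy.

Consequently an Euler step `f + s 𝓛 f`, a convex combination of `f`, `Q f` and `R f`, multiplies the
entropy bound by `1 - sμN + sμN (1 - 1/(N d)) = 1 - sμ/d`. The factor `N` in front of `R` cancels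
the `1/N` of the frame constant, whence a rate independent of `N`. The Euler scheme converges to the
solution in `L¹`, and semicontinuity yields `exp (-μ t / d)`.

Finiteness of the initial entropy is separate: `√f₀ ∈ H¹` controls the positive part of `f₀ log f₀`,
and the kinetic energy controls `f₀ log γ`. Entropies are written with the nonnegative function
`klFun x = x log x + 1 - x`, so that they make sense in `[0, ∞]` without integrability assumptions.
-/

namespace KacThermostat

/-! ### The Gaussian channel and its change of measure. -/

section GaussianChannel

variable {X : Type*} [NormedAddCommGroup X] [NormedSpace ℝ X] [FiniteDimensional ℝ X]
  [MeasurableSpace X] [BorelSpace X]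

/-- `γ` is the centred Gaussian probability measure with density `Z * exp (-B x x / 2)` with
respect to the reference measure `vol`. -/
structure IsGaussianFor (vol γ : Measure X) (B : X →L[ℝ] X →L[ℝ] ℝ) (Z : ℝ) : Prop where
  symm : ∀ x y, B x y = B y x
  nonneg : ∀ x, 0 ≤ B x x
  coercive : ∃ C : ℝ, ∀ x, ‖x‖ ^ 2 ≤ C * B x x
  pos : 0 < Z
  eq_withDensity : γ = vol.withDensity fun x => ENNReal.ofReal (Z * Real.exp (-(B x x) / 2))
  prob : IsProbabilityMeasure γ
  exp_integrable : Integrable (fun x => Real.exp (B x x / 4)) γ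

/-- The density at `x` of the Gaussian law centred at `τ • b`, relative to the centred one. -/
noncomputable def tilt (B : X →L[ℝ] X →L[ℝ] ℝ) (τ : ℝ) (b x : X) : ℝ :=
  Real.exp (τ * B b x - τ ^ 2 * B b b / 2)

/-- The density of `τ • Y + Z` relative to the law of the Gaussian `Z`, where `Y` has law `m`. -/
noncomputable def evidence (B : X →L[ℝ] X →L[ℝ] ℝ) (m : Measure X) (τ : ℝ) (x : X) : ℝ :=
  ∫ b, tilt B τ b x ∂m

/-- The conditional expectation of `Y` given `τ • Y + Z = x`. -/
noncomputable def postMean (B : X →L[ℝ] X →L[ℝ] ℝ) (m : Measure X) (τ : ℝ) (x : X) : X :=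
  (evidence B m τ x)⁻¹ • ∫ b, tilt B τ b x • b ∂m

/-- The output `z + τ • b` of the Gaussian channel with input `b` and noise `z`. -/
def channel (τ : ℝ) (p : X × X) : X := p.2 + τ • p.1

variable {vol γ : Measure X} {B : X →L[ℝ] X →L[ℝ] ℝ} {Z : ℝ} {m : Measure X}

lemma tilt_pos (τ : ℝ) (b x : X) : 0 < tilt B τ b x := Real.exp_pos _

@[fun_prop]
lemma continuous_tilt (τ : ℝ) : Continuous fun p : X × X => tilt B τ p.1 p.2 := by
  unfold tilt; fun_prop

@[fun_prop]
lemma continuous_channel (τ : ℝ) : Continuous (channel τ : X × X → X) := by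
  unfold channel; fun_prop

namespace IsGaussianFor

lemma abs_le (hγ : IsGaussianFor vol γ B Z) (x y : X) : |B x y| ≤ (B x x + B y y) / 2 := by
  have h1 := hγ.nonneg (x + y)
  have h2 := hγ.nonneg (x - y)
  simp only [map_add, map_sub, add_apply, sub_apply, hγ.symm y x] at h1 h2
  rw [_root_.abs_le]; constructor <;> linarith

lemma add_le (hγ : IsGaussianFor vol γ B Z) (x y : X) :
    B (x + y) (x + y) ≤ 2 * B x x + 2 * B y y := by
  have h2 := hγ.nonneg (x - y)
  simp only [map_add, map_sub, add_apply, sub_apply, hγ.symm y x] at h2 ⊢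
  linarith

lemma channel_le (hγ : IsGaussianFor vol γ B Z) (τ : ℝ) (p : X × X) :
    B (channel τ p) (channel τ p) ≤ 2 * B p.2 p.2 + 2 * τ ^ 2 * B p.1 p.1 := by
  have := hγ.add_le p.2 (τ • p.1)
  simp only [map_smul, smul_apply, smul_eq_mul] at this
  unfold channel; nlinarith

/-- Completing the square. The bound does not depend on `b`, so integrals of the tilt converge
against any finite input law. -/
lemma tilt_le (hγ : IsGaussianFor vol γ B Z) (τ : ℝ) (b x : X) :
    tilt B τ b x ≤ Real.exp (B x x / 2) := by
  have h2 := hγ.nonneg (x - τ • b)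
  simp only [map_sub, sub_apply, map_smul, smul_apply,
    smul_eq_mul, hγ.symm x b] at h2
  unfold tilt
  gcongr
  nlinarith

lemma integrable_sq (hγ : IsGaussianFor vol γ B Z) : Integrable (fun x => B x x) γ := by
  refine (hγ.exp_integrable.const_mul 4).mono (by fun_prop) (Eventually.of_forall fun x => ?_)
  rw [Real.norm_of_nonneg (hγ.nonneg x), Real.norm_of_nonneg (by positivity)]
  linarith [Real.add_one_le_exp (B x x / 4)]

lemma lintegral_eq (hγ : IsGaussianFor vol γ B Z) (F : X → ℝ≥0∞) :
    ∫⁻ x, F x ∂γ = ∫⁻ x, ENNReal.ofReal (Z * Real.exp (-(B x x) / 2)) * F x ∂vol := by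
  rw [hγ.eq_withDensity, lintegral_withDensity_eq_lintegral_mul_non_measurable]
  · rfl
  · fun_prop
  · exact Eventually.of_forall fun x => ENNReal.ofReal_lt_top

/-- Cameron–Martin formula: after the translation by `τ • b` the ratio of the two Gaussian densities
is the tilt. -/
lemma lintegral_shift [vol.IsAddHaarMeasure] (hγ : IsGaussianFor vol γ B Z) (τ : ℝ) (b : X)
    (F : X → ℝ≥0∞) :
    ∫⁻ z, F (z + τ • b) ∂γ = ∫⁻ x, ENNReal.ofReal (tilt B τ b x) * F x ∂γ := by
  rw [hγ.lintegral_eq, hγ.lintegral_eq]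
  refine Eq.trans ?_ (lintegral_add_right_eq_self (μ := vol)
    (fun x => ENNReal.ofReal (Z * Real.exp (-(B x x) / 2)) *
      (ENNReal.ofReal (tilt B τ b x) * F x)) (τ • b))
  refine lintegral_congr fun z => ?_
  rw [← mul_assoc, ← ENNReal.ofReal_mul (by have := hγ.pos; positivity), mul_assoc Z, tilt,
    ← Real.exp_add]
  congr 4
  simp only [map_add, add_apply, map_smul, smul_apply, smul_eq_mul,
    hγ.symm z b]
  ring

/-- Joint law of input and output: the tilt is the likelihood of the output given the input.
Expectations along the channel thereby become integrals over independent variables, where Fubini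
gives Bayes' rule. -/
lemma map_shear [vol.IsAddHaarMeasure] [SFinite m] (hγ : IsGaussianFor vol γ B Z) (τ : ℝ) :
    (m.prod γ).map (fun p => (p.1, channel τ p)) =
      (m.prod γ).withDensity fun p => ENNReal.ofReal (tilt B τ p.1 p.2) := by
  have := hγ.prob
  ext s hs
  have hcont : Continuous fun p : X × X => (p.1, channel τ p) := by fun_prop
  have hK : Measurable fun p : X × X => ENNReal.ofReal (tilt B τ p.1 p.2) :=
    (continuous_tilt τ).measurable.ennreal_ofReal
  rw [← lintegral_indicator_one hs, lintegral_map (measurable_one.indicator hs) hcont.measurable,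
    withDensity_apply _ hs, ← lintegral_indicator hs,
    lintegral_prod (fun p : X × X => s.indicator 1 (p.1, channel τ p))
      (((measurable_one.indicator hs).comp hcont.measurable).aemeasurable),
    lintegral_prod _ ((hK.indicator hs).aemeasurable)]
  refine lintegral_congr fun b => ?_
  have := hγ.lintegral_shift τ b (fun x => s.indicator 1 (b, x))
  simp only [channel] at this ⊢
  rw [this]
  refine lintegral_congr fun x => ?_
  by_cases h : (b, x) ∈ s <;> simp [h]

lemma integral_shear [vol.IsAddHaarMeasure] [SFinite m] (hγ : IsGaussianFor vol γ B Z) (τ : ℝ)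
    {F : X × X → ℝ} (hF : Measurable F) :
    ∫ p, F (p.1, channel τ p) ∂(m.prod γ) = ∫ p, tilt B τ p.1 p.2 * F p ∂(m.prod γ) := by
  have hcont : Continuous fun p : X × X => (p.1, channel τ p) := by fun_prop
  have hK : Measurable fun p : X × X => tilt B τ p.1 p.2 := (continuous_tilt τ).measurable
  rw [← integral_map hcont.measurable.aemeasurable hF.aestronglyMeasurable, hγ.map_shear τ,
    integral_withDensity_eq_integral_toReal_smul hK.ennreal_ofReal
      (Eventually.of_forall fun _ => ENNReal.ofReal_lt_top)]
  simp [ENNReal.toReal_ofReal (tilt_pos _ _ _).le]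

lemma integrable_shear_iff [vol.IsAddHaarMeasure] [SFinite m] (hγ : IsGaussianFor vol γ B Z)
    (τ : ℝ) {F : X × X → ℝ} (hF : Measurable F) :
    Integrable (fun p => F (p.1, channel τ p)) (m.prod γ) ↔
      Integrable (fun p => tilt B τ p.1 p.2 * F p) (m.prod γ) := by
  have hcont : Continuous fun p : X × X => (p.1, channel τ p) := by fun_prop
  have hK : Measurable fun p : X × X => tilt B τ p.1 p.2 := (continuous_tilt τ).measurable
  have h1 := integrable_map_measure (μ := m.prod γ) (g := F) hF.aestronglyMeasurable
    hcont.measurable.aemeasurable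
  rw [hγ.map_shear τ, integrable_withDensity_iff_integrable_smul' hK.ennreal_ofReal
      (Eventually.of_forall fun _ => ENNReal.ofReal_lt_top)] at h1
  simp only [ENNReal.toReal_ofReal (tilt_pos _ _ _).le, smul_eq_mul] at h1
  exact h1.symm

end IsGaussianFor

end GaussianChannel

/-! ### Entropy of the channel output and its slope in the signal strength. -/

section ChannelEntropy

variable {X : Type*} [NormedAddCommGroup X] [NormedSpace ℝ X] [FiniteDimensional ℝ X]
  [MeasurableSpace X] [BorelSpace X]
  {vol γ : Measure X} {B : X →L[ℝ] X →L[ℝ] ℝ} {Z : ℝ} {m : Measure X}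

/-- The relative entropy of the output of the channel with respect to the Gaussian `γ`. -/
noncomputable def chanEntropy (B : X →L[ℝ] X →L[ℝ] ℝ) (m γ : Measure X) (τ : ℝ) : ℝ :=
  ∫ p, Real.log (evidence B m τ (channel τ p)) ∂(m.prod γ)

/-- The derivative in `τ` of `chanEntropy B m γ τ`. -/
noncomputable def chanInfo (B : X →L[ℝ] X →L[ℝ] ℝ) (m γ : Measure X) (τ : ℝ) : ℝ :=
  τ * ∫ p, B (postMean B m τ (channel τ p)) (postMean B m τ (channel τ p)) ∂(m.prod γ)

namespace IsGaussianFor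

lemma measurable_evidence [SFinite m] (τ : ℝ) : Measurable (evidence B m τ) := by
  have : StronglyMeasurable fun p : X × X => tilt B τ p.2 p.1 := by
    apply Continuous.stronglyMeasurable
    unfold tilt; fun_prop
  exact this.integral_prod_right'.measurable

lemma measurable_postMean [SFinite m] (τ : ℝ) : Measurable (postMean B m τ) := by
  have : StronglyMeasurable fun p : X × X => tilt B τ p.2 p.1 • p.2 := by
    apply Continuous.stronglyMeasurable
    unfold tilt; fun_prop
  exact (measurable_evidence τ).inv.smul this.integral_prod_right'.measurable

lemma norm_tilt_le (hγ : IsGaussianFor vol γ B Z) (τ : ℝ) (b x : X) :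
    ‖tilt B τ b x‖ ≤ Real.exp (B x x / 2) := by
  rw [Real.norm_of_nonneg (tilt_pos _ _ _).le]; exact hγ.tilt_le τ b x

lemma integrable_tilt_mul (hγ : IsGaussianFor vol γ B Z) (τ : ℝ) (x : X) {g : X → ℝ}
    (hg : Integrable g m) : Integrable (fun b => tilt B τ b x * g b) m := by
  refine hg.bdd_mul (c := Real.exp (B x x / 2)) ?_
    (Eventually.of_forall fun b => hγ.norm_tilt_le τ b x)
  apply Continuous.aestronglyMeasurable
  unfold tilt; fun_prop

lemma integrable_tilt [IsFiniteMeasure m] (hγ : IsGaussianFor vol γ B Z) (τ : ℝ) (x : X) :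
    Integrable (fun b => tilt B τ b x) m := by
  simpa using hγ.integrable_tilt_mul τ x (integrable_const (1 : ℝ))

lemma evidence_pos [IsProbabilityMeasure m] (hγ : IsGaussianFor vol γ B Z) (τ : ℝ) (x : X) :
    0 < evidence B m τ x := integral_exp_pos (hγ.integrable_tilt τ x)

lemma integrable_apply_left [IsFiniteMeasure m] (hγ : IsGaussianFor vol γ B Z)
    (hm : Integrable (fun b => B b b) m) (x : X) : Integrable (fun b => B b x) m := by
  refine ((hm.add (integrable_const (B x x))).div_const 2).mono' (by fun_prop)
    (Eventually.of_forall fun b => ?_)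
  exact hγ.abs_le b x

lemma integrable_id [IsFiniteMeasure m] (hγ : IsGaussianFor vol γ B Z)
    (hm : Integrable (fun b => B b b) m) : Integrable (fun b : X => b) m := by
  obtain ⟨C, hC⟩ := hγ.coercive
  refine ((hm.const_mul C).add (integrable_const 1)).mono' (by fun_prop)
    (Eventually.of_forall fun b => ?_)
  have := hC b
  simp only [Pi.add_apply]
  nlinarith [sq_nonneg (‖b‖ - 1), norm_nonneg b]

lemma integrable_tilt_smul [IsFiniteMeasure m] (hγ : IsGaussianFor vol γ B Z)
    (hm : Integrable (fun b => B b b) m) (τ : ℝ) (x : X) :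
    Integrable (fun b => tilt B τ b x • b) m := by
  refine Integrable.bdd_smul (C := Real.exp (B x x / 2)) (hγ.integrable_id hm) ?_
    (Eventually.of_forall fun b => hγ.norm_tilt_le τ b x)
  apply Continuous.aestronglyMeasurable
  unfold tilt; fun_prop

/-- Bayes' rule with the normalisation cleared, tested against a fixed vector. -/
lemma evidence_mul_apply_postMean [IsProbabilityMeasure m] (hγ : IsGaussianFor vol γ B Z)
    (hm : Integrable (fun b => B b b) m) (τ : ℝ) (x y : X) :
    evidence B m τ x * B (postMean B m τ x) y = ∫ b, tilt B τ b x * B b y ∂m := by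
  have h := (B.flip y).integral_comp_comm (hγ.integrable_tilt_smul hm τ x)
  simp only [map_smul, ContinuousLinearMap.flip_apply, smul_eq_mul] at h
  rw [h, postMean]
  simp only [map_smul, smul_apply, smul_eq_mul]
  rw [← mul_assoc, mul_inv_cancel₀ (hγ.evidence_pos τ x).ne', one_mul]

/-- Conditional Jensen inequality: `B b y ≤ (B b b + B y y) / 2` with `y` the posterior mean is
averaged over the posterior, and half of the left side is absorbed. -/
lemma evidence_mul_postMean_sq_le [IsProbabilityMeasure m] (hγ : IsGaussianFor vol γ B Z)
    (hm : Integrable (fun b => B b b) m) (τ : ℝ) (x : X) :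
    evidence B m τ x * B (postMean B m τ x) (postMean B m τ x) ≤
      ∫ b, tilt B τ b x * B b b ∂m := by
  set y := postMean B m τ x with hy
  have h1 := hγ.evidence_mul_apply_postMean hm τ x y
  have h2 : ∫ b, tilt B τ b x * B b y ∂m ≤
      ∫ b, (tilt B τ b x * B b b * (1 / 2) + tilt B τ b x * (B y y / 2)) ∂m := by
    refine integral_mono (hγ.integrable_tilt_mul τ x (hγ.integrable_apply_left hm y))
      (((hγ.integrable_tilt_mul τ x hm).mul_const _).add ((hγ.integrable_tilt τ x).mul_const _))
      fun b => ?_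
    have := (_root_.abs_le.1 (hγ.abs_le b y)).2
    have h3 := (tilt_pos (B := B) τ b x).le
    simp only []
    nlinarith
  rw [integral_add ((hγ.integrable_tilt_mul τ x hm).mul_const _)
    ((hγ.integrable_tilt τ x).mul_const _), integral_mul_const, integral_mul_const] at h2
  change _ ≤ _ + evidence B m τ x * _ at h2
  linarith

lemma evidence_le [IsProbabilityMeasure m] (hγ : IsGaussianFor vol γ B Z) (τ : ℝ) (x : X) :
    evidence B m τ x ≤ Real.exp (B x x / 2) := by
  have := integral_mono (hγ.integrable_tilt (m := m) τ x)
    (integrable_const (Real.exp (B x x / 2))) fun b => hγ.tilt_le τ b x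
  simpa [evidence] using this

/-- Above, the uniform bound of the tilt; below, Jensen's inequality for `exp`. The growth in `x` is
quadratic, which is integrable along the channel. -/
lemma abs_log_evidence_le [IsProbabilityMeasure m] (hγ : IsGaussianFor vol γ B Z)
    (hm : Integrable (fun b => B b b) m) (τ : ℝ) (x : X) :
    |Real.log (evidence B m τ x)| ≤ B x x / 2 + τ ^ 2 * ∫ b, B b b ∂m := by
  have h0 : 0 ≤ ∫ b, B b b ∂m := integral_nonneg fun b => hγ.nonneg b
  have hint : Integrable (fun b => τ * B b x - τ ^ 2 * B b b / 2) m :=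
    ((hγ.integrable_apply_left hm x).const_mul τ).sub ((hm.const_mul _).div_const 2)
  have hexp := convexOn_exp.map_integral_le Real.continuous_exp.continuousOn isClosed_univ
    (Eventually.of_forall fun _ => mem_univ _) hint (hγ.integrable_tilt τ x)
  rw [_root_.abs_le]
  constructor
  · rw [Real.le_log_iff_exp_le (hγ.evidence_pos τ x)]
    have h1 : -(B x x / 2 + τ ^ 2 * ∫ b, B b b ∂m) ≤ ∫ b, (τ * B b x - τ ^ 2 * B b b / 2) ∂m := by
      have : -(B x x / 2 + τ ^ 2 * ∫ b, B b b ∂m) = ∫ b, (-(B x x) / 2 - τ ^ 2 * B b b) ∂m := by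
        rw [integral_sub (integrable_const _) (hm.const_mul _), integral_const_mul]
        simp; ring
      rw [this]
      refine integral_mono ((integrable_const _).sub (hm.const_mul _)) hint fun b => ?_
      have := (_root_.abs_le.1 (hγ.abs_le (τ • b) x)).1
      simp only [map_smul, smul_apply, smul_eq_mul] at this ⊢
      nlinarith
    exact (Real.exp_le_exp.2 h1).trans hexp
  · have := Real.log_le_log (hγ.evidence_pos τ x) (hγ.evidence_le (m := m) τ x)
    rw [Real.log_exp] at this
    nlinarith [sq_nonneg τ]

/-- As a function of `x` the logarithm of the evidence is a log-Laplace transform, hence convex, and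
its gradient is `τ` times the posterior mean. -/
lemma log_evidence_add_ge [IsProbabilityMeasure m] (hγ : IsGaussianFor vol γ B Z)
    (hm : Integrable (fun b => B b b) m) (τ : ℝ) (x δ : X) :
    Real.log (evidence B m τ x) + τ * B (postMean B m τ x) δ ≤
      Real.log (evidence B m τ (x + δ)) := by
  have hpos := hγ.evidence_pos (m := m) τ x
  set c := τ * B (postMean B m τ x) δ with hc
  rw [Real.le_log_iff_exp_le (hγ.evidence_pos τ _), Real.exp_add, Real.exp_log hpos]
  have h1 := hγ.evidence_mul_apply_postMean hm τ x δ
  have hi := (hγ.integrable_tilt (m := m) τ x)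
  have hi2 := hγ.integrable_tilt_mul τ x (hγ.integrable_apply_left hm δ)
  -- The tangent of `exp` is taken at the posterior mean `c` of the exponent `τ * B b δ`, so that
  -- the first-order terms cancel after integration.
  have h2 : evidence B m τ x * Real.exp c = ∫ b, (tilt B τ b x * (Real.exp c * (1 - c)) +
      tilt B τ b x * B b δ * (Real.exp c * τ)) ∂m := by
    rw [integral_add (hi.mul_const _) (hi2.mul_const _), integral_mul_const, integral_mul_const,
      ← h1]
    change _ = evidence B m τ x * _ + _
    rw [hc]; ring
  rw [h2]
  refine integral_mono ((hi.mul_const _).add (hi2.mul_const _)) (hγ.integrable_tilt τ _)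
    fun b => ?_
  have h3 : tilt B τ b (x + δ) = tilt B τ b x * (Real.exp c * Real.exp (τ * B b δ - c)) := by
    rw [← Real.exp_add, tilt, tilt, ← Real.exp_add]; congr 1; simp only [map_add]; ring
  have h4 := Real.add_one_le_exp (τ * B b δ - c)
  have h5 := mul_le_mul_of_nonneg_left h4
    (mul_pos (tilt_pos (B := B) τ b x) (Real.exp_pos c)).le
  simp only []
  rw [h3]
  linarith

lemma integrable_of_growth [IsProbabilityMeasure m] (hγ : IsGaussianFor vol γ B Z)
    (hm : Integrable (fun b => B b b) m) (τ : ℝ) {φ : X → ℝ} (hφ : Measurable φ) {C D : ℝ}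
    (hC : 0 ≤ C) (h : ∀ x, |φ x| ≤ C * B x x + D) :
    Integrable (fun p => φ (channel τ p)) (m.prod γ) := by
  have := hγ.prob
  have h1 : Integrable (fun p : X × X => B p.1 p.1) (m.prod γ) := hm.comp_fst γ
  have h2 : Integrable (fun p : X × X => B p.2 p.2) (m.prod γ) := hγ.integrable_sq.comp_snd m
  refine (((h2.const_mul (C * 2)).add (h1.const_mul (C * (2 * τ ^ 2)))).add
    (integrable_const D)).mono' (hφ.comp (continuous_channel τ).measurable).aestronglyMeasurable
    (Eventually.of_forall fun p => (h _).trans ?_)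
  have := mul_le_mul_of_nonneg_left (hγ.channel_le τ p) hC
  simp only [Pi.add_apply]
  linarith

lemma integrable_log_evidence [IsProbabilityMeasure m] (hγ : IsGaussianFor vol γ B Z)
    (hm : Integrable (fun b => B b b) m) (τ τ' : ℝ) :
    Integrable (fun p => Real.log (evidence B m τ (channel τ' p))) (m.prod γ) :=
  hγ.integrable_of_growth hm τ' (φ := fun x => Real.log (evidence B m τ x))
    (measurable_evidence τ).log (C := 1 / 2)
    (D := τ ^ 2 * ∫ b, B b b ∂m) (by norm_num) fun x => (hγ.abs_log_evidence_le hm τ x).trans_eq (by ring)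

lemma integrable_prod_tilt_mul [IsProbabilityMeasure m] (hγ : IsGaussianFor vol γ B Z) (τ : ℝ)
    {φ : X → ℝ} (hφ : Measurable φ) (h : Integrable (fun x => evidence B m τ x * φ x) γ) :
    Integrable (fun p : X × X => tilt B τ p.1 p.2 * φ p.2) (m.prod γ) := by
  have := hγ.prob
  rw [integrable_prod_iff' (by
    exact ((continuous_tilt τ).measurable.mul (hφ.comp measurable_snd)).aestronglyMeasurable)]
  refine ⟨Eventually.of_forall fun x => (hγ.integrable_tilt τ x).mul_const (φ x), ?_⟩
  refine h.norm.congr (Eventually.of_forall fun x => ?_)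
  simp only [norm_mul, integral_mul_const]
  rw [Real.norm_of_nonneg (hγ.evidence_pos τ x).le]
  simp only [Real.norm_of_nonneg (tilt_pos _ _ _).le]
  rfl

lemma integrable_channel [vol.IsAddHaarMeasure] [IsProbabilityMeasure m]
    (hγ : IsGaussianFor vol γ B Z) (τ : ℝ) {φ : X → ℝ} (hφ : Measurable φ)
    (h : Integrable (fun x => evidence B m τ x * φ x) γ) :
    Integrable (fun p => φ (channel τ p)) (m.prod γ) :=
  (hγ.integrable_shear_iff τ (F := fun p => φ p.2) (hφ.comp measurable_snd)).2
    (hγ.integrable_prod_tilt_mul τ hφ h)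

lemma integral_channel [vol.IsAddHaarMeasure] [IsProbabilityMeasure m]
    (hγ : IsGaussianFor vol γ B Z) (τ : ℝ) {φ : X → ℝ} (hφ : Measurable φ)
    (h : Integrable (fun p => φ (channel τ p)) (m.prod γ)) :
    ∫ p, φ (channel τ p) ∂(m.prod γ) = ∫ x, evidence B m τ x * φ x ∂γ := by
  have := hγ.prob
  have h1 := (hγ.integrable_shear_iff τ (F := fun p => φ p.2) (hφ.comp measurable_snd)).1 h
  rw [hγ.integral_shear τ (F := fun p => φ p.2) (hφ.comp measurable_snd),
    integral_prod_symm _ h1]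
  refine integral_congr_ae (Eventually.of_forall fun x => ?_)
  simp only [integral_mul_const]; rfl

lemma integrable_evidence [vol.IsAddHaarMeasure] [IsProbabilityMeasure m]
    (hγ : IsGaussianFor vol γ B Z) (τ : ℝ) : Integrable (evidence B m τ) γ := by
  have := hγ.prob
  have h1 := (hγ.integrable_shear_iff (m := m) τ (F := fun _ => 1) measurable_const).1
    (integrable_const _)
  simp only [mul_one] at h1
  exact h1.integral_prod_right

lemma integral_evidence [vol.IsAddHaarMeasure] [IsProbabilityMeasure m]
    (hγ : IsGaussianFor vol γ B Z) (τ : ℝ) : ∫ x, evidence B m τ x ∂γ = 1 := by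
  have := hγ.prob
  have h1 := hγ.integral_channel (m := m) τ (φ := fun _ => 1) measurable_const
    (integrable_const _)
  simpa using h1.symm

/-- Gibbs' inequality: under the output law at `τ'` no probability density has a larger expected
logarithm than the true one. The proof is `log r ≤ r - 1` for the ratio `r` of the evidences, whose
expectation is `1`. -/
lemma integral_log_evidence_le [vol.IsAddHaarMeasure] [IsProbabilityMeasure m]
    (hγ : IsGaussianFor vol γ B Z) (hm : Integrable (fun b => B b b) m) (τ τ' : ℝ) :
    ∫ p, Real.log (evidence B m τ (channel τ' p)) ∂(m.prod γ) ≤ chanEntropy B m γ τ' := by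
  have := hγ.prob
  have hmeas : Measurable fun x => evidence B m τ x / evidence B m τ' x :=
    (measurable_evidence τ).div (measurable_evidence τ')
  have heq : (fun x => evidence B m τ' x * (evidence B m τ x / evidence B m τ' x)) =
      evidence B m τ := by
    funext x
    have := (hγ.evidence_pos (m := m) τ' x).ne'
    field_simp
  have hint := hγ.integrable_channel τ' hmeas (by rw [heq]; exact hγ.integrable_evidence τ)
  have hval := hγ.integral_channel τ' hmeas hint
  rw [heq, hγ.integral_evidence] at hval
  have h1 := hγ.integrable_log_evidence hm τ τ'
  have h2 := hγ.integrable_log_evidence hm τ' τ'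
  have h3 : ∫ p, (Real.log (evidence B m τ (channel τ' p)) -
      Real.log (evidence B m τ' (channel τ' p))) ∂(m.prod γ) ≤
      ∫ p, (evidence B m τ (channel τ' p) / evidence B m τ' (channel τ' p) - 1) ∂(m.prod γ) := by
    refine integral_mono (h1.sub h2) (hint.sub (integrable_const 1)) fun p => ?_
    have p1 := hγ.evidence_pos (m := m) τ (channel τ' p)
    have p2 := hγ.evidence_pos (m := m) τ' (channel τ' p)
    simp only []
    rw [← Real.log_div p1.ne' p2.ne']
    exact Real.log_le_sub_one_of_pos (div_pos p1 p2)
  rw [integral_sub h1 h2, integral_sub hint (integrable_const 1), hval] at h3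
  simp at h3
  exact h3

lemma integrable_postMean_sq [vol.IsAddHaarMeasure] [IsProbabilityMeasure m]
    (hγ : IsGaussianFor vol γ B Z) (hm : Integrable (fun b => B b b) m) (τ : ℝ) :
    Integrable (fun p => B (postMean B m τ (channel τ p)) (postMean B m τ (channel τ p)))
      (m.prod γ) := by
  have := hγ.prob
  have hy := measurable_postMean (B := B) (m := m) τ
  have hB : Continuous fun x : X => B x x := by fun_prop
  have hmeas : Measurable fun x => B (postMean B m τ x) (postMean B m τ x) :=
    hB.measurable.comp hy
  refine hγ.integrable_channel τ hmeas ?_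
  have h1 := (hγ.integrable_shear_iff (m := m) τ (F := fun p => B p.1 p.1) (by fun_prop)).1
    (hm.comp_fst γ)
  refine h1.integral_prod_right.mono' ((measurable_evidence τ).mul hmeas).aestronglyMeasurable
    (Eventually.of_forall fun x => ?_)
  rw [Real.norm_of_nonneg (mul_nonneg (hγ.evidence_pos τ x).le (hγ.nonneg _))]
  exact hγ.evidence_mul_postMean_sq_le hm τ x

/-- The tower property of the conditional expectation `postMean`. -/
lemma integral_apply_channel [vol.IsAddHaarMeasure] [IsProbabilityMeasure m]
    (hγ : IsGaussianFor vol γ B Z) (hm : Integrable (fun b => B b b) m) (τ : ℝ) {φ : X → X}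
    (hφ : Measurable φ)
    (h : Integrable (fun p => B (φ (channel τ p)) (φ (channel τ p))) (m.prod γ)) :
    ∫ p, B p.1 (φ (channel τ p)) ∂(m.prod γ) =
      ∫ p, B (postMean B m τ (channel τ p)) (φ (channel τ p)) ∂(m.prod γ) := by
  have := hγ.prob
  have hy := measurable_postMean (B := B) (m := m) τ
  have hc := (continuous_channel (X := X) τ).measurable
  have hB : Continuous fun p : X × X => B p.1 p.2 := by fun_prop
  have m1 : Measurable fun p : X × X => B p.1 (φ p.2) :=
    hB.measurable.comp (measurable_fst.prodMk (hφ.comp measurable_snd))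
  have m2 : Measurable fun p : X × X => B (postMean B m τ p.2) (φ p.2) :=
    hB.measurable.comp ((hy.comp measurable_snd).prodMk (hφ.comp measurable_snd))
  have i1 : Integrable (fun p => B p.1 (φ (channel τ p))) (m.prod γ) := by
    refine (((hm.comp_fst γ).add h).div_const 2).mono'
      (m1.comp (measurable_fst.prodMk hc)).aestronglyMeasurable
      (Eventually.of_forall fun p => hγ.abs_le _ _)
  have i2 : Integrable (fun p => B (postMean B m τ (channel τ p)) (φ (channel τ p)))
      (m.prod γ) := by
    refine (((hγ.integrable_postMean_sq hm τ).add h).div_const 2).mono'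
      (m2.comp (measurable_fst.prodMk hc)).aestronglyMeasurable
      (Eventually.of_forall fun p => hγ.abs_le _ _)
  rw [hγ.integral_shear τ m1, hγ.integral_shear τ m2,
    integral_prod_symm _ ((hγ.integrable_shear_iff τ m1).1 i1),
    integral_prod_symm _ ((hγ.integrable_shear_iff τ m2).1 i2)]
  refine integral_congr_ae (Eventually.of_forall fun x => ?_)
  simp only [integral_mul_const]
  exact (hγ.evidence_mul_apply_postMean hm τ x (φ x)).symm

/-- The entropy of the channel lies above its tangents. -/
lemma chanEntropy_tangent [vol.IsAddHaarMeasure] [IsProbabilityMeasure m]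
    (hγ : IsGaussianFor vol γ B Z) (hm : Integrable (fun b => B b b) m) (τ τ' : ℝ) :
    chanEntropy B m γ τ + (τ' - τ) * chanInfo B m γ τ ≤ chanEntropy B m γ τ' := by
  have := hγ.prob
  -- No derivative in `τ` is taken. Gibbs' inequality freezes the evidence at `τ`. The output at
  -- `τ'` is then the output at `τ` shifted by `(τ' - τ) • b`, so convexity in the space variable
  -- applies, and the tower property replaces `b` by its posterior mean.
  refine le_trans ?_ (hγ.integral_log_evidence_le hm τ τ')
  have hy := measurable_postMean (B := B) (m := m) τ
  have hc := (continuous_channel (X := X) τ).measurable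
  have hsq := hγ.integrable_postMean_sq hm τ
  have htower := hγ.integral_apply_channel hm τ hy hsq
  have hB : Continuous fun p : X × X => B p.1 p.2 := by fun_prop
  have hi : Integrable (fun p => B p.1 (postMean B m τ (channel τ p))) (m.prod γ) := by
    refine (((hm.comp_fst γ).add hsq).div_const 2).mono'
      (hB.measurable.comp (measurable_fst.prodMk (hy.comp hc))).aestronglyMeasurable
      (Eventually.of_forall fun p => hγ.abs_le _ _)
  have h1 := hγ.integrable_log_evidence hm τ τ
  rw [chanEntropy, chanInfo, ← htower, ← mul_assoc, ← integral_const_mul,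
    ← integral_add h1 (hi.const_mul _)]
  refine integral_mono (h1.add (hi.const_mul _)) (hγ.integrable_log_evidence hm τ τ') fun p => ?_
  have h2 := hγ.log_evidence_add_ge hm τ (channel τ p) ((τ' - τ) • p.1)
  have h3 : channel τ p + (τ' - τ) • p.1 = channel τ' p := by
    unfold channel; module
  rw [h3] at h2
  refine le_trans (le_of_eq ?_) h2
  simp only [map_smul, smul_eq_mul, hγ.symm p.1]
  ring

lemma chanEntropy_zero [IsProbabilityMeasure m] : chanEntropy B m γ 0 = 0 := by
  simp [chanEntropy, evidence, tilt]

lemma chanInfo_nonneg (hγ : IsGaussianFor vol γ B Z) {τ : ℝ} (hτ : 0 ≤ τ) :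
    0 ≤ chanInfo B m γ τ :=
  mul_nonneg hτ (integral_nonneg fun _ => hγ.nonneg _)

end IsGaussianFor

end ChannelEntropy

/-! ### The channel with projected input. -/

section Projection

variable {X : Type*} [NormedAddCommGroup X] [NormedSpace ℝ X] [FiniteDimensional ℝ X]
  [MeasurableSpace X] [BorelSpace X]
  {vol γ : Measure X} {B : X →L[ℝ] X →L[ℝ] ℝ} {Z : ℝ} {m : Measure X} {P : X →L[ℝ] X}

/-- `P` is an orthogonal projection with respect to the bilinear form `B`. -/
structure IsOrthProj (B : X →L[ℝ] X →L[ℝ] ℝ) (P : X →L[ℝ] X) : Prop where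
  idem : ∀ x, P (P x) = P x
  symm : ∀ x y, B (P x) y = B x (P y)

namespace IsOrthProj

lemma apply_apply (hP : IsOrthProj B P) (x y : X) : B (P x) (P y) = B (P x) y := by
  rw [hP.symm, hP.idem, hP.symm]

lemma apply_self_le (hγ : IsGaussianFor vol γ B Z) (hP : IsOrthProj B P) (x : X) :
    B (P x) (P x) ≤ B x x := by
  have h := hγ.nonneg (x - P x)
  simp only [map_sub, sub_apply, hP.apply_apply, ← hP.symm x x] at h ⊢
  linarith

lemma integrable_map (hγ : IsGaussianFor vol γ B Z) (hP : IsOrthProj B P)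
    (hm : Integrable (fun b => B b b) m) : Integrable (fun b => B b b) (m.map P) := by
  rw [integrable_map_measure (by fun_prop) P.continuous.measurable.aemeasurable]
  refine hm.mono' (by fun_prop) (Eventually.of_forall fun x => ?_)
  simp only [Function.comp]
  rw [Real.norm_of_nonneg (hγ.nonneg _)]
  exact hP.apply_self_le hγ x

lemma tilt_map (hP : IsOrthProj B P) (τ : ℝ) (b x : X) :
    tilt B τ (P b) (P x) = tilt B τ (P b) x := by
  rw [tilt, tilt, hP.apply_apply]

lemma evidence_map (τ : ℝ) (x : X) :
    evidence B (m.map P) τ x = ∫ b, tilt B τ (P b) x ∂m := by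
  rw [evidence, integral_map P.continuous.measurable.aemeasurable]
  apply Continuous.aestronglyMeasurable
  unfold tilt; fun_prop

lemma evidence_map_apply (hP : IsOrthProj B P) (τ : ℝ) (x : X) :
    evidence B (m.map P) τ (P x) = evidence B (m.map P) τ x := by
  simp only [evidence_map, hP.tilt_map]

/-- An input in the range of `P` is seen by the tilt only through `P x`, so the noise orthogonal to
the range carries no information. -/
lemma postMean_map_apply (hP : IsOrthProj B P) (τ : ℝ) (x : X) :
    postMean B (m.map P) τ (P x) = postMean B (m.map P) τ x := by
  have h : ∀ x, ∫ b, tilt B τ b x • b ∂(m.map P) = ∫ b, tilt B τ (P b) x • P b ∂m := fun x => by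
    rw [integral_map P.continuous.measurable.aemeasurable]
    apply Continuous.aestronglyMeasurable
    unfold tilt; fun_prop
  simp only [postMean, hP.evidence_map_apply, h, hP.tilt_map]

lemma map_channel (hP : IsOrthProj B P) (τ : ℝ) (p : X × X) :
    P (channel τ (P p.1, p.2)) = P (channel τ p) := by
  simp [channel, hP.idem]

lemma integral_map_prod [SFinite m] [SFinite γ] {F : X × X → ℝ} (hF : Measurable F) :
    ∫ p, F p ∂((m.map P).prod γ) = ∫ p, F (P p.1, p.2) ∂(m.prod γ) := by
  have h := Measure.map_prod_map m γ P.continuous.measurable measurable_id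
  rw [Measure.map_id] at h
  rw [h, integral_map (by fun_prop) hF.aestronglyMeasurable]
  rfl

lemma integrable_map_prod [SFinite m] [SFinite γ] {F : X × X → ℝ} (hF : Measurable F)
    (h : Integrable F ((m.map P).prod γ)) :
    Integrable (fun p => F (P p.1, p.2)) (m.prod γ) := by
  have h' := Measure.map_prod_map m γ P.continuous.measurable measurable_id
  rw [Measure.map_id] at h'
  rw [h', integrable_map_measure hF.aestronglyMeasurable (by fun_prop)] at h
  exact h

lemma integrable_quadratic [SFinite m] (hγ : IsGaussianFor vol γ B Z) (hP : IsOrthProj B P)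
    {φ : X × X → X} (hφ : Measurable φ) (h : Integrable (fun p => B (φ p) (φ p)) (m.prod γ)) :
    Integrable (fun p => B (P (φ p)) (φ p)) (m.prod γ) := by
  have hB : Continuous fun x : X => B (P x) x := by fun_prop
  refine h.mono' (hB.measurable.comp hφ).aestronglyMeasurable (Eventually.of_forall fun p => ?_)
  rw [← hP.apply_apply, Real.norm_of_nonneg (hγ.nonneg _)]
  exact hP.apply_self_le hγ _

/-- The information of the projected channel is at most the projected information. -/
lemma chanInfo_map_le [vol.IsAddHaarMeasure] [IsProbabilityMeasure m]
    (hγ : IsGaussianFor vol γ B Z) (hP : IsOrthProj B P)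
    (hm : Integrable (fun b => B b b) m) {τ : ℝ} (hτ : 0 ≤ τ) :
    chanInfo B (m.map P) γ τ ≤
      τ * ∫ p, B (P (postMean B m τ (channel τ p))) (postMean B m τ (channel τ p))
        ∂(m.prod γ) := by
  have := hγ.prob
  have : IsProbabilityMeasure (m.map P) :=
    Measure.isProbabilityMeasure_map P.continuous.measurable.aemeasurable
  have hmP := hP.integrable_map hγ hm
  refine mul_le_mul_of_nonneg_left ?_ hτ
  have hc := (continuous_channel (X := X) τ).measurable
  have hB : Continuous fun p : X × X => B p.1 p.2 := by fun_prop
  have hBx : Continuous fun x : X => B x x := by fun_prop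
  have hy := IsGaussianFor.measurable_postMean (B := B) (m := m) τ
  have hyP := IsGaussianFor.measurable_postMean (B := B) (m := m.map P) τ
  -- The outputs with inputs `P Y` and `Y` have the same image under `P`, so both estimates can be
  -- compared on one probability space.
  have hinv : ∀ p, postMean B (m.map P) τ (channel τ (P p.1, p.2)) =
      postMean B (m.map P) τ (channel τ p) := fun p => by
    rw [← hP.postMean_map_apply, hP.map_channel, hP.postMean_map_apply]
  set yP := postMean B (m.map P) τ with hyPdef
  set y := postMean B m τ with hydef
  have msq : Measurable fun p => B (yP (channel τ p)) (yP (channel τ p)) :=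
    hBx.measurable.comp (hyP.comp hc)
  have mfst : Measurable fun p : X × X => B p.1 (yP (channel τ p)) :=
    hB.measurable.comp (measurable_fst.prodMk (hyP.comp hc))
  have hsq := hγ.integrable_postMean_sq hmP τ
  have hsq' : Integrable (fun p => B (yP (channel τ p)) (yP (channel τ p))) (m.prod γ) := by
    have := integrable_map_prod msq hsq
    simpa only [hinv] using this
  have e1 : ∫ p, B (yP (channel τ p)) (yP (channel τ p)) ∂((m.map P).prod γ) =
      ∫ p, B (yP (channel τ p)) (yP (channel τ p)) ∂(m.prod γ) := by
    rw [integral_map_prod msq]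
    simp only [hinv]
  have e2 : ∫ p, B (yP (channel τ p)) (yP (channel τ p)) ∂((m.map P).prod γ) =
      ∫ p, B (P p.1) (yP (channel τ p)) ∂(m.prod γ) := by
    rw [← hγ.integral_apply_channel hmP τ hyP hsq, integral_map_prod mfst]
    simp only [hinv]
  have hPyP : Integrable (fun p => B (P (yP (channel τ p))) (P (yP (channel τ p))))
      (m.prod γ) := by
    have := hP.integrable_quadratic hγ (φ := fun p => yP (channel τ p)) (hyP.comp hc) hsq'
    simpa only [hP.apply_apply] using this
  have e3 : ∫ p, B (P p.1) (yP (channel τ p)) ∂(m.prod γ) =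
      ∫ p, B (y (channel τ p)) (P (yP (channel τ p))) ∂(m.prod γ) := by
    rw [← hγ.integral_apply_channel hm τ (φ := fun x => P (yP x))
      (P.continuous.measurable.comp hyP) hPyP]
    simp only [hP.symm]
  have hsqm := hP.integrable_quadratic hγ (φ := fun p => y (channel τ p)) (hy.comp hc) (hγ.integrable_postMean_sq hm τ)
  -- Two uses of the tower property have given `E B(yP, yP) = E B(y, P yP)`. Cauchy–Schwarz in
  -- arithmetic form lets half of the left side be absorbed.
  have e4 : ∫ p, B (y (channel τ p)) (P (yP (channel τ p))) ∂(m.prod γ) ≤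
      ∫ p, (B (P (y (channel τ p))) (y (channel τ p)) +
        B (yP (channel τ p)) (yP (channel τ p))) / 2 ∂(m.prod γ) := by
    have hle : ∀ p, |B (y (channel τ p)) (P (yP (channel τ p)))| ≤
        (B (P (y (channel τ p))) (y (channel τ p)) +
          B (yP (channel τ p)) (yP (channel τ p))) / 2 := fun p => by
      rw [← hP.symm, ← hP.apply_apply (y _) (y _)]
      exact hγ.abs_le _ _
    have hdom := (hsqm.add hsq').div_const 2
    refine integral_mono (hdom.mono' ?_ (Eventually.of_forall hle)) hdom
      fun p => (le_abs_self _).trans (hle p)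
    exact (hB.measurable.comp ((hy.comp hc).prodMk
      (P.continuous.measurable.comp (hyP.comp hc)))).aestronglyMeasurable
  rw [integral_div, integral_add hsqm hsq'] at e4
  linarith

end IsOrthProj

end Projection

/-! ### Riemann sums for a convex function. -/

section ConvexSums

/-- Riemann sums of the slopes of a convex function. -/
lemma sum_tangent_bounds {D J : ℝ → ℝ} (h : ∀ s s', D s + (s' - s) * J s ≤ D s') (h0 : D 0 = 0)
    {τ : ℝ} {K : ℕ} (hK : K ≠ 0) :
    D τ ≤ ∑ k ∈ Finset.range K, τ / K * J ((k + 1 : ℕ) * (τ / K)) ∧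
      ∑ k ∈ Finset.range K, τ / K * J (k * (τ / K)) ≤ D τ := by
  have hKr : (K : ℝ) ≠ 0 := by exact_mod_cast hK
  have key : ∑ k ∈ Finset.range K, (D ((k + 1 : ℕ) * (τ / K)) - D (k * (τ / K))) = D τ := by
    rw [Finset.sum_range_sub fun k : ℕ => D (k * (τ / K))]
    simp [h0, mul_div_cancel₀ _ hKr]
  constructor
  -- Each increment is bounded by the tangent at its right endpoint, and in the second part by the
  -- tangent at its left endpoint. Neither monotonicity nor integrability of `J` enters.
  · conv_lhs => rw [← key]
    refine Finset.sum_le_sum fun k _ => ?_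
    have := h ((k + 1 : ℕ) * (τ / K)) (k * (τ / K))
    push_cast at this ⊢
    linarith
  · conv_rhs => rw [← key]
    refine Finset.sum_le_sum fun k _ => ?_
    have := h (k * (τ / K)) ((k + 1 : ℕ) * (τ / K))
    push_cast at this ⊢
    linarith

end ConvexSums

/-! ### Averages over random measure-preserving maps. -/

section MarkovAverage

open InformationTheory

variable {X Ω : Type*} [MeasurableSpace X] [MeasurableSpace Ω] {γ : Measure X} {ν : Measure Ω}
  {T : X × Ω → X} {h h' : X → ℝ}

/-- The relative entropy of the density `h` with respect to `γ`, as an extended number. -/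
noncomputable def klEntropy (γ : Measure X) (h : X → ℝ) : ℝ≥0∞ :=
  ∫⁻ x, ENNReal.ofReal (klFun (h x)) ∂γ

/-- The average of `h` over the random maps `x ↦ T (x, w)`. -/
noncomputable def average (ν : Measure Ω) (T : X × Ω → X) (h : X → ℝ) (x : X) : ℝ :=
  ∫ w, h (T (x, w)) ∂ν

lemma klEntropy_congr (hh : h =ᵐ[γ] h') : klEntropy γ h = klEntropy γ h' :=
  lintegral_congr_ae (hh.mono fun x hx => by simp only [hx])

/-- Jensen's inequality for `klFun`. -/
lemma ofReal_klFun_integral_le [IsProbabilityMeasure ν] {g : Ω → ℝ} (hg : Integrable g ν)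
    (h0 : 0 ≤ᵐ[ν] g) :
    ENNReal.ofReal (klFun (∫ w, g w ∂ν)) ≤ ∫⁻ w, ENNReal.ofReal (klFun (g w)) ∂ν := by
  by_cases hint : Integrable (fun w => klFun (g w)) ν
  · rw [← ofReal_integral_eq_lintegral_ofReal hint (h0.mono fun w hw => klFun_nonneg hw)]
    exact ENNReal.ofReal_le_ofReal (convexOn_klFun.map_integral_le
      continuous_klFun.continuousOn isClosed_Ici h0 hg hint)
  · have : ∫⁻ w, ENNReal.ofReal (klFun (g w)) ∂ν = ⊤ := by
      by_contra hne
      refine hint ⟨continuous_klFun.comp_aestronglyMeasurable hg.1, ?_⟩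
      rw [hasFiniteIntegral_iff_ofReal (h0.mono fun w hw => klFun_nonneg hw)]
      exact lt_top_iff_ne_top.2 hne
    rw [this]; exact le_top

variable [SFinite γ] [IsProbabilityMeasure ν]

lemma measurable_average (hT : Measurable T) (hh : Measurable h) :
    Measurable (average ν T h) :=
  ((hh.comp hT).stronglyMeasurable.integral_prod_right').measurable

lemma integrable_comp (hT : MeasurePreserving T (γ.prod ν) γ) (hh : Integrable h γ) :
    Integrable (fun p => h (T p)) (γ.prod ν) := hT.integrable_comp_of_integrable hh

lemma integrable_average (hT : MeasurePreserving T (γ.prod ν) γ) (hh : Integrable h γ) :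
    Integrable (average ν T h) γ := (integrable_comp hT hh).integral_prod_left

lemma ae_integrable_average (hT : MeasurePreserving T (γ.prod ν) γ) (hh : Integrable h γ) :
    ∀ᵐ x ∂γ, Integrable (fun w => h (T (x, w))) ν := (integrable_comp hT hh).prod_right_ae

lemma integral_average (hT : MeasurePreserving T (γ.prod ν) γ) (hh : Integrable h γ) :
    ∫ x, average ν T h x ∂γ = ∫ x, h x ∂γ := by
  have h1 := integral_prod _ (integrable_comp hT hh)
  have h2 := integral_map (μ := γ.prod ν) hT.measurable.aemeasurable (f := h)
    (by rw [hT.map_eq]; exact hh.1)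
  rw [hT.map_eq] at h2
  exact (h2.trans h1).symm

lemma average_nonneg (h0 : ∀ x, 0 ≤ h x) (x : X) : 0 ≤ average ν T h x :=
  integral_nonneg fun _ => h0 _

lemma average_congr (hT : MeasurePreserving T (γ.prod ν) γ) (hh : h =ᵐ[γ] h') :
    average ν T h =ᵐ[γ] average ν T h' := by
  have h1 : ∀ᵐ p ∂(γ.prod ν), h (T p) = h' (T p) := hT.quasiMeasurePreserving.ae hh
  filter_upwards [Measure.ae_ae_of_ae_prod h1] with x hx
  exact integral_congr_ae hx

lemma average_add (hT : MeasurePreserving T (γ.prod ν) γ) (hh : Integrable h γ)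
    (hh' : Integrable h' γ) :
    average ν T (fun x => h x + h' x) =ᵐ[γ] fun x => average ν T h x + average ν T h' x := by
  filter_upwards [ae_integrable_average hT hh, ae_integrable_average hT hh'] with x h1 h2
  exact integral_add h1 h2

lemma average_sub (hT : MeasurePreserving T (γ.prod ν) γ) (hh : Integrable h γ)
    (hh' : Integrable h' γ) :
    average ν T (fun x => h x - h' x) =ᵐ[γ] fun x => average ν T h x - average ν T h' x := by
  filter_upwards [ae_integrable_average hT hh, ae_integrable_average hT hh'] with x h1 h2
  exact integral_sub h1 h2

lemma average_const_mul (c : ℝ) (x : X) :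
    average ν T (fun x => c * h x) x = c * average ν T h x := integral_const_mul _ _

lemma integral_abs_average_le (hT : MeasurePreserving T (γ.prod ν) γ) (hh : Integrable h γ) :
    ∫ x, |average ν T h x| ∂γ ≤ ∫ x, |h x| ∂γ := by
  rw [← integral_average hT hh.abs]
  exact integral_mono (integrable_average hT hh).abs (integrable_average hT hh.abs)
    fun x => abs_integral_le_integral_abs

/-- Jensen's inequality in the random parameter, then invariance of `γ`. -/
lemma klEntropy_average_le (hT : MeasurePreserving T (γ.prod ν) γ) (hm : Measurable h)
    (hh : Integrable h γ) (h0 : ∀ x, 0 ≤ h x) :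
    klEntropy γ (average ν T h) ≤ klEntropy γ h := by
  have hmeas : Measurable fun x => ENNReal.ofReal (klFun (h x)) :=
    (measurable_klFun.comp hm).ennreal_ofReal
  calc klEntropy γ (average ν T h)
      ≤ ∫⁻ x, ∫⁻ w, ENNReal.ofReal (klFun (h (T (x, w)))) ∂ν ∂γ := by
        refine lintegral_mono_ae ?_
        filter_upwards [ae_integrable_average hT hh] with x hx
        exact ofReal_klFun_integral_le hx (Eventually.of_forall fun _ => h0 _)
    _ = ∫⁻ p, ENNReal.ofReal (klFun (h (T p))) ∂(γ.prod ν) :=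
        (lintegral_prod _ (hmeas.comp hT.measurable).aemeasurable).symm
    _ = klEntropy γ h := hT.lintegral_comp hmeas

end MarkovAverage

/-! ### Linear involutions and invariant densities. -/

section Involution

variable {E : Type*} [NormedAddCommGroup E] [NormedSpace ℝ E] [FiniteDimensional ℝ E]
  [MeasurableSpace E] [BorelSpace E]

/-- The determinant squares to `1`. -/
lemma measurePreserving_of_involutive (μ : Measure E) [μ.IsAddHaarMeasure] (T : E →L[ℝ] E)
    (hT : ∀ x, T (T x) = x) : MeasurePreserving T μ μ := by
  refine ⟨T.continuous.measurable, ?_⟩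
  have h1 : (T : E →ₗ[ℝ] E) * (T : E →ₗ[ℝ] E) = 1 := LinearMap.ext hT
  have h2 := congrArg LinearMap.det h1
  rw [map_mul, map_one] at h2
  have h3 : LinearMap.det (T : E →ₗ[ℝ] E) ≠ 0 := fun h => by simp [h] at h2
  have h4 : |(LinearMap.det (T : E →ₗ[ℝ] E))⁻¹| = 1 := by
    rcases mul_self_eq_one_iff.1 h2 with h | h <;> simp [h]
  have := Measure.map_linearMap_addHaar_eq_smul_addHaar μ h3
  rw [h4, ENNReal.ofReal_one, one_smul] at this
  exact this

lemma measurePreserving_withDensity {α : Type*} [MeasurableSpace α] {μ : Measure α} {T : α → α}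
    (hT : MeasurePreserving T μ μ) {g : α → ℝ≥0∞} (hg : Measurable g) (hgT : ∀ x, g (T x) = g x) :
    MeasurePreserving T (μ.withDensity g) (μ.withDensity g) := by
  refine ⟨hT.measurable, ?_⟩
  ext s hs
  rw [Measure.map_apply hT.measurable hs, withDensity_apply _ hs,
    withDensity_apply _ (hT.measurable hs), ← lintegral_indicator hs,
    ← lintegral_indicator (hT.measurable hs), ← hT.lintegral_comp (hg.indicator hs)]
  refine lintegral_congr fun x => ?_
  by_cases hx : T x ∈ s <;> simp [hx, hgT]

end Involution

/-! ### The Ornstein–Uhlenbeck flow on the range of a projection. -/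

section Mehler

open InformationTheory

variable {X : Type*} [NormedAddCommGroup X] [NormedSpace ℝ X] [FiniteDimensional ℝ X]
  [MeasurableSpace X] [BorelSpace X]
  {vol γ : Measure X} {B : X →L[ℝ] X →L[ℝ] ℝ} {Z : ℝ} {P : X →L[ℝ] X} {a b : ℝ} {h : X → ℝ}

/-- The map `(u, x) ↦ a P u + b P x + (1 - P) x`. -/
def mix (a b : ℝ) (P : X →L[ℝ] X) (p : X × X) : X :=
  a • P p.1 + b • P p.2 + (p.2 - P p.2)

/-- The involution of `X × X` whose first component is `mix a b P`. -/
def mixInvolution (a b : ℝ) (P : X →L[ℝ] X) : X × X →L[ℝ] X × X :=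
  ((a • P).comp (ContinuousLinearMap.fst ℝ X X) + (b • P).comp (ContinuousLinearMap.snd ℝ X X) +
    (ContinuousLinearMap.id ℝ X - P).comp (ContinuousLinearMap.snd ℝ X X)).prod
  ((b • P).comp (ContinuousLinearMap.fst ℝ X X) - (a • P).comp (ContinuousLinearMap.snd ℝ X X) +
    (ContinuousLinearMap.id ℝ X - P).comp (ContinuousLinearMap.fst ℝ X X))

lemma mixInvolution_apply (p : X × X) : mixInvolution a b P p =
    (mix a b P p, b • P p.1 - a • P p.2 + (p.1 - P p.1)) := rfl

/-- The Ornstein–Uhlenbeck semigroup on the range of `P`, combined with the conditional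
expectation given `P`. -/
noncomputable def mehler (γ : Measure X) (a b : ℝ) (P : X →L[ℝ] X) (h : X → ℝ) : X → ℝ :=
  average γ (mix a b P) h

@[fun_prop]
lemma continuous_mix : Continuous (mix a b P) := by unfold mix; fun_prop

namespace IsOrthProj

/-- On the range of `P` the map acts on pairs by the reflection matrix with rows `(a, b)` and `(b,
-a)`; on the kernel of `P` it swaps the two entries. Both are involutions and isometries, which also
explains `mixInvolution_sq`. -/
lemma mixInvolution_involutive (hP : IsOrthProj B P) (hab : a ^ 2 + b ^ 2 = 1) (p : X × X) :
    mixInvolution a b P (mixInvolution a b P p) = p := by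
  obtain ⟨u, x⟩ := p
  simp only [mixInvolution_apply, mix, map_add, map_sub, map_smul, hP.idem, Prod.mk.injEq]
  constructor
  · match_scalars <;> first | ring1 | linear_combination hab
  · match_scalars <;> first | ring1 | linear_combination hab

lemma mixInvolution_sq (hγ : IsGaussianFor vol γ B Z) (hP : IsOrthProj B P)
    (hab : a ^ 2 + b ^ 2 = 1) (p : X × X) :
    B (mixInvolution a b P p).1 (mixInvolution a b P p).1 +
      B (mixInvolution a b P p).2 (mixInvolution a b P p).2 = B p.1 p.1 + B p.2 p.2 := by
  obtain ⟨u, x⟩ := p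
  simp only [mixInvolution_apply, mix, map_add, map_sub, map_smul, add_apply, sub_apply,
    smul_apply, smul_eq_mul, hP.apply_apply, ← hP.symm]
  have h1 : B (P x) u = B (P u) x := by rw [hP.symm, hγ.symm]
  rw [h1]
  linear_combination (B (P u) u + B (P x) x) * hab

end IsOrthProj

namespace IsGaussianFor

lemma prod_eq_withDensity [vol.IsAddHaarMeasure] (hγ : IsGaussianFor vol γ B Z) :
    γ.prod γ = (vol.prod vol).withDensity fun p =>
      ENNReal.ofReal (Z ^ 2 * Real.exp (-(B p.1 p.1 + B p.2 p.2) / 2)) := by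
  rw [hγ.eq_withDensity, prod_withDensity (by fun_prop) (by fun_prop)]
  congr 1
  funext p
  rw [← ENNReal.ofReal_mul (by have := hγ.pos; positivity), pow_two, mul_mul_mul_comm,
    ← Real.exp_add]
  congr 3
  ring

lemma measurePreserving_mixInvolution [vol.IsAddHaarMeasure] (hγ : IsGaussianFor vol γ B Z)
    (hP : IsOrthProj B P) (hab : a ^ 2 + b ^ 2 = 1) :
    MeasurePreserving (mixInvolution a b P) (γ.prod γ) (γ.prod γ) := by
  rw [hγ.prod_eq_withDensity]
  refine measurePreserving_withDensity
    (measurePreserving_of_involutive _ _ (hP.mixInvolution_involutive hab)) (by fun_prop)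
    fun p => ?_
  rw [hP.mixInvolution_sq hγ hab]

lemma measurePreserving_mix [vol.IsAddHaarMeasure] (hγ : IsGaussianFor vol γ B Z)
    (hP : IsOrthProj B P) (hab : a ^ 2 + b ^ 2 = 1) :
    MeasurePreserving (mix a b P) (γ.prod γ) γ := by
  have := hγ.prob
  exact measurePreserving_fst.comp (hγ.measurePreserving_mixInvolution hP hab)

/-- The probability measure with density `h` with respect to `γ`. -/
lemma isProbabilityMeasure_withDensity (hh : Integrable h γ) (h0 : ∀ x, 0 ≤ h x)
    (h1 : ∫ x, h x ∂γ = 1) : IsProbabilityMeasure (γ.withDensity fun x => .ofReal (h x)) := by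
  constructor
  rw [withDensity_apply _ MeasurableSet.univ, Measure.restrict_univ,
    ← ofReal_integral_eq_lintegral_ofReal hh (Eventually.of_forall h0), h1, ENNReal.ofReal_one]

/-- A linear substitution turns the Mehler kernel into the likelihood of a Gaussian channel with
input `P Y`, where `Y` has density `h`, signal strength `a / b` and output `b⁻¹ • u`. -/
lemma mehler_eq [vol.IsAddHaarMeasure] (hγ : IsGaussianFor vol γ B Z)
    (hP : IsOrthProj B P) (hab : a ^ 2 + b ^ 2 = 1) (hb : b ≠ 0) (hm : Measurable h)
    (h0 : ∀ x, 0 ≤ h x) (u : X) :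
    mehler γ a b P h u = |(LinearMap.det (b • (P : X →ₗ[ℝ] X) + (1 - (P : X →ₗ[ℝ] X))))⁻¹| *
      (Real.exp (-((a / b) ^ 2 * B (P u) u / 2)) *
      evidence B ((γ.withDensity fun x => .ofReal (h x)).map P) (a / b) (b⁻¹ • u)) := by
  set S : X →ₗ[ℝ] X := b • (P : X →ₗ[ℝ] X) + (1 - (P : X →ₗ[ℝ] X)) with hS
  have hSx : ∀ x, S x = b • P x + (x - P x) := fun x => rfl
  set S' : X → X := fun x => b⁻¹ • P x + (x - P x) with hS'
  have hS'S : ∀ x, S' (S x) = x := fun x => by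
    simp only [hS', hSx, map_add, map_sub, map_smul, hP.idem]
    match_scalars
    · field_simp
      ring
    · ring
  have hdet : LinearMap.det S ≠ 0 := by
    have hinj : Function.Injective S := fun x y hxy => by rw [← hS'S x, hxy, hS'S]
    exact (LinearEquiv.isUnit_det' (LinearEquiv.ofInjectiveEndo S hinj)).ne_zero
  have hSc : Continuous S := LinearMap.continuous_of_finiteDimensional S
  set g : X → ℝ := fun x => Z * Real.exp (-(B x x) / 2) with hg
  have hgc : Continuous g := by fun_prop
  have hg0 : ∀ x, 0 ≤ g x := fun x => by have := hγ.pos; positivity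
  have hS'c : Continuous S' := by fun_prop
  have hint : ∀ F : X → ℝ, ∫ x, F x ∂γ = ∫ x, g x * F x ∂vol := fun F => by
    rw [hγ.eq_withDensity, integral_withDensity_eq_integral_toReal_smul (by fun_prop)
      (Eventually.of_forall fun _ => ENNReal.ofReal_lt_top)]
    refine integral_congr_ae (Eventually.of_forall fun x => ?_)
    simp only [smul_eq_mul]
    rw [ENNReal.toReal_ofReal (hg0 x)]
  -- The integrand after the substitution `y = S x`; the remaining translation by `a • P u` is made
  -- in `step3`.
  set F : X → ℝ := fun y => g (S' y) * h (a • P u + y) with hF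
  have hFm : Measurable F := by
    exact (hgc.comp hS'c).measurable.mul (hm.comp (by fun_prop))
  have step1 : mehler γ a b P h u = ∫ x, F (S x) ∂vol := by
    rw [mehler, average, hint]
    refine integral_congr_ae (Eventually.of_forall fun x => ?_)
    simp only [hF, hS'S, mix]
    rw [hSx, add_assoc]
  have step2 : ∫ x, F (S x) ∂vol = |(LinearMap.det S)⁻¹| * ∫ y, F y ∂vol := by
    have := Measure.map_linearMap_addHaar_eq_smul_addHaar vol hdet
    rw [← integral_map hSc.measurable.aemeasurable hFm.aestronglyMeasurable, this,
      integral_smul_measure, ENNReal.toReal_ofReal (abs_nonneg _), smul_eq_mul]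
  have step3 : ∫ y, F y ∂vol = ∫ y, F (y - a • P u) ∂vol :=
    (integral_sub_right_eq_self F _).symm
  rw [step1, step2, step3]
  congr 1
  rw [IsOrthProj.evidence_map, integral_withDensity_eq_integral_toReal_smul (by fun_prop)
      (Eventually.of_forall fun _ => ENNReal.ofReal_lt_top), hint, ← integral_const_mul]
  refine integral_congr_ae (Eventually.of_forall fun y => ?_)
  simp only [hF, smul_eq_mul, add_sub_cancel, ENNReal.toReal_ofReal (h0 y), hg, tilt]
  -- Expansion of the square; `a ^ 2 + b ^ 2 = 1` enters as `1 / b ^ 2 = 1 + (a / b) ^ 2`, which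
  -- splits off the Gaussian weight of `y`.
  have key : Real.exp (-(B (S' (y - a • P u)) (S' (y - a • P u))) / 2) =
      Real.exp (-((a / b) ^ 2 * B (P u) u / 2)) * (Real.exp (-(B y y) / 2) *
        Real.exp (a / b * B (P y) (b⁻¹ • u) - (a / b) ^ 2 * B (P y) (P y) / 2)) := by
    rw [← Real.exp_add, ← Real.exp_add]
    congr 1
    simp only [hS', map_add, map_sub, map_smul, add_apply, sub_apply, smul_apply, smul_eq_mul,
      hP.apply_apply, ← hP.symm, hP.idem]
    have e1 : B (P u) y = B (P y) u := by rw [hP.symm, hγ.symm]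
    rw [e1]
    field_simp
    linear_combination (B (P y) y) * hab
  rw [key]; ring

end IsGaussianFor

end Mehler

/-! ### Entropy along the Ornstein–Uhlenbeck flow. -/

section MehlerEntropy

open InformationTheory

variable {X : Type*} [NormedAddCommGroup X] [NormedSpace ℝ X] [FiniteDimensional ℝ X]
  [MeasurableSpace X] [BorelSpace X]
  {vol γ : Measure X} {B : X →L[ℝ] X →L[ℝ] ℝ} {Z : ℝ} {P : X →L[ℝ] X} {a b : ℝ} {h : X → ℝ}

/-- The measure with density `h` with respect to `γ`. -/
noncomputable def densityMeasure (γ : Measure X) (h : X → ℝ) : Measure X :=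
  γ.withDensity fun x => ENNReal.ofReal (h x)

lemma klEntropy_ne_top_iff (hm : Measurable h) (h0 : ∀ x, 0 ≤ h x) :
    klEntropy γ h ≠ ⊤ ↔ Integrable (fun x => klFun (h x)) γ := by
  rw [klEntropy, ← lt_top_iff_ne_top, ← hasFiniteIntegral_iff_ofReal
    (Eventually.of_forall fun x => klFun_nonneg (h0 x))]
  exact ⟨fun H => ⟨(measurable_klFun.comp hm).aestronglyMeasurable, H⟩, fun H => H.2⟩

lemma klEntropy_eq_ofReal [IsProbabilityMeasure γ] (hh : Integrable h γ) (h0 : ∀ x, 0 ≤ h x)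
    (h1 : ∫ x, h x ∂γ = 1) (hlog : Integrable (fun x => h x * Real.log (h x)) γ) :
    klEntropy γ h = ENNReal.ofReal (∫ x, h x * Real.log (h x) ∂γ) ∧
      0 ≤ ∫ x, h x * Real.log (h x) ∂γ := by
  have hlog1 : Integrable (fun x => h x * Real.log (h x) + 1) γ := hlog.add (integrable_const 1)
  have hi : Integrable (fun x => klFun (h x)) γ := hlog1.sub hh
  have hv : ∫ x, klFun (h x) ∂γ = ∫ x, h x * Real.log (h x) ∂γ := by
    simp only [klFun_apply]
    rw [integral_sub hlog1 hh, integral_add hlog (integrable_const 1), h1]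
    simp
  rw [klEntropy, ← ofReal_integral_eq_lintegral_ofReal hi
    (Eventually.of_forall fun x => klFun_nonneg (h0 x)), hv]
  exact ⟨rfl, hv ▸ integral_nonneg fun x => klFun_nonneg (h0 x)⟩

namespace IsGaussianFor

/-- Densities of finite relative entropy have finite second moments. -/
lemma integrable_sq_densityMeasure (hγ : IsGaussianFor vol γ B Z) (hm : Measurable h)
    (h0 : ∀ x, 0 ≤ h x) (hent : klEntropy γ h ≠ ⊤) :
    Integrable (fun x => B x x) (densityMeasure γ h) := by
  have := hγ.prob
  rw [densityMeasure, integrable_withDensity_iff_integrable_smul' hm.ennreal_ofReal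
    (Eventually.of_forall fun _ => ENNReal.ofReal_lt_top)]
  have h1 := (klEntropy_ne_top_iff hm h0).1 hent
  refine ((h1.add hγ.exp_integrable).const_mul 4).mono'
    (hm.ennreal_ofReal.ennreal_toReal.aestronglyMeasurable.smul (by fun_prop))
    (Eventually.of_forall fun x => ?_)
  simp only [smul_eq_mul, ENNReal.toReal_ofReal (h0 x), Pi.add_apply]
  rw [Real.norm_of_nonneg (mul_nonneg (h0 x) (hγ.nonneg x)), klFun_apply]
  rcases (h0 x).eq_or_lt with h2 | h2
  · rw [← h2]; simp; positivity
  -- Young's inequality for entropy, `h s ≤ h log h - h + exp s`, at `s = B x x / 4`, the exponent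
  -- for which `exp_integrable` is available.
  · have := Real.add_one_le_exp (B x x / 4 - Real.log (h x))
    rw [Real.exp_sub, Real.exp_log h2, le_div_iff₀ h2] at this
    nlinarith

variable [vol.IsAddHaarMeasure]

lemma mehler_pos (hγ : IsGaussianFor vol γ B Z) (hP : IsOrthProj B P)
    (hab : a ^ 2 + b ^ 2 = 1) (hb : b ≠ 0) (hm : Measurable h) (hh : Integrable h γ)
    (h0 : ∀ x, 0 ≤ h x) (h1 : ∫ x, h x ∂γ = 1) {C : ℝ} (hC : 0 < C)
    (hdet : |(LinearMap.det (b • (P : X →ₗ[ℝ] X) + (1 - (P : X →ₗ[ℝ] X))))⁻¹| = C) (u : X) :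
    0 < mehler γ a b P h u ∧ Real.log (mehler γ a b P h u) = Real.log C -
      (a / b) ^ 2 * B (P u) u / 2 +
      Real.log (evidence B ((densityMeasure γ h).map P) (a / b) (b⁻¹ • u)) := by
  have : IsProbabilityMeasure (densityMeasure γ h) := isProbabilityMeasure_withDensity hh h0 h1
  have : IsProbabilityMeasure ((densityMeasure γ h).map P) :=
    Measure.isProbabilityMeasure_map P.continuous.measurable.aemeasurable
  have hpos := hγ.evidence_pos (m := (densityMeasure γ h).map P) (a / b) (b⁻¹ • u)
  have key := hγ.mehler_eq hP hab hb hm h0 u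
  rw [hdet] at key
  change _ = C * (_ * evidence B ((densityMeasure γ h).map P) (a / b) (b⁻¹ • u)) at key
  rw [key]
  refine ⟨by positivity, ?_⟩
  rw [Real.log_mul hC.ne' (by positivity), Real.log_mul (by positivity) hpos.ne', Real.log_exp]
  ring

/-- The entropy of `mehler γ a b P h` in terms of the entropy of the channel with input `P Y`. -/
lemma mehler_entropy (hγ : IsGaussianFor vol γ B Z) (hP : IsOrthProj B P)
    (hab : a ^ 2 + b ^ 2 = 1) (hb : b ≠ 0) (hm : Measurable h) (hh : Integrable h γ)
    (h0 : ∀ x, 0 ≤ h x) (h1 : ∫ x, h x ∂γ = 1) (hent : klEntropy γ h ≠ ⊤) {C : ℝ} (hC : 0 < C)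
    (hdet : |(LinearMap.det (b • (P : X →ₗ[ℝ] X) + (1 - (P : X →ₗ[ℝ] X))))⁻¹| = C) :
    klEntropy γ (mehler γ a b P h) = ENNReal.ofReal (Real.log C -
      a ^ 2 / 2 * ∫ p, B (P (channel (a / b) p)) (channel (a / b) p)
        ∂((densityMeasure γ h).prod γ) +
      chanEntropy B ((densityMeasure γ h).map P) γ (a / b)) ∧
    0 ≤ Real.log C - a ^ 2 / 2 * ∫ p, B (P (channel (a / b) p)) (channel (a / b) p)
        ∂((densityMeasure γ h).prod γ) +
      chanEntropy B ((densityMeasure γ h).map P) γ (a / b) := by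
  have := hγ.prob
  set m := densityMeasure γ h with hmdef
  have : IsProbabilityMeasure m := isProbabilityMeasure_withDensity hh h0 h1
  have : IsProbabilityMeasure (m.map P) :=
    Measure.isProbabilityMeasure_map P.continuous.measurable.aemeasurable
  have hsq : Integrable (fun x => B x x) m := hγ.integrable_sq_densityMeasure hm h0 hent
  have hsqP := hP.integrable_map hγ hsq
  set τ := a / b with hτ
  have hT := hγ.measurePreserving_mix hP hab
  have hTi := hγ.measurePreserving_mixInvolution hP hab
  have hΨ := hγ.mehler_pos hP hab hb hm hh h0 h1 hC hdet
  have hΨm : Measurable (mehler γ a b P h) := measurable_average continuous_mix.measurable hm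
  set F : X → ℝ := fun u => Real.log (mehler γ a b P h u) with hF
  have hFm : Measurable F := hΨm.log
  -- The logarithm of the regularised density depends on `P u` alone, which permits replacing the
  -- mixture by `b` times a channel output with the same image under `P`.
  have hFP : ∀ u, F (P u) = F u := fun u => by
    simp only [hF]
    congr 1
    simp [mehler, average, mix, hP.idem]
  have hFb : ∀ x, F (b • x) = Real.log C - a ^ 2 / 2 * B (P x) x +
      Real.log (evidence B (m.map P) τ x) := fun x => by
    simp only [hF]
    rw [(hΨ _).2, inv_smul_smul₀ hb]
    simp only [map_smul, smul_apply, smul_eq_mul, hτ]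
    congr 1
    field_simp
  -- the value of `F` along the channel
  have hBP : Continuous fun x : X => B (P x) x := by fun_prop
  have hFmix : ∀ p : X × X, F (mix a b P p) = F (b • channel τ (P p.1, p.2)) := fun p => by
    rw [← hFP, ← hFP (b • _)]
    congr 1
    simp only [mix, channel, map_add, map_sub, map_smul, hP.idem, hτ]
    match_scalars <;> field_simp
    ring
  have iq : Integrable (fun p => B (P (channel τ p)) (channel τ p)) (m.prod γ) :=
    hγ.integrable_of_growth hsq τ hBP.measurable (C := 1) (D := 0) zero_le_one fun x => by
      rw [← hP.apply_apply, abs_of_nonneg (hγ.nonneg _)]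
      simpa using hP.apply_self_le hγ x
  have ilog' := hγ.integrable_log_evidence hsqP τ τ
  have mlog : Measurable fun p : X × X => Real.log (evidence B (m.map P) τ (channel τ p)) :=
    ((measurable_evidence τ).comp (continuous_channel τ).measurable).log
  have ilog := IsOrthProj.integrable_map_prod mlog ilog'
  have hFmix' : ∀ p : X × X, F (mix a b P p) = Real.log C -
      a ^ 2 / 2 * B (P (channel τ p)) (channel τ p) +
      Real.log (evidence B (m.map P) τ (channel τ (P p.1, p.2))) := fun p => by
    rw [hFmix, hFb, ← hP.apply_apply, hP.map_channel, hP.apply_apply]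
  have iF : Integrable (fun p => F (mix a b P p)) (m.prod γ) := by
    simp only [hFmix']
    exact ((integrable_const _).sub (iq.const_mul _)).add ilog
  have iF1 : Integrable (fun p => Real.log C -
      a ^ 2 / 2 * B (P (channel τ p)) (channel τ p)) (m.prod γ) :=
    (integrable_const _).sub (iq.const_mul _)
  have vF : ∫ p, F (mix a b P p) ∂(m.prod γ) = Real.log C -
      a ^ 2 / 2 * ∫ p, B (P (channel τ p)) (channel τ p) ∂(m.prod γ) +
      chanEntropy B (m.map P) γ τ := by
    simp only [hFmix']
    rw [integral_add iF1 ilog,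
      integral_sub (integrable_const _) (iq.const_mul _), integral_const_mul,
      chanEntropy, IsOrthProj.integral_map_prod mlog]
    simp
  -- transport to an integral against `γ`
  have hprod : m.prod γ = (γ.prod γ).withDensity fun p => ENNReal.ofReal (h p.1) :=
    prod_withDensity_left hm.ennreal_ofReal
  have hmd : Measurable fun p : X × X => ENNReal.ofReal (h p.1) :=
    (hm.comp measurable_fst).ennreal_ofReal
  set G : X × X → ℝ := fun q => h q.1 * F (mix a b P q) with hG
  have hGm : Measurable G :=
    (hm.comp measurable_fst).mul (hFm.comp continuous_mix.measurable)
  have iG : Integrable G (γ.prod γ) := by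
    rw [hprod, integrable_withDensity_iff_integrable_smul' hmd
      (Eventually.of_forall fun _ => ENNReal.ofReal_lt_top)] at iF
    simpa only [ENNReal.toReal_ofReal (h0 _), smul_eq_mul] using iF
  have vG : ∫ q, G q ∂(γ.prod γ) = ∫ p, F (mix a b P p) ∂(m.prod γ) := by
    rw [hprod, integral_withDensity_eq_integral_toReal_smul hmd
      (Eventually.of_forall fun _ => ENNReal.ofReal_lt_top)]
    simp only [ENNReal.toReal_ofReal (h0 _), smul_eq_mul, hG]
  -- The involution moves the mixing from the argument of `F` to the argument of `h`. Integrating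
  -- out the second variable then gives `Ψ log Ψ` with `Ψ = mehler γ a b P h`.
  have hGT : ∀ p, G (mixInvolution a b P p) = h (mix a b P p) * F p.1 := fun p => by
    have : mix a b P (mixInvolution a b P p) = p.1 := by
      have := congrArg Prod.fst (hP.mixInvolution_involutive hab p)
      rwa [mixInvolution_apply] at this
    simp only [hG, this]
    rfl
  have iGT : Integrable (fun p : X × X => h (mix a b P p) * F p.1) (γ.prod γ) := by
    have := hTi.integrable_comp_of_integrable iG
    simpa only [Function.comp_def, hGT] using this
  have vGT : ∫ p : X × X, h (mix a b P p) * F p.1 ∂(γ.prod γ) = ∫ q, G q ∂(γ.prod γ) := by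
    have := integral_map (μ := γ.prod γ) hTi.measurable.aemeasurable
      hGm.aestronglyMeasurable
    rw [hTi.map_eq] at this
    simp only [this, hGT]
  have hinner : ∀ u, ∫ x, h (mix a b P (u, x)) * F u ∂γ =
      mehler γ a b P h u * Real.log (mehler γ a b P h u) := fun u => integral_mul_const _ _
  have ilogΨ : Integrable (fun u => mehler γ a b P h u * Real.log (mehler γ a b P h u)) γ := by
    simpa only [hinner] using iGT.integral_prod_left
  have vlogΨ : ∫ u, mehler γ a b P h u * Real.log (mehler γ a b P h u) ∂γ =
      ∫ p : X × X, h (mix a b P p) * F p.1 ∂(γ.prod γ) := by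
    rw [integral_prod _ iGT]
    simp only [hinner]
  have key := klEntropy_eq_ofReal (h := mehler γ a b P h) (integrable_average hT hh)
    (fun u => (hΨ u).1.le) ((integral_average hT hh).trans h1) ilogΨ
  rwa [vlogΨ, vGT, vG, vF] at key

end IsGaussianFor

end MehlerEntropy

/-! ### Lower semicontinuity of entropy. -/

section Semicontinuity

open InformationTheory

/-- The relative entropy is lower semicontinuous under convergence in `L¹`. -/
lemma klEntropy_le_of_tendsto {X : Type*} [MeasurableSpace X] {γ : Measure X}
    {g : ℕ → X → ℝ} {g₀ : X → ℝ} (hg : ∀ k, Integrable (g k) γ) (hg₀ : Integrable g₀ γ)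
    (hlim : Tendsto (fun k => ∫ x, |g k x - g₀ x| ∂γ) atTop (𝓝 0))
    {u : ℕ → ℝ≥0∞} {u₀ : ℝ≥0∞} (hu : Tendsto u atTop (𝓝 u₀))
    (hle : ∀ᶠ k in atTop, klEntropy γ (g k) ≤ u k) :
    klEntropy γ g₀ ≤ u₀ := by
  have h1 : Tendsto (fun k => eLpNorm (g k - g₀) 1 γ) atTop (𝓝 0) := by
    have := ENNReal.tendsto_ofReal hlim
    rw [ENNReal.ofReal_zero] at this
    refine this.congr fun k => ?_
    have hi : Integrable (fun x => |g k x - g₀ x|) γ := ((hg k).sub hg₀).abs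
    rw [eLpNorm_one_eq_lintegral_enorm, ofReal_integral_eq_lintegral_ofReal
      hi (Eventually.of_forall fun _ => abs_nonneg _)]
    refine lintegral_congr fun x => ?_
    rw [Pi.sub_apply, Real.enorm_eq_ofReal_abs]
  -- Fatou's lemma needs pointwise convergence, available along a subsequence; the bounds `u` still
  -- converge to `u₀` along it.
  obtain ⟨ns, hns, hae⟩ := (tendstoInMeasure_of_tendsto_eLpNorm one_ne_zero
    (fun k => (hg k).1) hg₀.1 h1).exists_seq_tendsto_ae
  have h2 : klEntropy γ g₀ ≤ liminf (fun k => klEntropy γ (g (ns k))) atTop := by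
    refine le_trans (lintegral_mono_ae ?_) (lintegral_liminf_le' fun k =>
      (continuous_klFun.comp_aestronglyMeasurable (hg (ns k)).1).aemeasurable.ennreal_ofReal)
    filter_upwards [hae] with x hx
    exact (((ENNReal.continuous_ofReal.comp continuous_klFun).tendsto _).comp hx).liminf_eq.ge
  refine h2.trans ?_
  rw [← (hu.comp hns.tendsto_atTop).liminf_eq]
  exact liminf_le_liminf (hns.tendsto_atTop.eventually hle)

end Semicontinuity

/-! ### Continuity of the flow in its parameters. -/

section Limit

variable {X : Type*} [NormedAddCommGroup X] [NormedSpace ℝ X] [FiniteDimensional ℝ X]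
  [MeasurableSpace X] [BorelSpace X]
  {vol γ : Measure X} {B : X →L[ℝ] X →L[ℝ] ℝ} {Z : ℝ} {P : X →L[ℝ] X} {h : X → ℝ}

namespace IsGaussianFor

/-- The averages are contractions of `L¹` for all admissible parameters, so `h` may be approximated
by a bounded continuous function, for which dominated convergence applies. Three errors of size `ε /
4` occur. -/
lemma tendsto_mehler [vol.IsAddHaarMeasure] (hγ : IsGaussianFor vol γ B Z)
    (hP : IsOrthProj B P) (hh : Integrable h γ) {a b : ℕ → ℝ} {a₀ b₀ : ℝ}
    (hab : ∀ k, a k ^ 2 + b k ^ 2 = 1) (ha : Tendsto a atTop (𝓝 a₀))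
    (hb : Tendsto b atTop (𝓝 b₀)) :
    Tendsto (fun k => ∫ x, |mehler γ (a k) (b k) P h x - mehler γ a₀ b₀ P h x| ∂γ)
      atTop (𝓝 0) := by
  have := hγ.prob
  have hab₀ : a₀ ^ 2 + b₀ ^ 2 = 1 := tendsto_nhds_unique
    ((ha.pow 2).add (hb.pow 2)) (by simp only [hab]; exact tendsto_const_nhds)
  have hT₀ := hγ.measurePreserving_mix hP hab₀
  have hT := fun k => hγ.measurePreserving_mix hP (hab k)
  rw [Metric.tendsto_atTop]
  intro ε hε
  obtain ⟨g, hg, hgi⟩ := hh.exists_boundedContinuous_integral_sub_le (ε := ε / 4) (by positivity)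
  have hgd : Integrable (fun x => h x - g x) γ := hh.sub hgi
  obtain ⟨C, hC⟩ : ∃ C, ∀ x, |g x| ≤ C := ⟨‖g‖, fun x => g.norm_coe_le_norm x⟩
  have hbd : ∀ a b x, |mehler γ a b P g x| ≤ C := fun a b x => by
    have := norm_integral_le_of_norm_le_const (μ := γ)
      (f := fun y => g (mix a b P (x, y))) (Eventually.of_forall fun y => hC _)
    rw [probReal_univ, mul_one] at this
    exact this
  have hlim : Tendsto (fun k => ∫ x, |mehler γ (a k) (b k) P g x - mehler γ a₀ b₀ P g x| ∂γ)
      atTop (𝓝 0) := by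
    have : (0 : ℝ) = ∫ x : X, (0 : ℝ) ∂γ := by simp
    rw [this]
    refine tendsto_integral_of_dominated_convergence (fun _ => 2 * C) (fun k => ?_)
      (integrable_const _) (fun k => Eventually.of_forall fun x => ?_)
      (Eventually.of_forall fun x => ?_)
    · exact ((measurable_average continuous_mix.measurable g.continuous.measurable).sub
        (measurable_average continuous_mix.measurable
          g.continuous.measurable)).abs.aestronglyMeasurable
    · rw [Real.norm_eq_abs, abs_abs]
      have h1 := abs_sub (mehler γ (a k) (b k) P g x) (mehler γ a₀ b₀ P g x)
      linarith [hbd (a k) (b k) x, hbd a₀ b₀ x]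
    · have : Tendsto (fun k => mehler γ (a k) (b k) P g x) atTop
          (𝓝 (mehler γ a₀ b₀ P g x)) := by
        refine tendsto_integral_of_dominated_convergence (fun _ => C) (fun k => ?_)
          (integrable_const _) (fun k => Eventually.of_forall fun y => hC _)
          (Eventually.of_forall fun y => ?_)
        · exact (g.continuous.measurable.comp (continuous_mix.measurable.comp
            measurable_prodMk_left)).aestronglyMeasurable
        · refine (g.continuous.tendsto _).comp ?_
          unfold mix
          exact ((ha.smul_const _).add (hb.smul_const _)).add_const _
      simpa using (this.sub_const (mehler γ a₀ b₀ P g x)).abs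
  obtain ⟨k₀, hk₀⟩ := (Metric.tendsto_atTop.1 hlim) (ε / 4) (by positivity)
  refine ⟨k₀, fun k hk => ?_⟩
  have h1 := hk₀ k hk
  rw [Real.dist_0_eq_abs, abs_of_nonneg (integral_nonneg fun _ => abs_nonneg _)] at h1 ⊢
  have c1 := integral_abs_average_le (hT k) hgd
  have c2 := integral_abs_average_le hT₀ hgd
  have hg' : ∫ x, |h x - g x| ∂γ ≤ ε / 4 := hg
  have i1 := (integrable_average (hT k) hgd).abs
  have i2 := (integrable_average hT₀ hgd).abs
  have i3 : Integrable (fun x => |mehler γ (a k) (b k) P g x - mehler γ a₀ b₀ P g x|) γ := ((integrable_average (hT k) hgi).sub (integrable_average hT₀ hgi)).abs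
  have h2 : ∫ x, |mehler γ (a k) (b k) P h x - mehler γ a₀ b₀ P h x| ∂γ ≤
      ∫ x, (|average γ (mix (a k) (b k) P) (fun x => h x - g x) x| +
        |average γ (mix a₀ b₀ P) (fun x => h x - g x) x| +
        |mehler γ (a k) (b k) P g x - mehler γ a₀ b₀ P g x|) ∂γ := by
    refine integral_mono_ae (((integrable_average (hT k) hh).sub
      (integrable_average hT₀ hh)).abs) ((i1.add i2).add i3) ?_
    filter_upwards [average_sub (hT k) hh hgi, average_sub hT₀ hh hgi] with x e1 e2
    rw [e1, e2]
    simp only [mehler]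
    have t1 := abs_add_le (average γ (mix (a k) (b k) P) h x - average γ (mix (a k) (b k) P) g x)
      (average γ (mix (a k) (b k) P) g x - average γ (mix a₀ b₀ P) g x)
    have t2 := abs_sub
      ((average γ (mix (a k) (b k) P) h x - average γ (mix (a k) (b k) P) g x) +
      (average γ (mix (a k) (b k) P) g x - average γ (mix a₀ b₀ P) g x))
      (average γ (mix a₀ b₀ P) h x - average γ (mix a₀ b₀ P) g x)
    have e3 : (average γ (mix (a k) (b k) P) h x - average γ (mix (a k) (b k) P) g x) +
      (average γ (mix (a k) (b k) P) g x - average γ (mix a₀ b₀ P) g x) -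
      (average γ (mix a₀ b₀ P) h x - average γ (mix a₀ b₀ P) g x) =
      average γ (mix (a k) (b k) P) h x - average γ (mix a₀ b₀ P) h x := by ring
    rw [e3] at t2
    linarith
  have i12 : Integrable (fun x => |average γ (mix (a k) (b k) P) (fun x => h x - g x) x| +
      |average γ (mix a₀ b₀ P) (fun x => h x - g x) x|) γ := i1.add i2
  rw [integral_add i12 i3, integral_add i1 i2] at h2
  linarith

end IsGaussianFor

end Limit

/-! ### Entropy subadditivity for tight frames of projections. -/

section TightFrame

open InformationTheory

variable {X : Type*} [NormedAddCommGroup X] [NormedSpace ℝ X] [FiniteDimensional ℝ X]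
  [MeasurableSpace X] [BorelSpace X]
  {vol γ : Measure X} {B : X →L[ℝ] X →L[ℝ] ℝ} {Z : ℝ} {h : X → ℝ}
  {S : Type*} [MeasurableSpace S] {ν : Measure S} {P : S → X →L[ℝ] X} {c : ℝ}

lemma isOrthProj_id : IsOrthProj B (ContinuousLinearMap.id ℝ X) := ⟨fun _ => rfl, fun _ _ => rfl⟩

/-- Averaging the quadratic forms of the projections inside an integral. -/
lemma integral_integral_quadratic [IsProbabilityMeasure ν] (hγ : IsGaussianFor vol γ B Z)
    (hP : ∀ e, IsOrthProj B (P e)) (hPm : Measurable fun q : S × X => P q.1 q.2)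
    (hav : ∀ x, ∫ e, B (P e x) x ∂ν = c * B x x)
    {Ω : Type*} [MeasurableSpace Ω] {μ : Measure Ω} [SFinite μ] {φ : Ω → X} (hφ : Measurable φ)
    (hi : Integrable (fun p => B (φ p) (φ p)) μ) :
    Integrable (fun e => ∫ p, B (P e (φ p)) (φ p) ∂μ) ν ∧
      ∫ e, ∫ p, B (P e (φ p)) (φ p) ∂μ ∂ν = c * ∫ p, B (φ p) (φ p) ∂μ := by
  have hB : Continuous fun p : X × X => B p.1 p.2 := by fun_prop
  have hmeas : Measurable fun q : S × Ω => B (P q.1 (φ q.2)) (φ q.2) :=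
    hB.measurable.comp ((hPm.comp (measurable_fst.prodMk (hφ.comp measurable_snd))).prodMk
      (hφ.comp measurable_snd))
  have hint : Integrable (fun q : S × Ω => B (P q.1 (φ q.2)) (φ q.2)) (ν.prod μ) := by
    refine (hi.comp_snd ν).mono' hmeas.aestronglyMeasurable (Eventually.of_forall fun q => ?_)
    rw [← (hP _).apply_apply, Real.norm_of_nonneg (hγ.nonneg _)]
    exact (hP _).apply_self_le hγ _
  refine ⟨hint.integral_prod_left, ?_⟩
  rw [integral_integral_swap hint, ← integral_const_mul]
  exact integral_congr_ae (Eventually.of_forall fun p => hav _)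

namespace IsGaussianFor

variable [vol.IsAddHaarMeasure] [IsProbabilityMeasure ν]

/-- The slopes of the projected channel are replaced by quadratic forms in the estimate of the full
channel. The right side is linear in `P` and can therefore be averaged over a frame. -/
lemma chanEntropy_map_le {P : X →L[ℝ] X} (hγ : IsGaussianFor vol γ B Z) (hP : IsOrthProj B P)
    {m : Measure X} [IsProbabilityMeasure m] (hm : Integrable (fun x => B x x) m) {τ : ℝ}
    (hτ : 0 ≤ τ) {K : ℕ} (hK : K ≠ 0) :
    chanEntropy B (m.map P) γ τ ≤ ∑ k ∈ Finset.range K, τ / K * (((k + 1 : ℕ) * (τ / K)) *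
      ∫ p, B (P (postMean B m ((k + 1 : ℕ) * (τ / K)) (channel ((k + 1 : ℕ) * (τ / K)) p)))
        (postMean B m ((k + 1 : ℕ) * (τ / K)) (channel ((k + 1 : ℕ) * (τ / K)) p))
        ∂(m.prod γ)) := by
  have : IsProbabilityMeasure (m.map P) :=
    Measure.isProbabilityMeasure_map P.continuous.measurable.aemeasurable
  refine (sum_tangent_bounds (hγ.chanEntropy_tangent (hP.integrable_map hγ hm))
    chanEntropy_zero hK).1.trans (Finset.sum_le_sum fun k _ => ?_)
  exact mul_le_mul_of_nonneg_left (hP.chanInfo_map_le hγ hm (by positivity)) (by positivity)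

/-- Passing from right to left endpoints costs only the last slope; the slope at `0` is dropped by
positivity. -/
lemma sum_chanInfo_le (hγ : IsGaussianFor vol γ B Z)
    {m : Measure X} [IsProbabilityMeasure m] (hm : Integrable (fun x => B x x) m) {τ : ℝ}
    (hτ : 0 ≤ τ) {K : ℕ} (hK : K ≠ 0) :
    ∑ k ∈ Finset.range K, τ / K * chanInfo B m γ ((k + 1 : ℕ) * (τ / K)) ≤
      chanEntropy B m γ τ + τ / K * chanInfo B m γ τ := by
  have h1 := (sum_tangent_bounds (hγ.chanEntropy_tangent hm) chanEntropy_zero hK (τ := τ)).2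
  have h2 := Finset.sum_range_succ' (fun k : ℕ => τ / K * chanInfo B m γ (k * (τ / K))) K
  rw [Finset.sum_range_succ] at h2
  have hKr : (K : ℝ) ≠ 0 := by exact_mod_cast hK
  have h3 : 0 ≤ τ / K * chanInfo B m γ ((0 : ℕ) * (τ / K)) :=
    mul_nonneg (by positivity) (chanInfo_nonneg hγ (by simp))
  rw [mul_div_cancel₀ _ hKr] at h2
  linarith

/-- Each of the three terms in `mehler_entropy` acquires the factor `c` on averaging: the
determinant because the rank is `c` times the dimension, the second moment by the frame identity,
and the channel entropy by the frame identity inside a Riemann sum, up to an error vanishing with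
the mesh. -/
lemma lintegral_klEntropy_mehler_le_mehler (hγ : IsGaussianFor vol γ B Z)
    (hP : ∀ e, IsOrthProj B (P e)) (hPm : Measurable fun q : S × X => P q.1 q.2) (hc : 0 ≤ c)
    (hav : ∀ x, ∫ e, B (P e x) x ∂ν = c * B x x) {k : ℕ}
    (hdet : ∀ e (b : ℝ), 0 < b →
      LinearMap.det (b • (P e : X →ₗ[ℝ] X) + (1 - (P e : X →ₗ[ℝ] X))) = b ^ k)
    (hk : (k : ℝ) = c * Module.finrank ℝ X) (hm : Measurable h) (hh : Integrable h γ)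
    (h0 : ∀ x, 0 ≤ h x) (h1 : ∫ x, h x ∂γ = 1) (hent : klEntropy γ h ≠ ⊤) {a b : ℝ}
    (hab : a ^ 2 + b ^ 2 = 1) (ha : 0 ≤ a) (hb : 0 < b) :
    ∫⁻ e, klEntropy γ (mehler γ a b (P e) h) ∂ν ≤
      ENNReal.ofReal c * klEntropy γ (mehler γ a b (ContinuousLinearMap.id ℝ X) h) := by
  have := hγ.prob
  set m := densityMeasure γ h with hmdef
  have : IsProbabilityMeasure m := isProbabilityMeasure_withDensity hh h0 h1
  have hsq : Integrable (fun x => B x x) m := hγ.integrable_sq_densityMeasure hm h0 hent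
  set τ := a / b with hτdef
  have hτ : 0 ≤ τ := by positivity
  have hCpos : ∀ j : ℕ, 0 < (b ^ j)⁻¹ := fun j => by positivity
  have hClog : ∀ j : ℕ, Real.log ((b ^ j)⁻¹) = -(j * Real.log b) := fun j => by
    rw [Real.log_inv, Real.log_pow]
  -- the two entropies
  have hE := fun e => hγ.mehler_entropy (hP e) hab hb.ne' hm hh h0 h1 hent (hCpos k)
    (by rw [hdet e b hb, abs_of_pos (hCpos k)])
  have hI := hγ.mehler_entropy isOrthProj_id hab hb.ne' hm hh h0 h1 hent
    (hCpos (Module.finrank ℝ X)) (by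
      have : b • ((ContinuousLinearMap.id ℝ X : X →L[ℝ] X) : X →ₗ[ℝ] X) +
          (1 - ((ContinuousLinearMap.id ℝ X : X →L[ℝ] X) : X →ₗ[ℝ] X)) =
          b • LinearMap.id := by
        ext x; simp
      rw [this, LinearMap.det_smul, LinearMap.det_id, mul_one, abs_of_pos (hCpos _)])
  rw [← hmdef] at hI
  simp only [← hmdef, ← hτdef, hClog] at hE hI
  have hmid : m.map (ContinuousLinearMap.id ℝ X) = m := Measure.map_id
  rw [hmid] at hI
  simp only [ContinuousLinearMap.id_apply] at hI
  set x₁ : ℝ := -(Module.finrank ℝ X * Real.log b) -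
    a ^ 2 / 2 * ∫ p, B (channel τ p) (channel τ p) ∂(m.prod γ) + chanEntropy B m γ τ with hx₁
  have hBx : Continuous fun x : X => B x x := by fun_prop
  have iX : Integrable (fun p => B (channel τ p) (channel τ p)) (m.prod γ) :=
    hγ.integrable_of_growth hsq τ hBx.measurable (C := 1) (D := 0) zero_le_one fun x => by
      rw [abs_of_nonneg (hγ.nonneg _)]; simp
  have qX := integral_integral_quadratic hγ hP hPm hav (continuous_channel τ).measurable iX
  have qY := fun s => integral_integral_quadratic hγ hP hPm hav
    (φ := fun p => postMean B m s (channel s p)) ((measurable_postMean (B := B) (m := m) s).comp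
      (continuous_channel s).measurable) (hγ.integrable_postMean_sq hsq s)
  have step : ∀ K : ℕ, K ≠ 0 → ∫⁻ e, klEntropy γ (mehler γ a b (P e) h) ∂ν ≤
      ENNReal.ofReal (c * (x₁ + τ / K * chanInfo B m γ τ)) := fun K hK => by
    set s : ℕ → ℝ := fun j => (j + 1 : ℕ) * (τ / K) with hs
    set r : S → ℝ := fun e => -(k * Real.log b) -
      a ^ 2 / 2 * ∫ p, B (P e (channel τ p)) (channel τ p) ∂(m.prod γ) +
      ∑ j ∈ Finset.range K, τ / K * (s j *
        ∫ p, B (P e (postMean B m (s j) (channel (s j) p)))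
        (postMean B m (s j) (channel (s j) p)) ∂(m.prod γ)) with hr
    have hle : ∀ e, _ ≤ r e := fun e => add_le_add_right
      (hγ.chanEntropy_map_le (hP e) hsq hτ hK) (-(k * Real.log b) -
      a ^ 2 / 2 * ∫ p, B (P e (channel τ p)) (channel τ p) ∂(m.prod γ))
    have ir1 : Integrable (fun e => -(k * Real.log b) -
        a ^ 2 / 2 * ∫ p, B (P e (channel τ p)) (channel τ p) ∂(m.prod γ)) ν :=
      (integrable_const _).sub (qX.1.const_mul _)
    have ir2 : ∀ j ∈ Finset.range K, Integrable (fun e => τ / K * (s j *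
        ∫ p, B (P e (postMean B m (s j) (channel (s j) p)))
        (postMean B m (s j) (channel (s j) p)) ∂(m.prod γ))) ν := fun j _ =>
      ((qY (s j)).1.const_mul _).const_mul _
    have ir : Integrable r ν := ir1.add (integrable_finsetSum _ ir2)
    have vr : ∫ e, r e ∂ν = -(k * Real.log b) -
        a ^ 2 / 2 * (c * ∫ p, B (channel τ p) (channel τ p) ∂(m.prod γ)) +
        c * ∑ j ∈ Finset.range K, τ / K * chanInfo B m γ (s j) := by
      rw [hr, integral_add ir1 (integrable_finsetSum _ ir2),
        integral_sub (integrable_const _) (qX.1.const_mul _), integral_const_mul, qX.2,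
        integral_finsetSum _ ir2, Finset.mul_sum]
      simp only [integral_const, probReal_univ, one_smul]
      congr 1
      refine Finset.sum_congr rfl fun j _ => ?_
      rw [integral_const_mul, integral_const_mul, (qY (s j)).2, chanInfo]
      ring
    -- The upper bound `r e` is nonnegative because it dominates an entropy, so its integral can be
    -- computed in the reals.
    calc ∫⁻ e, klEntropy γ (mehler γ a b (P e) h) ∂ν ≤ ∫⁻ e, ENNReal.ofReal (r e) ∂ν :=
          lintegral_mono fun e => (hE e).1.trans_le (ENNReal.ofReal_le_ofReal (hle e))
      _ = ENNReal.ofReal (∫ e, r e ∂ν) := (ofReal_integral_eq_lintegral_ofReal ir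
          (Eventually.of_forall fun e => (hE e).2.trans (hle e))).symm
      _ ≤ _ := ENNReal.ofReal_le_ofReal ?_
    rw [vr, hk]
    have := mul_le_mul_of_nonneg_left (hγ.sum_chanInfo_le hsq hτ hK) hc
    rw [hx₁]
    linarith
  rw [hI.1, ← ENNReal.ofReal_mul hc]
  have hlim : Tendsto (fun K : ℕ => ENNReal.ofReal (c * (x₁ + τ / K * chanInfo B m γ τ))) atTop
      (𝓝 (ENNReal.ofReal (c * x₁))) := by
    refine ENNReal.tendsto_ofReal (Tendsto.const_mul c ?_)
    have := ((tendsto_const_div_atTop_nhds_zero_nat τ).mul_const (chanInfo B m γ τ)).const_add x₁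
    simpa using this
  exact ge_of_tendsto hlim ((eventually_ne_atTop 0).mono step)

/-- Subadditivity of the entropy for Gaussian projections forming a tight frame (the entropic
form of the geometric Brascamp–Lieb inequality). -/
theorem lintegral_klEntropy_proj_le (hγ : IsGaussianFor vol γ B Z)
    (hP : ∀ e, IsOrthProj B (P e)) (hPm : Measurable fun q : S × X => P q.1 q.2) (hc : 0 ≤ c)
    (hav : ∀ x, ∫ e, B (P e x) x ∂ν = c * B x x) {k : ℕ}
    (hdet : ∀ e (b : ℝ), 0 < b →
      LinearMap.det (b • (P e : X →ₗ[ℝ] X) + (1 - (P e : X →ₗ[ℝ] X))) = b ^ k)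
    (hk : (k : ℝ) = c * Module.finrank ℝ X) (hm : Measurable h) (hh : Integrable h γ)
    (h0 : ∀ x, 0 ≤ h x) (h1 : ∫ x, h x ∂γ = 1) (hent : klEntropy γ h ≠ ⊤) :
    ∫⁻ e, klEntropy γ (mehler γ 1 0 (P e) h) ∂ν ≤ ENNReal.ofReal c * klEntropy γ h := by
  have := hγ.prob
  -- The conditional expectation is the case `(a, b) = (1, 0)`, where `a / b` degenerates. It is
  -- approached along the unit circle with `b > 0`.
  set a : ℕ → ℝ := fun j => Real.cos (1 / (j + 1)) with ha
  set b : ℕ → ℝ := fun j => Real.sin (1 / (j + 1)) with hb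
  have hab : ∀ j, a j ^ 2 + b j ^ 2 = 1 := fun j => Real.cos_sq_add_sin_sq _
  have hle1 : ∀ j : ℕ, (0 : ℝ) < 1 / (j + 1) ∧ (1 : ℝ) / (j + 1) ≤ 1 := fun j => by
    refine ⟨by positivity, ?_⟩
    rw [div_le_one (by positivity)]
    linarith [(Nat.cast_nonneg j : (0 : ℝ) ≤ j)]
  have hapos : ∀ j, 0 ≤ a j := fun j =>
    (Real.cos_pos_of_le_one (_root_.abs_le.2 ⟨by linarith [hle1 j], (hle1 j).2⟩)).le
  have hbpos : ∀ j, 0 < b j := fun j => Real.sin_pos_of_pos_of_le_one (hle1 j).1 (hle1 j).2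
  have hzero : Tendsto (fun j : ℕ => (1 : ℝ) / (j + 1)) atTop (𝓝 0) :=
    tendsto_one_div_add_atTop_nhds_zero_nat
  have ha1 : Tendsto a atTop (𝓝 1) := by
    have := (Real.continuous_cos.tendsto 0).comp hzero
    rwa [Real.cos_zero] at this
  have hb0 : Tendsto b atTop (𝓝 0) := by
    have := (Real.continuous_sin.tendsto 0).comp hzero
    rwa [Real.sin_zero] at this
  have hmix : ∀ a b : ℝ, Measurable fun q : (S × X) × X => mix a b (P q.1.1) (q.1.2, q.2) := by
    intro a b
    have e1 : Measurable fun q : (S × X) × X => P q.1.1 q.1.2 := hPm.comp measurable_fst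
    have e2 : Measurable fun q : (S × X) × X => P q.1.1 q.2 :=
      hPm.comp ((measurable_fst.comp measurable_fst).prodMk measurable_snd)
    exact ((e1.const_smul a).add (e2.const_smul b)).add (measurable_snd.sub e2)
  have hmeh : ∀ a b : ℝ, Measurable fun q : S × X => mehler γ a b (P q.1) h q.2 := fun a b =>
    ((hm.comp (hmix a b)).stronglyMeasurable.integral_prod_right' (ν := γ)).measurable
  -- The averaged entropy is itself an entropy on `S × X`, so semicontinuity can be applied once, in
  -- `L¹` of the product.
  have hent' : ∀ a b : ℝ, klEntropy (ν.prod γ) (fun q : S × X => mehler γ a b (P q.1) h q.2) =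
      ∫⁻ e, klEntropy γ (mehler γ a b (P e) h) ∂ν := fun a b =>
    lintegral_prod _ ((measurable_klFun.comp (hmeh a b)).ennreal_ofReal.aemeasurable)
  have hT := fun e {a b : ℝ} (hab : a ^ 2 + b ^ 2 = 1) =>
    hγ.measurePreserving_mix (hP e) hab
  have hint : ∀ a b : ℝ, a ^ 2 + b ^ 2 = 1 →
      Integrable (fun q : S × X => mehler γ a b (P q.1) h q.2) (ν.prod γ) := fun a b hab => by
    have hB := fun e => integral_abs_average_le (hT e hab) hh
    rw [integrable_prod_iff (hmeh a b).aestronglyMeasurable]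
    refine ⟨Eventually.of_forall fun e => integrable_average (hT e hab) hh, ?_⟩
    refine (integrable_const (∫ x, |h x| ∂γ)).mono'
      (hmeh a b).stronglyMeasurable.norm.integral_prod_right'.aestronglyMeasurable
      (Eventually.of_forall fun e => ?_)
    rw [Real.norm_of_nonneg (integral_nonneg fun _ => norm_nonneg _)]
    exact hB e
  have h10 : (1 : ℝ) ^ 2 + (0 : ℝ) ^ 2 = 1 := by norm_num
  rw [← hent']
  refine klEntropy_le_of_tendsto (fun j => hint (a j) (b j) (hab j)) (hint 1 0 h10) ?_
    tendsto_const_nhds (Eventually.of_forall fun j => ?_)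
  · have hd : ∀ j, Integrable (fun q : S × X => |mehler γ (a j) (b j) (P q.1) h q.2 -
        mehler γ 1 0 (P q.1) h q.2|) (ν.prod γ) := fun j =>
      ((hint (a j) (b j) (hab j)).sub (hint 1 0 h10)).abs
    simp only [integral_prod _ (hd _)]
    rw [show 𝓝 (0 : ℝ) = 𝓝 (∫ e : S, (0 : ℝ) ∂ν) by simp]
    refine tendsto_integral_of_dominated_convergence (fun _ => 2 * ∫ x, |h x| ∂γ)
      (fun j => (hd j).integral_prod_left.aestronglyMeasurable)
      (integrable_const _) (fun j => Eventually.of_forall fun e => ?_)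
      (Eventually.of_forall fun e => hγ.tendsto_mehler (hP e) hh hab ha1 hb0)
    rw [Real.norm_of_nonneg (integral_nonneg fun _ => abs_nonneg _)]
    have i1 := integrable_average (hT e (hab j)) hh
    have i2 := integrable_average (hT e h10) hh
    have := integral_mono (f := fun x => |mehler γ (a j) (b j) (P e) h x -
        mehler γ 1 0 (P e) h x|) (g := fun x => |average γ (mix (a j) (b j) (P e)) h x| +
        |average γ (mix 1 0 (P e)) h x|) (i1.sub i2).abs (i1.abs.add i2.abs) fun x => abs_sub _ _
    rw [integral_add i1.abs i2.abs] at this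
    linarith [integral_abs_average_le (hT e (hab j)) hh, integral_abs_average_le (hT e h10) hh]
  · rw [hent']
    refine (hγ.lintegral_klEntropy_mehler_le_mehler hP hPm hc hav hdet hk hm hh h0 h1 hent
      (hab j) (hapos j) (hbpos j)).trans ?_
    gcongr
    exact klEntropy_average_le (hγ.measurePreserving_mix isOrthProj_id (hab j)) hm hh h0

end IsGaussianFor

end TightFrame

/-! ### The Maxwell density as a Gaussian in the sense above. -/

section Maxwell

variable {N d : ℕ} {β : ℝ}

/-- The Gaussian law of one velocity. -/
noncomputable def maxwellMeasure (d : ℕ) (β : ℝ) : Measure (Velocity d) :=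
  volume.withDensity fun w => ENNReal.ofReal (maxwell β w)

/-- The Gaussian law of `N` velocities. -/
noncomputable def maxwellMeasureN (N d : ℕ) (β : ℝ) : Measure (Config N d) :=
  volume.withDensity fun v => ENNReal.ofReal (maxwellN β v)

lemma maxwell_pos (hβ : 0 < β) (w : Velocity d) : 0 < maxwell β w := by
  have := Real.pi_pos
  unfold maxwell; positivity

lemma maxwellN_pos (hβ : 0 < β) (v : Config N d) : 0 < maxwellN β v := by
  have := Real.pi_pos
  unfold maxwellN; positivity

@[fun_prop]
lemma continuous_maxwell : Continuous (maxwell β : Velocity d → ℝ) := by unfold maxwell; fun_prop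

@[fun_prop]
lemma continuous_maxwellN : Continuous (maxwellN β : Config N d → ℝ) := by
  unfold maxwellN sqLength; fun_prop

lemma maxwellN_eq_prod (hβ : 0 < β) (v : Config N d) : maxwellN β v = ∏ i, maxwell β (v i) := by
  have := Real.pi_pos
  simp only [maxwellN, maxwell, Finset.prod_mul_distrib, Finset.prod_const, Finset.card_univ,
    Fintype.card_fin, ← Real.exp_sum, sqLength, Finset.mul_sum]
  congr 1
  rw [← Real.rpow_natCast, ← Real.rpow_mul (by positivity)]
  congr 1; ring

lemma integrable_exp_neg_mul_norm_sq {b : ℝ} (hb : 0 < b) :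
    Integrable fun w : Velocity d => Real.exp (-b * ‖w‖ ^ 2) := by
  -- A function that is not integrable has Bochner integral `0`, whereas the Gaussian integral is
  -- positive.
  by_contra h
  have h1 := GaussianFourier.integral_rexp_neg_mul_sq_norm (V := Velocity d) hb
  rw [integral_undef h] at h1
  have := Real.pi_pos
  have : 0 < (Real.pi / b) ^ (Module.finrank ℝ (Velocity d) / 2 : ℝ) := by positivity
  linarith

lemma integrable_maxwell (hβ : 0 < β) : Integrable (maxwell β : Velocity d → ℝ) :=
  (integrable_exp_neg_mul_norm_sq (by positivity)).const_mul _

lemma integral_maxwell (hβ : 0 < β) : ∫ w : Velocity d, maxwell β w = 1 := by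
  have := Real.pi_pos
  unfold maxwell
  rw [integral_const_mul, GaussianFourier.integral_rexp_neg_mul_sq_norm (by positivity),
    finrank_euclideanSpace_fin, ← Real.mul_rpow (by positivity) (by positivity)]
  convert Real.one_rpow _
  field_simp

lemma isProbabilityMeasure_maxwellMeasure (hβ : 0 < β) :
    IsProbabilityMeasure (maxwellMeasure d β) := by
  constructor
  rw [maxwellMeasure, withDensity_apply _ MeasurableSet.univ, Measure.restrict_univ,
    ← ofReal_integral_eq_lintegral_ofReal (integrable_maxwell hβ)
      (Eventually.of_forall fun w => (maxwell_pos hβ w).le), integral_maxwell hβ,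
    ENNReal.ofReal_one]

/-- The product structure identifies the law of one velocity under the `N`-particle Gaussian with
the law of a thermostat particle. -/
lemma maxwellMeasureN_eq_pi (hβ : 0 < β) :
    maxwellMeasureN N d β = Measure.pi fun _ : Fin N => maxwellMeasure d β := by
  have := isProbabilityMeasure_maxwellMeasure (d := d) hβ
  symm
  refine Measure.pi_eq fun s hs => ?_
  have hf : ∀ i, Integrable ((s i).indicator (maxwell β)) (volume : Measure (Velocity d)) :=
    fun i => (integrable_maxwell hβ).indicator (hs i)
  have h0 : ∀ i w, 0 ≤ (s i).indicator (maxwell β) w := fun i w =>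
    indicator_nonneg (fun w _ => (maxwell_pos hβ w).le) w
  have hone : ∀ i, maxwellMeasure d β (s i) =
      ENNReal.ofReal (∫ w, (s i).indicator (maxwell β) w) := fun i => by
    rw [maxwellMeasure, withDensity_apply _ (hs i), ofReal_integral_eq_lintegral_ofReal (hf i)
      (Eventually.of_forall (h0 i)), ← lintegral_indicator (hs i)]
    refine lintegral_congr fun w => ?_
    by_cases hw : w ∈ s i <;> simp [hw]
  have hprod : Integrable (fun v : Config N d => ∏ i, (s i).indicator (maxwell β) (v i)) :=
    Integrable.fintype_prod hf
  simp only [hone]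
  rw [← ENNReal.ofReal_prod_of_nonneg fun i _ => integral_nonneg (h0 i),
    ← integral_fintype_prod_volume_eq_prod, maxwellMeasureN,
    withDensity_apply _ (MeasurableSet.univ_pi hs), ofReal_integral_eq_lintegral_ofReal hprod
      (Eventually.of_forall fun v => Finset.prod_nonneg fun i _ => h0 i _),
    ← lintegral_indicator (MeasurableSet.univ_pi hs)]
  refine lintegral_congr fun v => ?_
  by_cases hv : v ∈ univ.pi s
  · rw [indicator_of_mem hv, maxwellN_eq_prod hβ]
    congr 1
    exact Finset.prod_congr rfl fun i _ => (indicator_of_mem (hv i (mem_univ i)) _).symm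
  · rw [indicator_of_notMem hv]
    simp only [mem_univ_pi, not_forall] at hv
    obtain ⟨i, hi⟩ := hv
    rw [Finset.prod_eq_zero (Finset.mem_univ i) (indicator_of_notMem hi _), ENNReal.ofReal_zero]

lemma isProbabilityMeasure_maxwellMeasureN (hβ : 0 < β) :
    IsProbabilityMeasure (maxwellMeasureN N d β) := by
  have := isProbabilityMeasure_maxwellMeasure (d := d) hβ
  rw [maxwellMeasureN_eq_pi hβ]
  infer_instance

/-- The inner product of `ℝ^{dN}`, multiplied by the inverse temperature. -/
noncomputable def confForm (N d : ℕ) (β : ℝ) : Config N d →L[ℝ] Config N d →L[ℝ] ℝ :=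
  ∑ i, β • (innerSL ℝ (E := Velocity d)).bilinearComp
    (ContinuousLinearMap.proj i) (ContinuousLinearMap.proj i)

lemma confForm_apply (x y : Config N d) :
    confForm N d β x y = β * ∑ i, inner ℝ (x i) (y i) := by
  simp [confForm, Finset.mul_sum]

lemma confForm_self (x : Config N d) : confForm N d β x x = β * sqLength x := by
  simp [confForm_apply, sqLength]

lemma isGaussianFor_maxwell (hβ : 0 < β) :
    IsGaussianFor volume (maxwellMeasureN N d β) (confForm N d β)
      ((β / (2 * Real.pi)) ^ ((d : ℝ) * N / 2)) := by
  have hpi := Real.pi_pos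
  refine ⟨fun x y => ?_, fun x => ?_, ⟨β⁻¹, fun x => ?_⟩, by positivity, ?_,
    isProbabilityMeasure_maxwellMeasureN hβ, ?_⟩
  · simp only [confForm_apply, real_inner_comm]
  · rw [confForm_self]; exact mul_nonneg hβ.le (Finset.sum_nonneg fun _ _ => sq_nonneg _)
  -- The norm of a configuration is the maximum norm, which is dominated by the Euclidean length.
  · rw [confForm_self, ← mul_assoc, inv_mul_cancel₀ hβ.ne', one_mul]
    have h1 : ‖x‖ ≤ Real.sqrt (sqLength x) := (pi_norm_le_iff_of_nonneg (Real.sqrt_nonneg _)).2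
      fun i => Real.le_sqrt_of_sq_le (Finset.single_le_sum (f := fun i => ‖x i‖ ^ 2)
        (fun _ _ => sq_nonneg _) (Finset.mem_univ i))
    calc ‖x‖ ^ 2 ≤ Real.sqrt (sqLength x) ^ 2 := by gcongr
      _ = sqLength x := Real.sq_sqrt (Finset.sum_nonneg fun _ _ => sq_nonneg _)
  · unfold maxwellMeasureN
    congr 1
    funext v
    rw [confForm_self, maxwellN]
    congr 3; ring
  · have h1 : Integrable fun v : Config N d => ∏ i, Real.exp (-(β / 4) * ‖v i‖ ^ 2) :=
      Integrable.fintype_prod fun _ => integrable_exp_neg_mul_norm_sq (by positivity)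
    rw [maxwellMeasureN, integrable_withDensity_iff_integrable_smul' (by fun_prop)
      (Eventually.of_forall fun _ => ENNReal.ofReal_lt_top)]
    refine (h1.const_mul ((β / (2 * Real.pi)) ^ ((d : ℝ) * N / 2))).congr
      (Eventually.of_forall fun v => ?_)
    simp only [smul_eq_mul]
    rw [ENNReal.toReal_ofReal (maxwellN_pos hβ v).le, maxwellN, mul_assoc, ← Real.exp_add,
      ← Real.exp_sum, confForm_self, ← Finset.mul_sum]
    congr 2
    unfold sqLength; ring

end Maxwell

/-! ### The frame of projections that remove one velocity component. -/

section Frame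

variable {N d : ℕ} {β : ℝ}

/-- The orthogonal projection that removes the component along `σ` of the velocity `j`. -/
noncomputable def removeProj (j : Fin N) (σ : Angle d) : Config N d →L[ℝ] Config N d :=
  ContinuousLinearMap.id ℝ _ - (ContinuousLinearMap.single ℝ (fun _ => Velocity d) j).comp
    ((innerSL ℝ (σ : Velocity d)).smulRight (σ : Velocity d) |>.comp
      (ContinuousLinearMap.proj j))

lemma removeProj_apply (j : Fin N) (σ : Angle d) (v : Config N d) :
    removeProj j σ v = v - Pi.single j (inner ℝ (σ : Velocity d) (v j) • (σ : Velocity d)) := rfl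

lemma inner_angle_self (σ : Angle d) : inner ℝ (σ : Velocity d) (σ : Velocity d) = 1 := by
  rw [real_inner_self_eq_norm_sq, norm_eq_of_mem_sphere]; norm_num

lemma confForm_single (j : Fin N) (x : Velocity d) (v : Config N d) :
    confForm N d β (Pi.single j x) v = β * inner ℝ x (v j) := by
  rw [confForm_apply, Finset.sum_eq_single j]
  · simp
  · intro i _ hi; simp [hi]
  · simp

lemma confForm_symm (x y : Config N d) : confForm N d β x y = confForm N d β y x := by
  simp only [confForm_apply, real_inner_comm]

lemma confForm_removeProj (j : Fin N) (σ : Angle d) (x y : Config N d) :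
    confForm N d β (removeProj j σ x) y = confForm N d β x y -
      β * (inner ℝ (σ : Velocity d) (x j) * inner ℝ (σ : Velocity d) (y j)) := by
  rw [removeProj_apply, map_sub, sub_apply, confForm_single, real_inner_smul_left]

lemma isOrthProj_removeProj (j : Fin N) (σ : Angle d) :
    IsOrthProj (confForm N d β) (removeProj j σ) := by
  refine ⟨fun x => ?_, fun x y => ?_⟩
  · have h : inner ℝ (σ : Velocity d) (removeProj j σ x j) = 0 := by
      rw [removeProj_apply, Pi.sub_apply, Pi.single_eq_same, inner_sub_right,
        real_inner_smul_right, inner_angle_self]; ring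
    rw [removeProj_apply j σ (removeProj j σ x), h, zero_smul, Pi.single_zero, sub_zero]
  · rw [confForm_removeProj, confForm_symm x (removeProj j σ y), confForm_removeProj,
      confForm_symm y x]
    ring

lemma measurable_removeProj :
    Measurable fun q : (Fin N × Angle d) × Config N d => removeProj q.1.1 q.1.2 q.2 := by
  refine measurable_pi_iff.2 fun i => ?_
  have : ∀ q : (Fin N × Angle d) × Config N d, removeProj q.1.1 q.1.2 q.2 i =
      q.2 i - if q.1.1 = i then inner ℝ (q.1.2 : Velocity d) (q.2 i) • (q.1.2 : Velocity d)
        else 0 := fun q => by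
    rw [removeProj_apply, Pi.sub_apply]
    by_cases h : q.1.1 = i
    · rw [if_pos h, ← h, Pi.single_eq_same]
    · rw [if_neg h, Pi.single_eq_of_ne (Ne.symm h)]
  simp only [this]
  refine Measurable.sub (by fun_prop) (Measurable.ite ?_ ?_ measurable_const)
  · exact (measurable_fst.comp measurable_fst) (measurableSet_singleton i)
  · apply Continuous.measurable
    fun_prop

lemma finrank_config : Module.finrank ℝ (Config N d) = N * d := by
  rw [Module.finrank_pi_fintype]
  simp

/-- The map is `b` on the hyperplane fixed by the projection and `1` on the removed line. It is `b`
times a transvection in the general sense (a rank-one perturbation of the identity) of determinant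
`b⁻¹`. -/
lemma det_removeProj (j : Fin N) (σ : Angle d) {b : ℝ} (hb : 0 < b) :
    LinearMap.det (b • (removeProj j σ : Config N d →ₗ[ℝ] Config N d) +
      (1 - (removeProj j σ : Config N d →ₗ[ℝ] Config N d))) = b ^ (N * d - 1) := by
  set E : Config N d := Pi.single j (σ : Velocity d) with hE
  set ℓ : Module.Dual ℝ (Config N d) :=
    (innerSL ℝ (σ : Velocity d) : Velocity d →ₗ[ℝ] ℝ).comp (LinearMap.proj j) with hℓ
  have hℓv : ∀ v, ℓ v = inner ℝ (σ : Velocity d) (v j) := fun v => rfl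
  have hℓE : ℓ E = 1 := by rw [hℓv, hE, Pi.single_eq_same, inner_angle_self]
  have heq : b • (removeProj j σ : Config N d →ₗ[ℝ] Config N d) +
      (1 - (removeProj j σ : Config N d →ₗ[ℝ] Config N d)) =
      b • LinearMap.transvection ℓ ((b⁻¹ - 1) • E) := by
    refine LinearMap.ext fun v => ?_
    change b • removeProj j σ v + (v - removeProj j σ v) =
      b • (v + ℓ v • ((b⁻¹ - 1) • E))
    rw [removeProj_apply, hℓv, Pi.single_smul, ← hE]
    match_scalars
    · ring
    · field_simp
      ring
  have h1 : ℓ ((b⁻¹ - 1) • E) = b⁻¹ - 1 := by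
    rw [map_smul, hℓE]; simp
  -- The removed vector `E` is nonzero, so the dimension is positive and the natural subtraction in
  -- the exponent is genuine.
  have hNd : N * d ≠ 0 := by
    intro h
    have hfin := finrank_config (N := N) (d := d)
    rw [h] at hfin
    have : Subsingleton (Config N d) := Module.finrank_zero_iff.1 hfin
    have h2 := congrArg ℓ (Subsingleton.elim (E) 0)
    rw [hℓE, map_zero] at h2
    exact one_ne_zero h2
  rw [heq, LinearMap.det_smul, LinearMap.transvection.det, h1, finrank_config]
  obtain ⟨k, hk⟩ := Nat.exists_eq_succ_of_ne_zero hNd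
  rw [hk, Nat.succ_sub_one, pow_succ]
  field_simp
  ring

lemma integral_inner_sq {ρ : Measure (Angle d)} [IsProbabilityMeasure ρ]
    (hρ : SymmetryCondition ρ) (x : Velocity d) :
    ∫ σ : Angle d, inner ℝ (σ : Velocity d) x ^ 2 ∂ρ = ‖x‖ ^ 2 / d := by
  have hkl : ∀ k l : Fin d, ∫ σ : Angle d, (σ : Velocity d) k * (σ : Velocity d) l ∂ρ =
      1 / d * if k = l then 1 else 0 := fun k l => by
    have := congrFun (congrFun hρ k) l
    simpa [Matrix.one_apply] using this
  have hint : ∀ k l : Fin d,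
      Integrable (fun σ : Angle d => (σ : Velocity d) k * (σ : Velocity d) l) ρ := fun k l => by
    refine (integrable_const (1 : ℝ)).mono' ?_ (Eventually.of_forall fun σ => ?_)
    · apply Continuous.aestronglyMeasurable
      fun_prop
    · have hn : ‖(σ : Velocity d)‖ = 1 := norm_eq_of_mem_sphere σ
      have h1 := PiLp.norm_apply_le (σ : Velocity d) k
      have h2 := PiLp.norm_apply_le (σ : Velocity d) l
      rw [hn] at h1 h2
      rw [norm_mul]
      exact mul_le_one₀ h1 (norm_nonneg _) h2
  have hexp : ∀ σ : Angle d, inner ℝ (σ : Velocity d) x ^ 2 =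
      ∑ k, ∑ l, x k * x l * ((σ : Velocity d) k * (σ : Velocity d) l) := fun σ => by
    rw [PiLp.inner_apply, pow_two, Finset.sum_mul_sum]
    refine Finset.sum_congr rfl fun k _ => Finset.sum_congr rfl fun l _ => ?_
    simp only [RCLike.inner_apply, conj_trivial]
    ring
  simp only [hexp]
  rw [integral_finsetSum _ fun k _ => integrable_finsetSum _ fun l _ => (hint k l).const_mul _]
  simp only [integral_finsetSum _ fun l _ => (hint _ l).const_mul _, integral_const_mul, hkl]
  rw [EuclideanSpace.norm_sq_eq]
  simp only [mul_ite, mul_one, mul_zero, Finset.sum_ite_eq, Finset.mem_univ, if_true,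
    Real.norm_eq_abs, sq_abs, Finset.sum_div]
  exact Finset.sum_congr rfl fun k _ => by ring

/-- The uniform probability measure on the particle labels. -/
noncomputable def uniformLabel (N : ℕ) : Measure (Fin N) := (N : ℝ≥0∞)⁻¹ • Measure.count

lemma isProbabilityMeasure_uniformLabel (hN : 1 ≤ N) :
    IsProbabilityMeasure (uniformLabel N) := by
  constructor
  have : (N : ℝ≥0∞) ≠ 0 := by exact_mod_cast (by omega : N ≠ 0)
  simp [uniformLabel, Measure.count_univ, ENNReal.inv_mul_cancel this]

lemma lintegral_uniformLabel (F : Fin N → ℝ≥0∞) :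
    ∫⁻ j, F j ∂(uniformLabel N) = (N : ℝ≥0∞)⁻¹ * ∑ j, F j := by
  rw [uniformLabel, lintegral_smul_measure, lintegral_count, tsum_fintype, smul_eq_mul]

lemma integral_uniformLabel (F : Fin N → ℝ) :
    ∫ j, F j ∂(uniformLabel N) = (N : ℝ)⁻¹ * ∑ j, F j := by
  rw [uniformLabel, integral_smul_measure, integral_count]
  simp

lemma measurable_confForm_removeProj (x : Config N d) :
    Measurable fun e : Fin N × Angle d => confForm N d β (removeProj e.1 e.2 x) x := by
  have h1 : Measurable fun e : Fin N × Angle d => (e, x) := measurable_id.prodMk measurable_const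
  have h2 := (measurable_removeProj (N := N) (d := d)).comp h1
  have hB : Measurable ((confForm N d β).flip x) := ContinuousLinearMap.measurable _
  exact hB.comp h2

/-- The projections `removeProj j σ` form a tight frame. -/
lemma integral_confForm_removeProj (hd : 1 ≤ d) (hN : 1 ≤ N) (hβ : 0 < β)
    {ρ : Measure (Angle d)} [IsProbabilityMeasure ρ] (hρ : SymmetryCondition ρ)
    (x : Config N d) :
    ∫ e : Fin N × Angle d, confForm N d β (removeProj e.1 e.2 x) x ∂((uniformLabel N).prod ρ) =
      (1 - 1 / (N * d)) * confForm N d β x x := by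
  have hγ := isGaussianFor_maxwell (N := N) (d := d) hβ
  have := isProbabilityMeasure_uniformLabel hN
  have hN0 : (N : ℝ) ≠ 0 := by positivity
  have hd0 : (d : ℝ) ≠ 0 := by positivity
  have hint : ∀ x : Velocity d, Integrable (fun σ : Angle d => inner ℝ (σ : Velocity d) x ^ 2) ρ :=
    fun x => by
      refine (integrable_const (‖x‖ ^ 2)).mono' ?_ (Eventually.of_forall fun σ => ?_)
      · apply Continuous.aestronglyMeasurable
        fun_prop
      · have h2 := abs_real_inner_le_norm (σ : Velocity d) x
        rw [norm_eq_of_mem_sphere, one_mul] at h2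
        rw [norm_pow, Real.norm_eq_abs]
        gcongr
  have hval : ∀ (j : Fin N) (x : Config N d),
      ∫ σ, confForm N d β (removeProj j σ x) x ∂ρ =
        confForm N d β x x - β * (‖x j‖ ^ 2 / d) := fun j x => by
    simp only [confForm_removeProj, ← pow_two]
    rw [integral_sub (integrable_const _) ((hint _).const_mul _), integral_const_mul,
      integral_inner_sq hρ]
    simp
  rw [integral_prod, integral_uniformLabel]
  · simp only [hval]
    rw [Finset.sum_sub_distrib, ← Finset.mul_sum, ← Finset.sum_div, confForm_self]
    simp only [Finset.sum_const, Finset.card_univ, Fintype.card_fin, nsmul_eq_mul]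
    change (N : ℝ)⁻¹ * (N * (β * sqLength x) - β * (sqLength x / d)) = _
    field_simp
  · refine (integrable_const (confForm N d β x x)).mono'
      (measurable_confForm_removeProj x).aestronglyMeasurable (Eventually.of_forall fun e => ?_)
    have hP := isOrthProj_removeProj (β := β) e.1 e.2
    rw [← hP.apply_apply, Real.norm_of_nonneg (hγ.nonneg _)]
    exact hP.apply_self_le hγ x

lemma measurable_mehler_removeProj {γ : Measure (Config N d)} [SFinite γ] {h : Config N d → ℝ}
    (hm : Measurable h) : Measurable fun q : (Fin N × Angle d) × Config N d =>
      mehler γ 1 0 (removeProj q.1.1 q.1.2) h q.2 := by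
  have hmix : Measurable fun q : ((Fin N × Angle d) × Config N d) × Config N d =>
      mix 1 0 (removeProj q.1.1.1 q.1.1.2) (q.1.2, q.2) := by
    have e1 : Measurable fun q : ((Fin N × Angle d) × Config N d) × Config N d =>
      removeProj q.1.1.1 q.1.1.2 q.1.2 := measurable_removeProj.comp measurable_fst
    have e0 : Measurable fun q : ((Fin N × Angle d) × Config N d) × Config N d =>
      (q.1.1, q.2) := by fun_prop
    have e2 : Measurable fun q : ((Fin N × Angle d) × Config N d) × Config N d =>
        removeProj q.1.1.1 q.1.1.2 q.2 := measurable_removeProj.comp e0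
    exact ((e1.const_smul (1 : ℝ)).add (e2.const_smul (0 : ℝ))).add (measurable_snd.sub e2)
  exact ((hm.comp hmix).stronglyMeasurable.integral_prod_right' (ν := γ)).measurable

/-- Entropy subadditivity for the projections that remove one velocity component. -/
theorem sum_lintegral_klEntropy_removeProj_le (hd : 1 ≤ d) (hN : 1 ≤ N) (hβ : 0 < β)
    {ρ : Measure (Angle d)} [IsProbabilityMeasure ρ] (hρ : SymmetryCondition ρ)
    {h : Config N d → ℝ} (hm : Measurable h) (hh : Integrable h (maxwellMeasureN N d β))
    (h0 : ∀ x, 0 ≤ h x) (h1 : ∫ x, h x ∂(maxwellMeasureN N d β) = 1)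
    (hent : klEntropy (maxwellMeasureN N d β) h ≠ ⊤) :
    (N : ℝ≥0∞)⁻¹ * ∑ j : Fin N, ∫⁻ σ, klEntropy (maxwellMeasureN N d β)
      (mehler (maxwellMeasureN N d β) 1 0 (removeProj j σ) h) ∂ρ ≤
      ENNReal.ofReal (1 - 1 / (N * d)) * klEntropy (maxwellMeasureN N d β) h := by
  have hγ := isGaussianFor_maxwell (N := N) (d := d) hβ
  have := isProbabilityMeasure_uniformLabel hN
  have := hγ.prob
  have hNr : (1 : ℝ) ≤ N := by exact_mod_cast hN
  have hdr : (1 : ℝ) ≤ d := by exact_mod_cast hd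
  have hN0 : (N : ℝ) ≠ 0 := by positivity
  have hd0 : (d : ℝ) ≠ 0 := by positivity
  set c : ℝ := 1 - 1 / (N * d) with hc
  have hc0 : 0 ≤ c := by
    rw [hc, sub_nonneg, div_le_one (by positivity)]
    nlinarith
  -- The rank `N * d - 1` equals `c` times the dimension `N * d`, as the trace of the frame identity
  -- requires.
  have key := hγ.lintegral_klEntropy_proj_le (ν := (uniformLabel N).prod ρ)
    (P := fun e => removeProj e.1 e.2) (c := c) (k := N * d - 1)
    (fun e => isOrthProj_removeProj e.1 e.2) measurable_removeProj hc0
    (integral_confForm_removeProj hd hN hβ hρ)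
    (fun e b hb => det_removeProj e.1 e.2 hb) (by
      rw [finrank_config, Nat.cast_sub (by nlinarith), hc]
      push_cast
      field_simp) hm hh h0 h1 hent
  refine le_trans (le_of_eq ?_) key
  rw [lintegral_prod, lintegral_uniformLabel]
  exact (((InformationTheory.measurable_klFun.comp
    (measurable_mehler_removeProj hm)).ennreal_ofReal).lintegral_prod_right'
    (ν := maxwellMeasureN N d β)).aemeasurable

end Frame

/-! ### Invariance under random maps, one parameter at a time. -/

section RandomMaps

lemma measurePreserving_of_forall {A S X : Type*} [MeasurableSpace A] [MeasurableSpace S]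
    [MeasurableSpace X] {α : Measure A} [SFinite α] {ρ : Measure S} [IsProbabilityMeasure ρ]
    {γ : Measure X} {T : A × S → X} (hT : Measurable T)
    (h : ∀ σ, MeasurePreserving (fun a => T (a, σ)) α γ) :
    MeasurePreserving T (α.prod ρ) γ := by
  refine ⟨hT, ?_⟩
  ext s hs
  rw [Measure.map_apply hT hs, Measure.prod_apply_symm (hT hs)]
  have : ∀ σ, α ((fun a => (a, σ)) ⁻¹' (T ⁻¹' s)) = γ s := fun σ =>
    (h σ).measure_preimage hs.nullMeasurableSet
  simp [this]

end RandomMaps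

/-! ### Thermostat collisions as conditional expectations. -/

section Thermostat

variable {N d : ℕ} {β : ℝ}

/-- The velocities of the particles after the collision of particle `j` with a thermostat
particle. -/
noncomputable def thermoMap (j : Fin N) (q : Config N d × (Velocity d × Angle d)) : Config N d :=
  q.1 - Pi.single j (inner ℝ (q.2.2 : Velocity d) (q.1 j - q.2.1) • (q.2.2 : Velocity d))

lemma continuous_single (j : Fin N) :
    Continuous fun x : Velocity d => (Pi.single j x : Config N d) :=
  (ContinuousLinearMap.single ℝ (fun _ : Fin N => Velocity d) j).continuous

lemma continuous_thermoMap (j : Fin N) :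
    Continuous (thermoMap j : Config N d × (Velocity d × Angle d) → Config N d) := by
  refine continuous_fst.sub ((continuous_single j).comp ?_)
  fun_prop

lemma init_collide (σ : Angle d) (j : Fin N) (v : Config N d) (w : Velocity d) :
    Fin.init (α := fun _ => Velocity d) (collide σ j.castSucc (Fin.last N)
      (Fin.snoc (α := fun _ => Velocity d) v w)) = thermoMap j (v, (w, σ)) := by
  funext i
  have h1 : i.castSucc ≠ Fin.last N := (Fin.castSucc_lt_last i).ne
  simp only [Fin.init, collide, thermoMap, Function.update_of_ne h1, Pi.sub_apply]
  by_cases h : i = j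
  · subst h
    simp only [Function.update_self, Fin.snoc_castSucc, Fin.snoc_last, Pi.single_eq_same]
  · have h2 : i.castSucc ≠ j.castSucc := fun hc => h (Fin.castSucc_injective _ hc)
    simp only [Function.update_of_ne h2, Fin.snoc_castSucc, Pi.single_eq_of_ne h, sub_zero]

lemma collide_last (σ : Angle d) (j : Fin N) (v : Config N d) (w : Velocity d) :
    collide σ j.castSucc (Fin.last N) (Fin.snoc (α := fun _ => Velocity d) v w) (Fin.last N) =
      w + inner ℝ (σ : Velocity d) (v j - w) • (σ : Velocity d) := by
  simp only [collide, Function.update_self, Fin.snoc_castSucc, Fin.snoc_last]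

lemma sqLength_single (σ : Angle d) (j : Fin N) :
    sqLength (Pi.single j (σ : Velocity d) : Config N d) = 1 := by
  have h := confForm_self (β := 1) (Pi.single j (σ : Velocity d) : Config N d)
  rw [confForm_single, Pi.single_eq_same, inner_angle_self] at h
  linarith

/-- Conservation of kinetic energy in the collision with the thermostat particle. -/
lemma maxwell_mul_maxwellN (σ : Angle d) (j : Fin N) (v : Config N d)
    (w : Velocity d) :
    maxwell β (w + inner ℝ (σ : Velocity d) (v j - w) • (σ : Velocity d)) *
      maxwellN β (thermoMap j (v, (w, σ))) = maxwell β w * maxwellN β v := by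
  set c := inner ℝ (σ : Velocity d) (v j - w) with hc
  have hc' : c = inner ℝ (σ : Velocity d) (v j) - inner ℝ (σ : Velocity d) w := by
    rw [hc, inner_sub_right]
  have h1 : thermoMap j (v, (w, σ)) = v - c • (Pi.single j (σ : Velocity d) : Config N d) := by
    rw [← Pi.single_smul]; rfl
  have h2 : sqLength (thermoMap j (v, (w, σ))) =
      sqLength v - 2 * c * inner ℝ (σ : Velocity d) (v j) + c ^ 2 := by
    have e1 := confForm_self (β := 1) (thermoMap j (v, (w, σ)))
    rw [h1] at e1 ⊢
    simp only [map_sub, map_smul, sub_apply, smul_apply, smul_eq_mul,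
      confForm_symm v (Pi.single j (σ : Velocity d)), confForm_single, confForm_self,
      sqLength_single] at e1
    linear_combination -e1
  have h3 : ‖w + c • (σ : Velocity d)‖ ^ 2 =
      ‖w‖ ^ 2 + 2 * c * inner ℝ (σ : Velocity d) w + c ^ 2 := by
    rw [norm_add_sq_real, norm_smul, real_inner_smul_right, norm_eq_of_mem_sphere,
      real_inner_comm, Real.norm_eq_abs, mul_one, sq_abs]
    ring
  have h4 : ∀ C D x y : ℝ, C * Real.exp x * (D * Real.exp y) = C * D * Real.exp (x + y) :=
    fun C D x y => by rw [Real.exp_add]; ring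
  simp only [maxwell, maxwellN, h4]
  rw [h2, h3]
  congr 2
  rw [hc']; ring

/-- In terms of densities relative to the Gaussian, the thermostat averages over the
velocity of the thermostat particle. -/
lemma thermostatOpAt_eq (hβ : 0 < β) (ρ : Measure (Angle d)) (j : Fin N)
    (f : Config N d → ℝ) (v : Config N d) :
    thermostatOpAt β ρ j f v = maxwellN β v * ∫ w, ∫ σ,
      f (thermoMap j (v, (w, σ))) / maxwellN β (thermoMap j (v, (w, σ))) ∂ρ
        ∂(maxwellMeasure d β) := by
  rw [maxwellMeasure, integral_withDensity_eq_integral_toReal_smul (by fun_prop)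
    (Eventually.of_forall fun _ => ENNReal.ofReal_lt_top), ← integral_const_mul, thermostatOpAt]
  refine integral_congr_ae (Eventually.of_forall fun w => ?_)
  simp only [init_collide, collide_last, smul_eq_mul]
  rw [ENNReal.toReal_ofReal (maxwell_pos hβ w).le, ← integral_const_mul, ← integral_const_mul]
  refine integral_congr_ae (Eventually.of_forall fun σ => ?_)
  have h1 := maxwell_mul_maxwellN (β := β) σ j v w
  have h2 := (maxwellN_pos hβ (thermoMap j (v, (w, σ)))).ne'
  simp only []
  rw [← mul_assoc, mul_comm (maxwellN β v), ← h1]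
  field_simp

lemma measurePreserving_eval_maxwell (hβ : 0 < β) (j : Fin N) :
    MeasurePreserving (fun z : Config N d => z j) (maxwellMeasureN N d β)
      (maxwellMeasure d β) := by
  have := isProbabilityMeasure_maxwellMeasure (d := d) hβ
  rw [maxwellMeasureN_eq_pi hβ]
  exact measurePreserving_eval (fun _ : Fin N => maxwellMeasure d β) j

/-- The link with the frame: for `a = 1`, `b = 0` the mixture only substitutes the `σ`-component of
`z j` for that of `v j`, which is the effect of a thermostat particle of velocity `z j`. -/
lemma mix_removeProj (j : Fin N) (σ : Angle d) (v z : Config N d) :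
    mix 1 0 (removeProj j σ) (v, z) = thermoMap j (v, (z j, σ)) := by
  simp only [mix, thermoMap, removeProj_apply, inner_sub_right, sub_smul, Pi.single_sub]
  module

lemma measurePreserving_thermoMap_angle (hβ : 0 < β) (j : Fin N) (σ : Angle d) :
    MeasurePreserving (fun p : Config N d × Velocity d => thermoMap j (p.1, (p.2, σ)))
      ((maxwellMeasureN N d β).prod (maxwellMeasure d β)) (maxwellMeasureN N d β) := by
  have hγ := isGaussianFor_maxwell (N := N) (d := d) hβ
  have := hγ.prob
  have := isProbabilityMeasure_maxwellMeasure (d := d) hβ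
  have hm : Measurable fun p : Config N d × Velocity d => thermoMap j (p.1, (p.2, σ)) :=
    (continuous_thermoMap j).measurable.comp (by fun_prop)
  refine ⟨hm, ?_⟩
  have h1 := (hγ.measurePreserving_mix (isOrthProj_removeProj j σ)
    (a := 1) (b := 0) (by norm_num)).map_eq
  have h2 := Measure.map_prod_map (maxwellMeasureN N d β) (maxwellMeasureN N d β)
    measurable_id (measurePreserving_eval_maxwell (d := d) hβ j).measurable
  rw [Measure.map_id, (measurePreserving_eval_maxwell hβ j).map_eq] at h2
  rw [h2, Measure.map_map hm (measurable_id.prodMap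
    (measurePreserving_eval_maxwell (d := d) hβ j).measurable)]
  conv_rhs => rw [← h1]
  congr 1
  funext p
  exact (mix_removeProj j σ p.1 p.2).symm

lemma measurePreserving_thermoMap (hβ : 0 < β) (ρ : Measure (Angle d)) [IsProbabilityMeasure ρ]
    (j : Fin N) :
    MeasurePreserving (thermoMap j) ((maxwellMeasureN N d β).prod ((maxwellMeasure d β).prod ρ))
      (maxwellMeasureN N d β) := by
  have := isProbabilityMeasure_maxwellMeasureN (N := N) (d := d) hβ
  have := isProbabilityMeasure_maxwellMeasure (d := d) hβ
  have hm : Measurable fun p : (Config N d × Velocity d) × Angle d =>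
      thermoMap j (p.1.1, (p.1.2, p.2)) := (continuous_thermoMap j).measurable.comp (by fun_prop)
  have h1 := measurePreserving_of_forall (ρ := ρ) hm
    fun σ => measurePreserving_thermoMap_angle hβ j σ
  have h2 := measurePreserving_prodAssoc (maxwellMeasureN N d β) (maxwellMeasure d β) ρ
  exact h1.comp (h2.symm MeasurableEquiv.prodAssoc)

lemma mehler_removeProj (hβ : 0 < β) (j : Fin N) (σ : Angle d) {h : Config N d → ℝ}
    (hm : Measurable h) (v : Config N d) :
    mehler (maxwellMeasureN N d β) 1 0 (removeProj j σ) h v =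
      ∫ w, h (thermoMap j (v, (w, σ))) ∂(maxwellMeasure d β) := by
  have he := measurePreserving_eval_maxwell (N := N) (d := d) hβ j
  have hm' : Measurable fun w : Velocity d => h (thermoMap j (v, (w, σ))) :=
    hm.comp ((continuous_thermoMap j).measurable.comp (by fun_prop))
  rw [mehler, average, ← he.map_eq, integral_map he.measurable.aemeasurable
    hm'.aestronglyMeasurable]
  simp only [mix_removeProj]

/-- Jensen's inequality is applied in the angle only. The average over the thermostat velocity stays
inside the entropy, since the gain comes from that conditional expectation. -/
lemma klEntropy_average_thermoMap_le (hβ : 0 < β) (ρ : Measure (Angle d))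
    [IsProbabilityMeasure ρ] (j : Fin N) {h : Config N d → ℝ} (hm : Measurable h)
    (hh : Integrable h (maxwellMeasureN N d β)) (h0 : ∀ x, 0 ≤ h x) :
    klEntropy (maxwellMeasureN N d β)
      (average ((maxwellMeasure d β).prod ρ) (thermoMap j) h) ≤
      ∫⁻ σ, klEntropy (maxwellMeasureN N d β)
        (mehler (maxwellMeasureN N d β) 1 0 (removeProj j σ) h) ∂ρ := by
  have := isProbabilityMeasure_maxwellMeasureN (N := N) (d := d) hβ
  have := isProbabilityMeasure_maxwellMeasure (d := d) hβ
  have hmeas : Measurable fun q : Angle d × Config N d =>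
      mehler (maxwellMeasureN N d β) 1 0 (removeProj j q.1) h q.2 := by
    have h1 := measurable_mehler_removeProj (N := N) (d := d) (γ := maxwellMeasureN N d β) hm
    have h2 : Measurable fun q : Angle d × Config N d => ((j, q.1), q.2) := by fun_prop
    have h3 := h1.comp h2
    exact h3
  simp only [klEntropy]
  rw [lintegral_lintegral_swap
    ((InformationTheory.measurable_klFun.comp hmeas).ennreal_ofReal.aemeasurable)]
  refine lintegral_mono_ae ?_
  filter_upwards [ae_integrable_average (measurePreserving_thermoMap hβ ρ j) hh] with v hv
  rw [average, integral_prod_symm _ hv]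
  simp only [← mehler_removeProj hβ j _ hm v]
  refine ofReal_klFun_integral_le ?_ (Eventually.of_forall fun σ => average_nonneg h0 _)
  have := hv.integral_prod_right
  simpa only [← mehler_removeProj hβ j _ hm v] using this

end Thermostat

/-! ### Collisions inside the system preserve the Gaussian. -/

section Collision

variable {N d : ℕ} {β : ℝ}

lemma collide_eq {i j : Fin N} (hij : i ≠ j) (σ : Angle d) (v : Config N d) :
    collide σ i j v = v - inner ℝ (σ : Velocity d) (v i - v j) •
      ((Pi.single i (σ : Velocity d) : Config N d) - Pi.single j (σ : Velocity d)) := by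
  funext k
  rw [collide]
  by_cases hk : k = j
  · subst hk
    simp [hij.symm]
  · by_cases hi : k = i
    · subst hi
      simp [hij]
    · simp [hk, hi]

/-- The collision as a linear map. -/
noncomputable def collideL (i j : Fin N) (σ : Angle d) : Config N d →L[ℝ] Config N d :=
  ContinuousLinearMap.id ℝ _ -
    ((innerSL ℝ (σ : Velocity d)).comp
      (ContinuousLinearMap.proj (R := ℝ) (φ := fun _ : Fin N => Velocity d) i -
        ContinuousLinearMap.proj (R := ℝ) (φ := fun _ : Fin N => Velocity d) j)).smulRight
      ((Pi.single i (σ : Velocity d) : Config N d) - Pi.single j (σ : Velocity d))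

lemma collideL_apply {i j : Fin N} (hij : i ≠ j) (σ : Angle d) (v : Config N d) :
    collideL i j σ v = collide σ i j v := by
  rw [collide_eq hij]; rfl

lemma collide_collide {i j : Fin N} (hij : i ≠ j) (σ : Angle d) (v : Config N d) :
    collide σ i j (collide σ i j v) = v := by
  set c := inner ℝ (σ : Velocity d) (v i - v j) with hc
  have h : inner ℝ (σ : Velocity d) (collide σ i j v i - collide σ i j v j) = -c := by
    rw [collide_eq hij]
    simp only [Pi.sub_apply, Pi.smul_apply, Pi.single_eq_same, Pi.single_eq_of_ne hij,
      Pi.single_eq_of_ne hij.symm, inner_sub_right, real_inner_smul_right, inner_angle_self,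
      inner_zero_right]
    rw [hc, inner_sub_right]
    ring
  rw [collide_eq hij σ (collide σ i j v), h, collide_eq hij]
  module

lemma sqLength_collide {i j : Fin N} (hij : i ≠ j) (σ : Angle d) (v : Config N d) :
    sqLength (collide σ i j v) = sqLength v := by
  set c := inner ℝ (σ : Velocity d) (v i - v j) with hc
  have hc' : c = inner ℝ (σ : Velocity d) (v i) - inner ℝ (σ : Velocity d) (v j) := by
    rw [hc, inner_sub_right]
  have e1 := confForm_self (β := 1) (collide σ i j v)
  rw [collide_eq hij, ← hc] at e1 ⊢
  simp only [map_sub, map_smul, sub_apply, smul_apply, smul_eq_mul,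
    confForm_symm v (Pi.single i (σ : Velocity d)), confForm_symm v (Pi.single j (σ : Velocity d)),
    confForm_single, Pi.single_eq_of_ne hij, Pi.single_eq_of_ne hij.symm,
    inner_zero_right, confForm_self, sqLength_single] at e1
  linear_combination -e1 + 2 * c * hc'

lemma maxwellN_collide {i j : Fin N} (hij : i ≠ j) (σ : Angle d) (v : Config N d) :
    maxwellN β (collide σ i j v) = maxwellN β v := by
  rw [maxwellN, sqLength_collide hij]; rfl

/-- The collision of the particles `i` and `j` with random scattering angle. -/
noncomputable def collideMap (i j : Fin N) (q : Config N d × Angle d) : Config N d :=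
  collide q.2 i j q.1

lemma measurable_collideMap {i j : Fin N} (hij : i ≠ j) :
    Measurable (collideMap i j : Config N d × Angle d → Config N d) := by
  unfold collideMap
  simp only [collide_eq hij]
  apply Continuous.measurable
  have h1 : Continuous fun q : Config N d × Angle d =>
      (Pi.single i (q.2 : Velocity d) : Config N d) := (continuous_single i).comp (by fun_prop)
  have h2 : Continuous fun q : Config N d × Angle d =>
      (Pi.single j (q.2 : Velocity d) : Config N d) := (continuous_single j).comp (by fun_prop)
  fun_prop

lemma measurePreserving_collideMap (ρ : Measure (Angle d)) [IsProbabilityMeasure ρ]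
    {i j : Fin N} (hij : i ≠ j) :
    MeasurePreserving (collideMap i j) ((maxwellMeasureN N d β).prod ρ)
      (maxwellMeasureN N d β) := by
  have : SFinite (maxwellMeasureN N d β) := by unfold maxwellMeasureN; infer_instance
  refine measurePreserving_of_forall (measurable_collideMap hij) fun σ => ?_
  have h1 : MeasurePreserving (collideL i j σ) (volume : Measure (Config N d)) volume :=
    measurePreserving_of_involutive _ _ fun v => by
      simp only [collideL_apply hij, collide_collide hij]
  have h2 := measurePreserving_withDensity h1
    (g := fun v => ENNReal.ofReal (maxwellN β v)) (by fun_prop) fun v => by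
      rw [collideL_apply hij, maxwellN_collide hij]
  have h3 : (fun v : Config N d => collideMap i j (v, σ)) = collideL i j σ :=
    funext fun v => (collideL_apply hij σ v).symm
  rw [h3]
  exact h2

/-- The Maxwell density is invariant under the collision and can be moved in and out of the average.
-/
lemma integral_collide_eq (hβ : 0 < β) (ρ : Measure (Angle d)) {i j : Fin N} (hij : i ≠ j)
    (f : Config N d → ℝ) (v : Config N d) :
    ∫ σ, f (collide σ i j v) ∂ρ =
      maxwellN β v * average ρ (collideMap i j) (fun v => f v / maxwellN β v) v := by
  rw [average, ← integral_const_mul]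
  refine integral_congr_ae (Eventually.of_forall fun σ => ?_)
  have := (maxwellN_pos hβ v).ne'
  simp only [collideMap, maxwellN_collide hij]
  field_simp

end Collision

/-! ### Densities relative to the Gaussian and operators on `L¹`. -/

section RelativeDensity

variable {N d : ℕ} {β : ℝ}

/-- The integrable functions on the phase space of `N` particles. -/
abbrev ConfL1 (N d : ℕ) : Type := Lp ℝ 1 (volume : Measure (Config N d))

/-- The density of `f` relative to the Gaussian. -/
noncomputable def rel (β : ℝ) (f : Config N d → ℝ) (v : Config N d) : ℝ := f v / maxwellN β v

/-- Positivity of the Maxwell density; statements valid almost everywhere pass freely between the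
two measures. -/
lemma ae_maxwellMeasureN (hβ : 0 < β) :
    ae (maxwellMeasureN N d β) = ae (volume : Measure (Config N d)) := by
  refine le_antisymm (withDensity_absolutelyContinuous _ _).ae_le
    (withDensity_absolutelyContinuous' (by fun_prop) (Eventually.of_forall fun v => ?_)).ae_le
  exact (ENNReal.ofReal_pos.2 (maxwellN_pos hβ v)).ne'

lemma integrable_maxwellMeasureN_iff (hβ : 0 < β) {g : Config N d → ℝ} :
    Integrable g (maxwellMeasureN N d β) ↔ Integrable (fun v => maxwellN β v * g v) := by
  rw [maxwellMeasureN, integrable_withDensity_iff_integrable_smul' (by fun_prop)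
    (Eventually.of_forall fun _ => ENNReal.ofReal_lt_top)]
  simp only [ENNReal.toReal_ofReal (maxwellN_pos hβ _).le, smul_eq_mul]

lemma integral_maxwellMeasureN (hβ : 0 < β) (g : Config N d → ℝ) :
    ∫ v, g v ∂(maxwellMeasureN N d β) = ∫ v, maxwellN β v * g v := by
  rw [maxwellMeasureN, integral_withDensity_eq_integral_toReal_smul (by fun_prop)
    (Eventually.of_forall fun _ => ENNReal.ofReal_lt_top)]
  simp only [ENNReal.toReal_ofReal (maxwellN_pos hβ _).le, smul_eq_mul]

lemma maxwellN_mul_rel (hβ : 0 < β) (f : Config N d → ℝ) (v : Config N d) :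
    maxwellN β v * rel β f v = f v := mul_div_cancel₀ _ (maxwellN_pos hβ v).ne'

lemma rel_maxwellN_mul (hβ : 0 < β) (g : Config N d → ℝ) (v : Config N d) :
    rel β (fun v => maxwellN β v * g v) v = g v :=
  mul_div_cancel_left₀ _ (maxwellN_pos hβ v).ne'

lemma integrable_rel (hβ : 0 < β) {f : Config N d → ℝ} (hf : Integrable f) :
    Integrable (rel β f) (maxwellMeasureN N d β) := by
  rw [integrable_maxwellMeasureN_iff hβ]
  simpa only [maxwellN_mul_rel hβ] using hf

lemma integral_rel (hβ : 0 < β) (f : Config N d → ℝ) :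
    ∫ v, rel β f v ∂(maxwellMeasureN N d β) = ∫ v, f v := by
  rw [integral_maxwellMeasureN hβ]
  simp only [maxwellN_mul_rel hβ]

lemma integral_abs_rel (hβ : 0 < β) (f : Config N d → ℝ) :
    ∫ v, |rel β f v| ∂(maxwellMeasureN N d β) = ∫ v, |f v| := by
  rw [integral_maxwellMeasureN hβ]
  refine integral_congr_ae (Eventually.of_forall fun v => ?_)
  simp only [rel, abs_div, abs_of_pos (maxwellN_pos hβ v)]
  exact mul_div_cancel₀ _ (maxwellN_pos hβ v).ne'

lemma rel_congr (hβ : 0 < β) {f g : Config N d → ℝ} (h : f =ᵐ[volume] g) :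
    rel β f =ᵐ[maxwellMeasureN N d β] rel β g := by
  unfold Filter.EventuallyEq
  rw [ae_maxwellMeasureN hβ]
  filter_upwards [h] with v hv
  simp only [rel, hv]

lemma norm_confL1 (f : ConfL1 N d) : ‖f‖ = ∫ v, |f v| := by
  rw [L1.norm_eq_integral_norm]; rfl

lemma integrable_confL1 (f : ConfL1 N d) : Integrable f := L1.integrable_coeFn f

variable {Ω : Type*} [MeasurableSpace Ω] {ν : Measure Ω} [IsProbabilityMeasure ν]
  {T : Config N d × Ω → Config N d}

lemma integrable_maxwellN_mul_average (hβ : 0 < β)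
    (hT : MeasurePreserving T ((maxwellMeasureN N d β).prod ν) (maxwellMeasureN N d β))
    {f : Config N d → ℝ} (hf : Integrable f) :
    Integrable fun v => maxwellN β v * average ν T (rel β f) v := by
  have : SFinite (maxwellMeasureN N d β) := by unfold maxwellMeasureN; infer_instance
  exact (integrable_maxwellMeasureN_iff hβ).1 (integrable_average hT (integrable_rel hβ hf))

/-- The operator on `L¹` of the random map `T` that preserves the Gaussian. -/
noncomputable def markovOp (hβ : 0 < β)
    (hT : MeasurePreserving T ((maxwellMeasureN N d β).prod ν) (maxwellMeasureN N d β)) :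
    ConfL1 N d →L[ℝ] ConfL1 N d :=
  LinearMap.mkContinuous
    { toFun := fun f =>
        (integrable_maxwellN_mul_average hβ hT (integrable_confL1 f)).toL1 _
      map_add' := fun f g => by
        have : SFinite (maxwellMeasureN N d β) := by unfold maxwellMeasureN; infer_instance
        rw [← Integrable.toL1_add, Integrable.toL1_eq_toL1_iff]
        have h1 : rel β (f + g : ConfL1 N d) =ᵐ[maxwellMeasureN N d β]
            fun v => rel β f v + rel β g v := by
          refine (rel_congr hβ (Lp.coeFn_add f g)).trans (Eventually.of_forall fun v => ?_)
          simp only [rel, Pi.add_apply, add_div]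
        have h2 := (average_congr hT h1).trans (average_add hT
          (integrable_rel hβ (integrable_confL1 f)) (integrable_rel hβ (integrable_confL1 g)))
        unfold Filter.EventuallyEq at h2
        rw [ae_maxwellMeasureN hβ] at h2
        filter_upwards [h2] with v hv
        simp only [hv, Pi.add_apply, mul_add]
      map_smul' := fun c f => by
        have : SFinite (maxwellMeasureN N d β) := by unfold maxwellMeasureN; infer_instance
        rw [RingHom.id_apply, ← Integrable.toL1_smul', Integrable.toL1_eq_toL1_iff]
        have h1 : rel β (c • f : ConfL1 N d) =ᵐ[maxwellMeasureN N d β]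
            fun v => c * rel β f v := by
          refine (rel_congr hβ (Lp.coeFn_smul c f)).trans (Eventually.of_forall fun v => ?_)
          simp only [rel, Pi.smul_apply, smul_eq_mul, mul_div_assoc]
        have h2 := average_congr hT h1
        unfold Filter.EventuallyEq at h2
        rw [ae_maxwellMeasureN hβ] at h2
        filter_upwards [h2] with v hv
        simp only [hv, Pi.smul_apply, smul_eq_mul, average_const_mul]
        ring } 1 (fun f => by
    have : SFinite (maxwellMeasureN N d β) := by unfold maxwellMeasureN; infer_instance
    rw [one_mul]
    change ‖(integrable_maxwellN_mul_average hβ hT (integrable_confL1 f)).toL1 _‖ ≤ _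
    rw [L1.norm_of_fun_eq_integral_norm, norm_confL1, ← integral_abs_rel hβ f]
    refine le_trans (le_of_eq ?_)
      (integral_abs_average_le hT (integrable_rel hβ (integrable_confL1 f)))
    rw [integral_maxwellMeasureN hβ]
    refine integral_congr_ae (Eventually.of_forall fun v => ?_)
    simp only [Real.norm_eq_abs, abs_mul, abs_of_pos (maxwellN_pos hβ v)])

lemma markovOp_ae (hβ : 0 < β)
    (hT : MeasurePreserving T ((maxwellMeasureN N d β).prod ν) (maxwellMeasureN N d β))
    (f : ConfL1 N d) :
    markovOp hβ hT f =ᵐ[volume] fun v => maxwellN β v * average ν T (rel β f) v :=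
  (integrable_maxwellN_mul_average hβ hT (integrable_confL1 f)).coeFn_toL1

lemma norm_markovOp_le (hβ : 0 < β)
    (hT : MeasurePreserving T ((maxwellMeasureN N d β).prod ν) (maxwellMeasureN N d β))
    (f : ConfL1 N d) : ‖markovOp hβ hT f‖ ≤ ‖f‖ := by
  refine (ContinuousLinearMap.le_opNorm _ f).trans ?_
  have : ‖markovOp hβ hT‖ ≤ 1 := LinearMap.mkContinuous_norm_le _ zero_le_one _
  nlinarith [norm_nonneg f]

lemma rel_markovOp (hβ : 0 < β)
    (hT : MeasurePreserving T ((maxwellMeasureN N d β).prod ν) (maxwellMeasureN N d β))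
    (f : ConfL1 N d) :
    rel β (markovOp hβ hT f) =ᵐ[maxwellMeasureN N d β] average ν T (rel β f) :=
  (rel_congr hβ (markovOp_ae hβ hT f)).trans
    (Eventually.of_forall fun v => rel_maxwellN_mul hβ _ v)

end RelativeDensity

/-! ### Entropy bounds and their stability under averaging and convex combinations. -/

section EntropyBound

open InformationTheory

variable {N d : ℕ} {β : ℝ}

/-- `f` is a probability density whose entropy relative to the Gaussian is at most `E`. -/
structure HasEntropyLE (β : ℝ) (E : ℝ≥0∞) (f : ConfL1 N d) : Prop where
  nonneg : 0 ≤ᵐ[volume] f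
  mass : ∫ v, f v = 1
  le : klEntropy (maxwellMeasureN N d β) (rel β f) ≤ E

/-- A version of the relative density that is measurable and nonnegative everywhere. -/
lemma HasEntropyLE.exists_version (hβ : 0 < β) {E : ℝ≥0∞} {f : ConfL1 N d}
    (hf : HasEntropyLE β E f) :
    ∃ h : Config N d → ℝ, Measurable h ∧ Integrable h (maxwellMeasureN N d β) ∧ (∀ v, 0 ≤ h v) ∧
      ∫ v, h v ∂(maxwellMeasureN N d β) = 1 ∧ rel β f =ᵐ[maxwellMeasureN N d β] h ∧
      klEntropy (maxwellMeasureN N d β) h ≤ E := by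
  have hm : Measurable (rel β f : Config N d → ℝ) :=
    (Lp.stronglyMeasurable f).measurable.div continuous_maxwellN.measurable
  have hae : rel β f =ᵐ[maxwellMeasureN N d β] fun v => max (rel β f v) 0 := by
    unfold Filter.EventuallyEq
    rw [ae_maxwellMeasureN hβ]
    filter_upwards [hf.nonneg] with v hv
    exact (max_eq_left (div_nonneg hv (maxwellN_pos hβ v).le)).symm
  refine ⟨fun v => max (rel β f v) 0, hm.max measurable_const,
    (integrable_rel hβ (integrable_confL1 f)).congr hae, fun v => le_max_right _ _, ?_, hae, ?_⟩
  · rw [← integral_congr_ae hae, integral_rel hβ, hf.mass]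
  · rw [← klEntropy_congr hae]; exact hf.le

lemma HasEntropyLE.mono {E E' : ℝ≥0∞} {f : ConfL1 N d} (hf : HasEntropyLE β E f) (h : E ≤ E') :
    HasEntropyLE β E' f := ⟨hf.nonneg, hf.mass, hf.le.trans h⟩

variable {Ω : Type*} [MeasurableSpace Ω] {ν : Measure Ω} [IsProbabilityMeasure ν]
  {T : Config N d × Ω → Config N d}

/-- The entropy bound is required only for a chosen version `h`, because the frame estimate concerns
functions that are measurable and nonnegative everywhere. -/
lemma HasEntropyLE.markovOp_of_le (hβ : 0 < β)
    (hT : MeasurePreserving T ((maxwellMeasureN N d β).prod ν) (maxwellMeasureN N d β))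
    {E E' : ℝ≥0∞} {f : ConfL1 N d} (hf : HasEntropyLE β E f) {h : Config N d → ℝ}
    (h0 : ∀ v, 0 ≤ h v) (hh : rel β f =ᵐ[maxwellMeasureN N d β] h)
    (hE : klEntropy (maxwellMeasureN N d β) (average ν T h) ≤ E') :
    HasEntropyLE β E' (markovOp hβ hT f) := by
  have : SFinite (maxwellMeasureN N d β) := by unfold maxwellMeasureN; infer_instance
  have hae := (rel_markovOp hβ hT f).trans (average_congr hT hh)
  refine ⟨?_, ?_, (klEntropy_congr hae).trans_le hE⟩
  · have h1 := average_congr hT hh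
    unfold Filter.EventuallyEq at h1
    rw [ae_maxwellMeasureN hβ] at h1
    filter_upwards [markovOp_ae hβ hT f, h1] with v hv hv1
    rw [hv, hv1]
    exact mul_nonneg (maxwellN_pos hβ v).le (average_nonneg h0 v)
  · rw [integral_congr_ae (markovOp_ae hβ hT f), ← integral_maxwellMeasureN hβ,
      integral_average hT (integrable_rel hβ (integrable_confL1 f)), integral_rel hβ, hf.mass]

lemma HasEntropyLE.markovOp (hβ : 0 < β)
    (hT : MeasurePreserving T ((maxwellMeasureN N d β).prod ν) (maxwellMeasureN N d β))
    {E : ℝ≥0∞} {f : ConfL1 N d} (hf : HasEntropyLE β E f) :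
    HasEntropyLE β E (KacThermostat.markovOp hβ hT f) := by
  have : SFinite (maxwellMeasureN N d β) := by unfold maxwellMeasureN; infer_instance
  obtain ⟨h, hm, hi, h0, -, hh, hE⟩ := hf.exists_version hβ
  exact hf.markovOp_of_le hβ hT h0 hh ((klEntropy_average_le hT hm hi h0).trans hE)

lemma coeFn_sum_smul {ι : Type*} (s : Finset ι) (w : ι → ℝ) (f : ι → ConfL1 N d) :
    (∑ i ∈ s, w i • f i : ConfL1 N d) =ᵐ[volume] fun v => ∑ i ∈ s, w i * f i v := by
  classical
  induction s using Finset.induction_on with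
  | empty => simp only [Finset.sum_empty]; exact Lp.coeFn_zero _ _ _
  | insert a s ha ih =>
    rw [Finset.sum_insert ha]
    filter_upwards [Lp.coeFn_add (w a • f a) (∑ i ∈ s, w i • f i), Lp.coeFn_smul (w a) (f a), ih]
      with v h1 h2 h3
    rw [h1, Pi.add_apply, h2, h3, Finset.sum_insert ha, Pi.smul_apply, smul_eq_mul]

/-- The relative entropy is convex. -/
lemma HasEntropyLE.sum (hβ : 0 < β) {ι : Type*} (s : Finset ι) {w : ι → ℝ}
    (hw : ∀ i ∈ s, 0 ≤ w i) (hw1 : ∑ i ∈ s, w i = 1) {f : ι → ConfL1 N d} {E : ι → ℝ≥0∞}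
    (hf : ∀ i ∈ s, HasEntropyLE β (E i) (f i)) :
    HasEntropyLE β (∑ i ∈ s, ENNReal.ofReal (w i) * E i) (∑ i ∈ s, w i • f i) := by
  have hae := coeFn_sum_smul s w f
  have hnn : ∀ᵐ v, ∀ i ∈ s, 0 ≤ f i v := by
    rw [eventually_all_finset]; exact fun i hi => (hf i hi).nonneg
  refine ⟨?_, ?_, ?_⟩
  · filter_upwards [hae, hnn] with v h1 h2
    rw [h1]
    exact Finset.sum_nonneg fun i hi => mul_nonneg (hw i hi) (h2 i hi)
  · rw [integral_congr_ae hae, integral_finsetSum _ fun i _ =>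
      (integrable_confL1 (f i)).const_mul _, ← hw1]
    refine Finset.sum_congr rfl fun i hi => ?_
    rw [integral_const_mul, (hf i hi).mass, mul_one]
  · have hm : ∀ i ∈ s, AEMeasurable (fun v => ENNReal.ofReal (w i) *
        ENNReal.ofReal (klFun (rel β (f i) v))) (maxwellMeasureN N d β) := fun i _ => by
      have : Measurable (rel β (f i) : Config N d → ℝ) :=
        (Lp.stronglyMeasurable (f i)).measurable.div continuous_maxwellN.measurable
      exact ((measurable_klFun.comp this).ennreal_ofReal.const_mul _).aemeasurable
    calc klEntropy (maxwellMeasureN N d β) (rel β (∑ i ∈ s, w i • f i : ConfL1 N d))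
        ≤ ∫⁻ v, ∑ i ∈ s, ENNReal.ofReal (w i) * ENNReal.ofReal (klFun (rel β (f i) v))
            ∂(maxwellMeasureN N d β) := by
          refine lintegral_mono_ae ?_
          rw [ae_maxwellMeasureN hβ]
          filter_upwards [hae, hnn] with v h1 h2
          have h3 : ∀ i ∈ s, 0 ≤ rel β (f i) v := fun i hi =>
            div_nonneg (h2 i hi) (maxwellN_pos hβ v).le
          have h4 : rel β (∑ i ∈ s, w i • f i : ConfL1 N d) v = ∑ i ∈ s, w i • rel β (f i) v := by
            simp only [rel, h1, smul_eq_mul, Finset.sum_div, mul_div_assoc]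
          have h5 := convexOn_klFun.map_sum_le hw hw1 h3
          rw [h4]
          refine (ENNReal.ofReal_le_ofReal h5).trans ?_
          simp only [smul_eq_mul]
          rw [ENNReal.ofReal_sum_of_nonneg fun i hi => mul_nonneg (hw i hi) (klFun_nonneg (h3 i hi))]
          refine Finset.sum_le_sum fun i hi => ?_
          rw [ENNReal.ofReal_mul (hw i hi)]
      _ = ∑ i ∈ s, ENNReal.ofReal (w i) * klEntropy (maxwellMeasureN N d β) (rel β (f i)) := by
          rw [lintegral_finsetSum' _ hm]
          refine Finset.sum_congr rfl fun i _ => ?_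
          rw [lintegral_const_mul' _ _ ENNReal.ofReal_ne_top]; rfl
      _ ≤ _ := Finset.sum_le_sum fun i hi => by gcongr; exact (hf i hi).le

end EntropyBound

/-! ### The generator and one Euler step. -/

section Generator

variable {N d : ℕ} {β : ℝ} {ρ : Measure (Angle d)} [IsProbabilityMeasure ρ]

/-- The thermostat operator `R` on `L¹`. -/
noncomputable def thermostatL1 (N : ℕ) (hβ : 0 < β) (ρ : Measure (Angle d))
    [IsProbabilityMeasure ρ] : ConfL1 N d →L[ℝ] ConfL1 N d :=
  have := isProbabilityMeasure_maxwellMeasure (d := d) hβ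
  ∑ j, (N : ℝ)⁻¹ • markovOp hβ (measurePreserving_thermoMap hβ ρ j)

/-- The collision operator `Q` on `L¹`. -/
noncomputable def collisionL1 (N : ℕ) (hβ : 0 < β) (ρ : Measure (Angle d))
    [IsProbabilityMeasure ρ] : ConfL1 N d →L[ℝ] ConfL1 N d :=
  if N < 2 then 1 else
  ∑ p : {p : Fin N × Fin N // p.1 < p.2}, ((N.choose 2 : ℕ) : ℝ)⁻¹ •
    markovOp hβ (measurePreserving_collideMap ρ p.2.ne)

lemma thermostatL1_ae (hβ : 0 < β) (f : ConfL1 N d) :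
    thermostatL1 N hβ ρ f =ᵐ[volume] thermostatOp β ρ f := by
  have := isProbabilityMeasure_maxwellMeasure (d := d) hβ
  have := isProbabilityMeasure_maxwellMeasureN (N := N) (d := d) hβ
  have h1 : ∀ᵐ v, ∀ j : Fin N, markovOp hβ (measurePreserving_thermoMap hβ ρ j) f v =
      thermostatOpAt β ρ j f v := by
    rw [ae_all_iff]
    intro j
    have h2 := ae_integrable_average (measurePreserving_thermoMap hβ ρ j)
      (integrable_rel hβ (integrable_confL1 f))
    rw [ae_maxwellMeasureN hβ] at h2
    filter_upwards [markovOp_ae hβ (measurePreserving_thermoMap hβ ρ j) f, h2] with v h3 h4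
    rw [h3, thermostatOpAt_eq hβ, average, integral_prod _ h4]
    rfl
  have h2 := coeFn_sum_smul Finset.univ (fun _ : Fin N => (N : ℝ)⁻¹)
    fun j => markovOp hβ (measurePreserving_thermoMap hβ ρ j) f
  have h3 : thermostatL1 N hβ ρ f = ∑ j, (N : ℝ)⁻¹ •
      markovOp hβ (measurePreserving_thermoMap hβ ρ j) f := by
    simp [thermostatL1]
  rw [h3]
  filter_upwards [h1, h2] with v h4 h5
  rw [h5]
  simp only [h4, thermostatOp, Finset.mul_sum]

/-- The subtype carries the proof that the labels differ, which the collision operators need. -/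
lemma sum_pairs (F : Fin N × Fin N → ℝ) :
    ∑ p : {p : Fin N × Fin N // p.1 < p.2}, F p = ∑ p : Fin N × Fin N with p.1 < p.2, F p :=
  (Finset.sum_subtype _ (by simp) F).symm

lemma collisionL1_ae (hβ : 0 < β) (f : ConfL1 N d) :
    collisionL1 N hβ ρ f =ᵐ[volume] collisionOp ρ f := by
  by_cases hN : N < 2
  · refine Eventually.of_forall fun v => ?_
    simp [collisionL1, collisionOp, hN]
  have h1 : ∀ᵐ v, ∀ p : {p : Fin N × Fin N // p.1 < p.2},
      markovOp hβ (measurePreserving_collideMap ρ p.2.ne) f v =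
      ∫ σ, f (collide σ p.1.1 p.1.2 v) ∂ρ := by
    rw [ae_all_iff]
    intro p
    filter_upwards [markovOp_ae hβ (measurePreserving_collideMap ρ p.2.ne) f] with v h3
    rw [h3, integral_collide_eq hβ ρ p.2.ne]
    rfl
  have h2 := coeFn_sum_smul Finset.univ
    (fun _ : {p : Fin N × Fin N // p.1 < p.2} => ((N.choose 2 : ℕ) : ℝ)⁻¹)
    fun p => markovOp hβ (measurePreserving_collideMap ρ p.2.ne) f
  have h3 : collisionL1 N hβ ρ f =
      ∑ p : {p : Fin N × Fin N // p.1 < p.2}, ((N.choose 2 : ℕ) : ℝ)⁻¹ •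
      markovOp hβ (measurePreserving_collideMap ρ p.2.ne) f := by
    simp [collisionL1, hN]
  rw [h3]
  filter_upwards [h1, h2] with v h4 h5
  rw [h5]
  simp only [h4, collisionOp, if_neg hN, Finset.mul_sum]
  exact sum_pairs fun p => ((N.choose 2 : ℕ) : ℝ)⁻¹ * ∫ σ, f (collide σ p.1 p.2 v) ∂ρ

/-- Counting by the larger label gives `0 + 1 + ⋯ + (N - 1)`. It makes the weights of the pairs sum
to `1`. -/
lemma card_pairs : Fintype.card {p : Fin N × Fin N // p.1 < p.2} = N.choose 2 := by
  rw [Fintype.card_subtype, Finset.card_filter, Fintype.sum_prod_type_right]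
  have h (j : Fin N) : ∑ i : Fin N, (if i < j then 1 else 0) = (j : ℕ) := by
    rw [← Finset.card_filter, ← Fin.card_Iio j]
    congr 1
    ext i
    simp
  simp only [h]
  rw [Fin.sum_univ_eq_sum_range (fun i => i), Finset.sum_range_id, Nat.choose_two_right]

/-- Convexity over the labels combined with the frame subadditivity; this is the only source of
entropy decay. -/
lemma HasEntropyLE.thermostatL1 (hd : 1 ≤ d) (hN : 1 ≤ N) (hβ : 0 < β)
    (hρ : SymmetryCondition ρ) {E : ℝ≥0∞} (hE : E ≠ ⊤) {f : ConfL1 N d}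
    (hf : HasEntropyLE β E f) :
    HasEntropyLE β (ENNReal.ofReal (1 - 1 / (N * d)) * E) (thermostatL1 N hβ ρ f) := by
  have := isProbabilityMeasure_maxwellMeasure (d := d) hβ
  have hN0 : (N : ℝ) ≠ 0 := by exact_mod_cast (by omega : N ≠ 0)
  obtain ⟨h, hm, hi, h0, h1, hh, hhE⟩ := hf.exists_version hβ
  have key := sum_lintegral_klEntropy_removeProj_le hd hN hβ hρ hm hi h0 h1
    (ne_top_of_le_ne_top hE hhE)
  have h2 := HasEntropyLE.sum hβ Finset.univ (w := fun _ : Fin N => (N : ℝ)⁻¹)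
    (fun _ _ => by positivity) (by simp [hN0]) fun j _ =>
      hf.markovOp_of_le hβ (measurePreserving_thermoMap hβ ρ j) h0 hh
        (klEntropy_average_thermoMap_le hβ ρ j hm hi h0)
  have h3 : KacThermostat.thermostatL1 N hβ ρ f = ∑ j, (N : ℝ)⁻¹ •
      KacThermostat.markovOp hβ (measurePreserving_thermoMap hβ ρ j) f := by
    simp [KacThermostat.thermostatL1]
  rw [h3]
  refine h2.mono ?_
  rw [← Finset.mul_sum, ENNReal.ofReal_inv_of_pos (by positivity), ENNReal.ofReal_natCast]
  exact key.trans (by gcongr)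

lemma HasEntropyLE.collisionL1 (hβ : 0 < β) {E : ℝ≥0∞} {f : ConfL1 N d}
    (hf : HasEntropyLE β E f) : HasEntropyLE β E (collisionL1 N hβ ρ f) := by
  by_cases hN : N < 2
  · simpa [KacThermostat.collisionL1, hN] using hf
  have h3 : KacThermostat.collisionL1 N hβ ρ f =
      ∑ p : {p : Fin N × Fin N // p.1 < p.2}, ((N.choose 2 : ℕ) : ℝ)⁻¹ •
      KacThermostat.markovOp hβ (measurePreserving_collideMap ρ p.2.ne) f := by
    simp [KacThermostat.collisionL1, hN]
  have hc : ((N.choose 2 : ℕ) : ℝ) ≠ 0 := by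
    exact_mod_cast (Nat.choose_pos (by omega)).ne'
  have hw1 : ∑ _p : {p : Fin N × Fin N // p.1 < p.2}, ((N.choose 2 : ℕ) : ℝ)⁻¹ = 1 := by
    rw [Finset.sum_const, Finset.card_univ, card_pairs, nsmul_eq_mul, mul_inv_cancel₀ hc]
  rw [h3]
  refine (HasEntropyLE.sum hβ Finset.univ (fun _ _ => by positivity) hw1 fun p _ =>
    hf.markovOp hβ (measurePreserving_collideMap ρ p.2.ne)).mono ?_
  rw [← Finset.sum_mul, ← ENNReal.ofReal_sum_of_nonneg fun _ _ => by positivity, hw1,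
    ENNReal.ofReal_one, one_mul]

lemma norm_sum_smul_le {ι V : Type*} [NormedAddCommGroup V] [NormedSpace ℝ V] (s : Finset ι)
    {w : ι → ℝ} (hw : ∀ i ∈ s, 0 ≤ w i) (hw1 : ∑ i ∈ s, w i = 1) {x : ι → V} {r : ℝ}
    (hx : ∀ i ∈ s, ‖x i‖ ≤ r) : ‖∑ i ∈ s, w i • x i‖ ≤ r := by
  calc ‖∑ i ∈ s, w i • x i‖ ≤ ∑ i ∈ s, w i * r := by
        refine norm_sum_le_of_le _ fun i hi => ?_
        rw [norm_smul, Real.norm_of_nonneg (hw i hi)]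
        exact mul_le_mul_of_nonneg_left (hx i hi) (hw i hi)
    _ = r := by rw [← Finset.sum_mul, hw1, one_mul]

lemma norm_thermostatL1_le (hN : 1 ≤ N) (hβ : 0 < β) (f : ConfL1 N d) :
    ‖thermostatL1 N hβ ρ f‖ ≤ ‖f‖ := by
  have := isProbabilityMeasure_maxwellMeasure (d := d) hβ
  have hN0 : (N : ℝ) ≠ 0 := by exact_mod_cast (by omega : N ≠ 0)
  have h3 : thermostatL1 N hβ ρ f = ∑ j, (N : ℝ)⁻¹ •
      markovOp hβ (measurePreserving_thermoMap hβ ρ j) f := by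
    simp [thermostatL1]
  rw [h3]
  exact norm_sum_smul_le _ (fun _ _ => by positivity) (by simp [hN0])
    fun j _ => norm_markovOp_le hβ _ f

lemma norm_collisionL1_le (hβ : 0 < β) (f : ConfL1 N d) : ‖collisionL1 N hβ ρ f‖ ≤ ‖f‖ := by
  by_cases hN : N < 2
  · simp [collisionL1, hN]
  have h3 : collisionL1 N hβ ρ f =
      ∑ p : {p : Fin N × Fin N // p.1 < p.2}, ((N.choose 2 : ℕ) : ℝ)⁻¹ •
      markovOp hβ (measurePreserving_collideMap ρ p.2.ne) f := by
    simp [collisionL1, hN]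
  have hc : ((N.choose 2 : ℕ) : ℝ) ≠ 0 := by
    exact_mod_cast (Nat.choose_pos (by omega)).ne'
  rw [h3]
  refine norm_sum_smul_le _ (fun _ _ => by positivity) ?_ fun p _ => norm_markovOp_le hβ _ f
  rw [Finset.sum_const, Finset.card_univ, card_pairs, nsmul_eq_mul, mul_inv_cancel₀ hc]

/-- The generator on `L¹`. -/
noncomputable def generatorL1 (N : ℕ) (lam μ : ℝ) (hβ : 0 < β) (ρ : Measure (Angle d))
    [IsProbabilityMeasure ρ] : ConfL1 N d →L[ℝ] ConfL1 N d :=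
  (lam * N) • (collisionL1 N hβ ρ - 1) + (μ * N) • (thermostatL1 N hβ ρ - 1)

lemma generatorL1_ae (lam μ : ℝ) (hβ : 0 < β) (f : ConfL1 N d) :
    generatorL1 N lam μ hβ ρ f =ᵐ[volume] generator lam μ β ρ f := by
  have h0 : generatorL1 N lam μ hβ ρ f =
      (lam * N) • (collisionL1 N hβ ρ f - f) + (μ * N) • (thermostatL1 N hβ ρ f - f) := rfl
  rw [h0]
  filter_upwards [collisionL1_ae (ρ := ρ) hβ f, thermostatL1_ae (ρ := ρ) hβ f,
    Lp.coeFn_add ((lam * N) • (collisionL1 N hβ ρ f - f)) ((μ * N) • (thermostatL1 N hβ ρ f - f)),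
    Lp.coeFn_smul (lam * N) (collisionL1 N hβ ρ f - f),
    Lp.coeFn_smul (μ * N) (thermostatL1 N hβ ρ f - f),
    Lp.coeFn_sub (collisionL1 N hβ ρ f) f, Lp.coeFn_sub (thermostatL1 N hβ ρ f) f]
    with v h1 h2 h3 h4 h5 h6 h7
  rw [h3, Pi.add_apply, h4, h5, Pi.smul_apply, Pi.smul_apply, h6, h7, Pi.sub_apply, Pi.sub_apply,
    h1, h2]
  rfl

/-- One step of the Euler scheme is a convex combination. -/
lemma eulerStep_eq (lam μ : ℝ) (hβ : 0 < β) (s : ℝ) (f : ConfL1 N d) :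
    f + s • generatorL1 N lam μ hβ ρ f =
      ∑ i : Fin 3, (![1 - s * (lam * N + μ * N), s * (lam * N), s * (μ * N)] : Fin 3 → ℝ) i •
        (![f, collisionL1 N hβ ρ f, thermostatL1 N hβ ρ f] : Fin 3 → ConfL1 N d) i := by
  have h0 : generatorL1 N lam μ hβ ρ f =
      (lam * N) • (collisionL1 N hβ ρ f - f) + (μ * N) • (thermostatL1 N hβ ρ f - f) := rfl
  rw [h0, Fin.sum_univ_three]
  simp only [Matrix.cons_val]
  module

variable {lam μ s : ℝ}

lemma eulerWeights_nonneg (hlam : 0 ≤ lam) (hμ : 0 ≤ μ) (hs : 0 ≤ s)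
    (hs1 : s * (lam * N + μ * N) ≤ 1) (i : Fin 3) :
    0 ≤ (![1 - s * (lam * N + μ * N), s * (lam * N), s * (μ * N)] : Fin 3 → ℝ) i := by
  fin_cases i
  · simpa using hs1
  · simp only [Fin.mk_one, Matrix.cons_val]; positivity
  · simp only [Fin.reduceFinMk, Matrix.cons_val]; positivity

lemma norm_eulerStep_le (hN : 1 ≤ N) (hlam : 0 ≤ lam) (hμ : 0 ≤ μ) (hβ : 0 < β) (hs : 0 ≤ s)
    (hs1 : s * (lam * N + μ * N) ≤ 1) (f : ConfL1 N d) :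
    ‖f + s • generatorL1 N lam μ hβ ρ f‖ ≤ ‖f‖ := by
  rw [eulerStep_eq]
  refine norm_sum_smul_le _ (fun i _ => eulerWeights_nonneg hlam hμ hs hs1 i) ?_ fun i _ => ?_
  · rw [Fin.sum_univ_three]; simp only [Matrix.cons_val]; ring
  · fin_cases i
    · exact le_rfl
    · exact norm_collisionL1_le hβ f
    · exact norm_thermostatL1_le hN hβ f

/-- The relative entropy decreases along the Euler scheme. -/
lemma HasEntropyLE.eulerStep (hd : 1 ≤ d) (hN : 1 ≤ N) (hlam : 0 ≤ lam) (hμ : 0 ≤ μ)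
    (hβ : 0 < β) (hρ : SymmetryCondition ρ) (hs : 0 ≤ s) (hs1 : s * (lam * N + μ * N) ≤ 1)
    {E : ℝ≥0∞} (hE : E ≠ ⊤) {f : ConfL1 N d} (hf : HasEntropyLE β E f) :
    HasEntropyLE β (ENNReal.ofReal (1 - s * μ / d) * E)
      (f + s • generatorL1 N lam μ hβ ρ f) := by
  have hNr : (1 : ℝ) ≤ N := by exact_mod_cast hN
  have hdr : (1 : ℝ) ≤ d := by exact_mod_cast hd
  have hc0 : (0 : ℝ) ≤ 1 - 1 / (N * d) := by
    rw [sub_nonneg, div_le_one (by positivity)]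
    nlinarith
  have hw := eulerWeights_nonneg (N := N) hlam hμ hs hs1
  rw [eulerStep_eq]
  refine (HasEntropyLE.sum hβ Finset.univ (fun i _ => hw i) ?_
    (E := ![E, E, ENNReal.ofReal (1 - 1 / (N * d)) * E]) fun i _ => ?_).mono (le_of_eq ?_)
  · rw [Fin.sum_univ_three]; simp only [Matrix.cons_val]; ring
  · fin_cases i
    · exact hf
    · exact hf.collisionL1 hβ
    · exact hf.thermostatL1 hd hN hβ hρ hE
  -- The total factor is `1 - s μ N + s μ N (1 - 1 / (N d)) = 1 - s μ / d`, in which `N` and `lam`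
  -- have disappeared.
  · have w0 := hw 0
    have w1 := hw 1
    have w2 := hw 2
    rw [Fin.sum_univ_three]
    simp only [Matrix.cons_val] at w0 w1 w2 ⊢
    rw [← mul_assoc (ENNReal.ofReal (s * (μ * N))) _ E, ← ENNReal.ofReal_mul w2, ← add_mul, ← add_mul, ← ENNReal.ofReal_add w0 w1,
      ← ENNReal.ofReal_add (add_nonneg w0 w1) (mul_nonneg w2 hc0)]
    congr 2
    field_simp
    ring

end Generator

/-! ### Convergence of the explicit Euler scheme. -/

section EulerScheme

variable {V : Type*} [NormedAddCommGroup V] [NormedSpace ℝ V]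

/-- On the interval `f' = L f` is Lipschitz with constant `‖L‖ * (‖L‖ * B)`, so the local error is
of second order in the step. -/
lemma norm_euler_error_le (L : V →L[ℝ] V) {f : ℝ → V} {t B : ℝ}
    (hf : ∀ x ∈ Icc 0 t, HasDerivWithinAt f (L (f x)) (Icc 0 t) x)
    (hB : ∀ x ∈ Icc 0 t, ‖f x‖ ≤ B) {s h : ℝ} (hs : 0 ≤ s) (hh : 0 ≤ h) (hsh : s + h ≤ t) :
    ‖f (s + h) - (f s + h • L (f s))‖ ≤ ‖L‖ * (‖L‖ * B) * h ^ 2 := by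
  have hs' : s ∈ Icc 0 t := ⟨hs, by linarith⟩
  have hB0 : 0 ≤ B := (norm_nonneg _).trans (hB s hs')
  have hlip : ∀ y ∈ Icc 0 t, ‖f y - f s‖ ≤ ‖L‖ * B * ‖y - s‖ := fun y hy =>
    Convex.norm_image_sub_le_of_norm_hasDerivWithin_le hf
      (fun x hx => (L.le_opNorm _).trans (by gcongr; exact hB x hx)) (convex_Icc 0 t) hs' hy
  have hsub : Icc s (s + h) ⊆ Icc 0 t := Icc_subset_Icc hs hsh
  -- The mean value inequality for `f` minus its tangent at `s`.
  have key := Convex.norm_image_sub_le_of_norm_hasDerivWithin_le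
    (f := fun y => f y - y • L (f s)) (f' := fun y => L (f y) - (1 : ℝ) • L (f s))
    (s := Icc s (s + h)) (x := s) (y := s + h) (C := ‖L‖ * (‖L‖ * B) * h)
    (fun x hx => ((hf x (hsub hx)).mono hsub).sub ((hasDerivWithinAt_id x _).smul_const _))
    (fun x hx => ?_) (convex_Icc _ _) ⟨le_rfl, by linarith⟩ ⟨by linarith, le_rfl⟩
  · have e1 : f (s + h) - (f s + h • L (f s)) =
        f (s + h) - (s + h) • L (f s) - (f s - s • L (f s)) := by
      rw [add_smul]; abel
    rw [e1]
    refine key.trans (le_of_eq ?_)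
    rw [add_sub_cancel_left, Real.norm_of_nonneg hh]
    ring
  · rw [one_smul, ← map_sub]
    refine (L.le_opNorm _).trans ?_
    rw [mul_assoc]
    gcongr
    refine (hlip x (hsub hx)).trans ?_
    gcongr
    rw [Real.norm_of_nonneg (by linarith [hx.1])]
    linarith [hx.2]

/-- The explicit Euler scheme of `f' = L f` converges if its steps are contractions. -/
lemma tendsto_euler (L : V →L[ℝ] V) {f : ℝ → V}
    (hf : ∀ x, 0 ≤ x → HasDerivWithinAt f (L (f x)) (Ici 0) x) {r : ℝ}
    (hr : ∀ s, 0 ≤ s → s * r ≤ 1 → ∀ x, ‖x + s • L x‖ ≤ ‖x‖) {t : ℝ} (ht : 0 ≤ t) :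
    Tendsto (fun n : ℕ => (fun x => x + (t / n) • L x)^[n] (f 0)) atTop (𝓝 (f t)) := by
  have hf' : ∀ x ∈ Icc 0 t, HasDerivWithinAt f (L (f x)) (Icc 0 t) x := fun x hx =>
    (hf x hx.1).mono Icc_subset_Ici_self
  obtain ⟨B, hB⟩ := isCompact_Icc.exists_bound_of_continuousOn
    (fun x hx => (hf' x hx).continuousWithinAt)
  -- Since the steps do not increase norms, earlier errors are not amplified and the local errors
  -- merely add. At `k = n` the total is of order `t ^ 2 / n`.
  have hbound : ∀ n : ℕ, 1 ≤ n → t / n * r ≤ 1 → ∀ k : ℕ, k ≤ n →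
      ‖(fun x => x + (t / n) • L x)^[k] (f 0) - f (k * (t / n))‖ ≤
        k * (‖L‖ * (‖L‖ * B) * (t / n) ^ 2) := by
    intro n hn hnr k
    have hn0 : (0 : ℝ) < n := by exact_mod_cast hn
    have hh : 0 ≤ t / n := by positivity
    induction k with
    | zero => intro _; simp
    | succ k ih =>
      intro hk
      have hle : (k : ℝ) * (t / n) + t / n ≤ t := by
        have : ((k : ℝ) + 1) ≤ n := by exact_mod_cast hk
        calc (k : ℝ) * (t / n) + t / n = (k + 1) * (t / n) := by ring
          _ ≤ n * (t / n) := by gcongr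
          _ = t := by field_simp
      have h1 := norm_euler_error_le L hf' hB (s := k * (t / n)) (by positivity) hh hle
      have h2 := ih (by omega)
      rw [Function.iterate_succ_apply']
      set y := (fun x => x + (t / n) • L x)^[k] (f 0)
      have e1 : ((k + 1 : ℕ) : ℝ) * (t / n) = k * (t / n) + t / n := by push_cast; ring
      rw [e1]
      have h3 := hr (t / n) hh hnr (y - f (k * (t / n)))
      have e2 : y + (t / n) • L y - f (k * (t / n) + t / n) =
          (y - f (k * (t / n)) + (t / n) • L (y - f (k * (t / n)))) -
          (f (k * (t / n) + t / n) - (f (k * (t / n)) + (t / n) • L (f (k * (t / n))))) := by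
        rw [map_sub, smul_sub]; abel
      rw [e2]
      refine (norm_sub_le _ _).trans ?_
      push_cast
      linarith
  rw [tendsto_iff_norm_sub_tendsto_zero]
  have hlim : Tendsto (fun n : ℕ => ‖L‖ * (‖L‖ * B) * t ^ 2 / (n : ℝ)) atTop (𝓝 0) :=
    tendsto_const_div_atTop_nhds_zero_nat _
  refine squeeze_zero' (Eventually.of_forall fun _ => norm_nonneg _) ?_ hlim
  obtain ⟨m, hm⟩ := exists_nat_ge (t * r)
  filter_upwards [eventually_ge_atTop m, eventually_ge_atTop 1] with n hn hn1
  have hn0 : (0 : ℝ) < n := by exact_mod_cast hn1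
  have hmn : (m : ℝ) ≤ n := by exact_mod_cast hn
  have h1 := hbound n hn1 (by rw [div_mul_eq_mul_div, div_le_one hn0]; linarith) n le_rfl
  have e1 : (n : ℝ) * (t / n) = t := by field_simp
  rw [e1] at h1
  refine h1.trans (le_of_eq ?_)
  field_simp

end EulerScheme

/-! ### Exponential decay along the master equation. -/

section Decay

variable {N d : ℕ} {β lam μ : ℝ} {ρ : Measure (Angle d)} [IsProbabilityMeasure ρ]

lemma IsSolution.hasDerivWithinAt (hβ : 0 < β) {f : ℝ → ConfL1 N d}
    (hf : IsSolution lam μ β ρ f) {t : ℝ} (ht : 0 ≤ t) :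
    HasDerivWithinAt f (generatorL1 N lam μ hβ ρ (f t)) (Ici 0) t := by
  obtain ⟨g, hg, hge⟩ := hf t ht
  rwa [← Lp.ext (hge.trans (generatorL1_ae lam μ hβ (f t)).symm)]

/-- The entropy bounds are stable under convergence in `L¹`. -/
lemma HasEntropyLE.of_tendsto (hβ : 0 < β) {g : ℕ → ConfL1 N d} {g₀ : ConfL1 N d}
    (hlim : Tendsto g atTop (𝓝 g₀)) {E : ℝ≥0∞} (hg : ∀ᶠ n in atTop, HasEntropyLE β E (g n)) :
    HasEntropyLE β E g₀ := by
  refine ⟨?_, ?_, ?_⟩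
  · rw [Lp.coeFn_nonneg]
    exact ge_of_tendsto hlim (hg.mono fun n hn => (Lp.coeFn_nonneg _).1 hn.nonneg)
  · exact tendsto_nhds_unique ((continuous_integral.tendsto g₀).comp hlim)
      (tendsto_const_nhds.congr' (hg.mono fun n hn => hn.mass.symm))
  · refine klEntropy_le_of_tendsto (fun n => integrable_rel hβ (integrable_confL1 (g n)))
      (integrable_rel hβ (integrable_confL1 g₀)) ?_ tendsto_const_nhds (hg.mono fun n hn => hn.le)
    refine (tendsto_iff_norm_sub_tendsto_zero.1 hlim).congr fun n => ?_
    rw [norm_confL1, ← integral_abs_rel hβ]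
    refine integral_congr_ae ?_
    filter_upwards [rel_congr hβ (Lp.coeFn_sub (g n) g₀)] with v hv
    rw [hv]
    simp only [rel, Pi.sub_apply, sub_div]

lemma HasEntropyLE.eulerIterate (hd : 1 ≤ d) (hN : 1 ≤ N) (hlam : 0 ≤ lam) (hμ : 0 ≤ μ)
    (hβ : 0 < β) (hρ : SymmetryCondition ρ) {s : ℝ} (hs : 0 ≤ s)
    (hs1 : s * (lam * N + μ * N) ≤ 1) (hs2 : 0 ≤ 1 - s * μ / d)
    {E : ℝ≥0∞} (hE : E ≠ ⊤) {f : ConfL1 N d} (hf : HasEntropyLE β E f) (n : ℕ) :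
    HasEntropyLE β (ENNReal.ofReal ((1 - s * μ / d) ^ n) * E)
      ((fun x => x + s • generatorL1 N lam μ hβ ρ x)^[n] f) := by
  induction n with
  | zero => simpa using hf
  | succ n ih =>
    rw [Function.iterate_succ_apply', pow_succ', ENNReal.ofReal_mul hs2, mul_assoc]
    exact ih.eulerStep hd hN hlam hμ hβ hρ hs hs1 (ENNReal.mul_ne_top ENNReal.ofReal_ne_top hE)

/-- Exponential decay of the relative entropy along the master equation. -/
theorem IsSolution.hasEntropyLE (hd : 1 ≤ d) (hN : 1 ≤ N) (hlam : 0 ≤ lam) (hμ : 0 ≤ μ)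
    (hβ : 0 < β) (hρ : SymmetryCondition ρ) {f : ℝ → ConfL1 N d} (hf : IsSolution lam μ β ρ f)
    {E : ℝ≥0∞} (hE : E ≠ ⊤) (h0 : HasEntropyLE β E (f 0)) {t : ℝ} (ht : 0 ≤ t) :
    HasEntropyLE β (ENNReal.ofReal (Real.exp (-(1 / (d : ℝ)) * μ * t)) * E) (f t) := by
  have hlim := tendsto_euler (generatorL1 N lam μ hβ ρ) (fun x hx => hf.hasDerivWithinAt hβ hx)
    (fun s hs hs1 x => norm_eulerStep_le hN hlam hμ hβ hs hs1 x) ht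
  refine HasEntropyLE.of_tendsto hβ hlim ?_
  -- Large `n` makes the Euler weights nonnegative (`m`) and the factor `1 - t μ / (d n)`
  -- nonnegative (`m'`), which `(1 - x / n) ^ n ≤ exp (-x)` also needs.
  obtain ⟨m, hm⟩ := exists_nat_ge (t * (lam * N + μ * N))
  obtain ⟨m', hm'⟩ := exists_nat_ge (t * μ / d)
  filter_upwards [eventually_ge_atTop m, eventually_ge_atTop m', eventually_ge_atTop 1]
    with n hn hn' hn1
  have hn0 : (0 : ℝ) < n := by exact_mod_cast hn1
  have hmn : (m : ℝ) ≤ n := by exact_mod_cast hn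
  have hmn' : (m' : ℝ) ≤ n := by exact_mod_cast hn'
  have e1 : t / n * μ / d = t * μ / d / n := by ring
  refine (h0.eulerIterate hd hN hlam hμ hβ hρ (s := t / n) (by positivity)
    (by rw [div_mul_eq_mul_div, div_le_one hn0]; linarith)
    (by rw [e1, sub_nonneg, div_le_one hn0]; linarith) hE n).mono ?_
  gcongr
  rw [e1]
  refine (Real.one_sub_div_pow_le_exp_neg (by linarith)).trans (le_of_eq ?_)
  congr 1
  ring

end Decay

/-! ### Weak derivatives control translations in `L²`. -/

section Translation

variable {E : Type*} [NormedAddCommGroup E] [NormedSpace ℝ E] [FiniteDimensional ℝ E]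
  [MeasurableSpace E] [BorelSpace E] {μ : Measure E} [μ.IsAddHaarMeasure]

lemma abs_integral_mul_le {u v : E → ℝ} (hu : MemLp u 2 μ) (hv : MemLp v 2 μ) :
    |∫ x, u x * v x ∂μ| ≤ (eLpNorm u 2 μ).toReal * (eLpNorm v 2 μ).toReal := by
  have h1 : inner ℝ (hv.toLp v) (hu.toLp u) = ∫ x, u x * v x ∂μ := by
    rw [L2.inner_def]
    refine integral_congr_ae ?_
    filter_upwards [hu.coeFn_toLp, hv.coeFn_toLp] with x h1 h2
    rw [h1, h2]; rfl
  have h2 := norm_inner_le_norm (𝕜 := ℝ) (hv.toLp v) (hu.toLp u)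
  rwa [h1, Lp.norm_toLp, Lp.norm_toLp, Real.norm_eq_abs, mul_comm] at h2

/-- The integral is a convolution of `u` with the reflected test function along a line, so the
derivative falls on the smooth factor. -/
lemma hasDerivAt_integral_mul_comp_sub {u φ : E → ℝ} (hu : LocallyIntegrable u μ)
    (hφ : ContDiff ℝ ∞ φ) (hc : HasCompactSupport φ) (y : E) (s : ℝ) :
    HasDerivAt (fun s : ℝ => ∫ x, u x * φ (x - s • y) ∂μ)
      (-∫ x, u x * fderiv ℝ φ (x - s • y) y ∂μ) s := by
  set ψ : E → ℝ := fun z => φ (-z) with hψ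
  have hψc : HasCompactSupport ψ := hc.comp_homeomorph (Homeomorph.neg E)
  have hψs : ContDiff ℝ 1 ψ := (hφ.comp contDiff_neg).of_le (by exact_mod_cast le_top)
  have h1 := hψc.hasFDerivAt_convolution_right (ContinuousLinearMap.mul ℝ ℝ) hu hψs (s • y)
  have h2 : HasDerivAt (fun s : ℝ => s • y) y s := by
    simpa using (hasDerivAt_id s).smul_const y
  have h3 := h1.comp_hasDerivAt s h2
  rw [convolution_precompR_apply _ hu (hψc.fderiv (𝕜 := ℝ))
    (hψs.continuous_fderiv one_ne_zero)] at h3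
  have e1 : (fun s : ℝ => ∫ x, u x * φ (x - s • y) ∂μ) =
      convolution u ψ (ContinuousLinearMap.mul ℝ ℝ) μ ∘ fun s => s • y := by
    funext s
    simp only [Function.comp_apply, convolution, ContinuousLinearMap.mul_apply', hψ, neg_sub]
  have e2 : -∫ x, u x * fderiv ℝ φ (x - s • y) y ∂μ =
      convolution u (fun a => (fderiv ℝ ψ a) y) (ContinuousLinearMap.mul ℝ ℝ) μ (s • y) := by
    rw [← integral_neg]
    simp only [convolution, ContinuousLinearMap.mul_apply']
    refine integral_congr_ae (Eventually.of_forall fun x => ?_)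
    have h4 : HasFDerivAt ψ ((fderiv ℝ φ (-(s • y - x))).comp (-ContinuousLinearMap.id ℝ E))
        (s • y - x) :=
      HasFDerivAt.comp _ (hφ.differentiable (by simp) _).hasFDerivAt (hasFDerivAt_id _).neg
    simp only [h4.fderiv, neg_sub]
    simp
  rw [e1, e2]
  exact h3

/-- Duality estimate for the difference of `u` and its translate, where `g` is the weak derivative
of `u` in the direction `y`. -/
lemma abs_integral_translate_sub_mul_le {u g : E → ℝ} (hu : MemLp u 2 μ) (hg : MemLp g 2 μ) {y : E}
    (hw : ∀ φ : E → ℝ, ContDiff ℝ ∞ φ → HasCompactSupport φ →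
      ∫ x, u x * fderiv ℝ φ x y ∂μ = -∫ x, g x * φ x ∂μ)
    {φ : E → ℝ} (hφ : ContDiff ℝ ∞ φ) (hc : HasCompactSupport φ) :
    |∫ x, (u (x + y) - u x) * φ x ∂μ| ≤ (eLpNorm g 2 μ).toReal * (eLpNorm φ 2 μ).toReal := by
  have hφL : MemLp φ 2 μ := hφ.continuous.memLp_of_hasCompactSupport hc
  have htr (a : E) : MeasurePreserving (fun x => x - a) μ μ := measurePreserving_sub_right μ a
  have hF (s : ℝ) : HasDerivAt (fun s : ℝ => ∫ x, u x * φ (x - s • y) ∂μ)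
      (∫ x, g x * φ (x - s • y) ∂μ) s := by
    have h1 := hasDerivAt_integral_mul_comp_sub (hu.locallyIntegrable (by norm_num)) hφ hc y s
    have h2 := hw (fun x => φ (x - s • y)) (hφ.comp (contDiff_id.sub contDiff_const))
      (hc.comp_homeomorph (Homeomorph.subRight (s • y)))
    simp only [fderiv_comp_sub] at h2
    rwa [h2, neg_neg] at h1
  have h3 : ∀ s ∈ Ico (0 : ℝ) 1, ‖∫ x, g x * φ (x - s • y) ∂μ‖ ≤
      (eLpNorm g 2 μ).toReal * (eLpNorm φ 2 μ).toReal := by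
    intro s _
    rw [Real.norm_eq_abs]
    refine (abs_integral_mul_le hg (hφL.comp_measurePreserving (htr (s • y)))).trans (le_of_eq ?_)
    rw [eLpNorm_comp_measurePreserving hφL.1 (htr _)]
  -- The translation by `y` is reached along `s • y`, `0 ≤ s ≤ 1`; the weak derivative bounds the
  -- speed uniformly in `s`.
  have h4 := norm_image_sub_le_of_norm_deriv_le_segment_01'
    (fun s _ => (hF s).hasDerivWithinAt) h3
  refine le_trans (le_of_eq ?_) h4
  have e1 : ∫ x, u x * φ (x - y) ∂μ = ∫ x, u (x + y) * φ x ∂μ := by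
    rw [← integral_add_right_eq_self _ y]
    simp only [add_sub_cancel_right]
  have i1 : Integrable (fun x => u (x + y) * φ x) μ :=
    (hu.comp_measurePreserving (measurePreserving_add_right μ y)).integrable_mul hφL
  have i2 : Integrable (fun x => u x * φ x) μ := hu.integrable_mul hφL
  simp only [one_smul, zero_smul, sub_zero]
  rw [e1, ← integral_sub i1 i2, Real.norm_eq_abs]
  simp only [sub_mul]

/-- By density of test functions the bound extends to all of `L²`; it is then evaluated at `w`
itself. -/
lemma eLpNorm_le_of_forall_test {w : E → ℝ} (hw : MemLp w 2 μ) {C : ℝ} (hC : 0 ≤ C)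
    (h : ∀ φ : E → ℝ, ContDiff ℝ ∞ φ → HasCompactSupport φ →
      |∫ x, w x * φ x ∂μ| ≤ C * (eLpNorm φ 2 μ).toReal) :
    (eLpNorm w 2 μ).toReal ≤ C := by
  have key : ∀ v : Lp ℝ 2 μ, |inner ℝ v (hw.toLp w)| ≤ C * ‖v‖ := by
    refine (Lp.dense_hasCompactSupport_contDiff (by norm_num)).induction ?_
      (isClosed_le (by fun_prop) (by fun_prop))
    rintro v ⟨φ, hv, hc, hs⟩
    have h1 : inner ℝ v (hw.toLp w) = ∫ x, w x * φ x ∂μ := by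
      rw [L2.inner_def]
      refine integral_congr_ae ?_
      filter_upwards [hw.coeFn_toLp, hv] with x h1 h2
      rw [h1, h2]; rfl
    rw [h1, Lp.norm_def, eLpNorm_congr_ae hv]
    exact h φ hs hc
  have h2 := key (hw.toLp w)
  rw [real_inner_self_eq_norm_sq, abs_of_nonneg (sq_nonneg _), Lp.norm_toLp] at h2
  rcases eq_or_lt_of_le (ENNReal.toReal_nonneg : 0 ≤ (eLpNorm w 2 μ).toReal) with h0 | h0
  · rwa [← h0]
  · nlinarith

/-- The translates of a function with a weak derivative. -/
lemma eLpNorm_translate_sub_le {u g : E → ℝ} (hu : MemLp u 2 μ) (hg : MemLp g 2 μ) {y : E}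
    (hw : ∀ φ : E → ℝ, ContDiff ℝ ∞ φ → HasCompactSupport φ →
      ∫ x, u x * fderiv ℝ φ x y ∂μ = -∫ x, g x * φ x ∂μ) :
    eLpNorm (fun x => u (x + y) - u x) 2 μ ≤ eLpNorm g 2 μ := by
  have h1 : MemLp (fun x => u (x + y) - u x) 2 μ :=
    (hu.comp_measurePreserving (measurePreserving_add_right μ y)).sub hu
  rw [← ENNReal.toReal_le_toReal h1.2.ne hg.2.ne]
  exact eLpNorm_le_of_forall_test h1 ENNReal.toReal_nonneg
    fun φ hφ hc => abs_integral_translate_sub_mul_le hu hg hw hφ hc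

end Translation

/-! ### Mass of a Sobolev function on its high level sets. -/

section LogIntegrability

variable {E : Type*} [NormedAddCommGroup E] [NormedSpace ℝ E] [FiniteDimensional ℝ E]
  [MeasurableSpace E] [BorelSpace E] {μ : Measure E} [μ.IsAddHaarMeasure]

lemma enorm_sq_le_two_mul (a b : ℝ) : ‖a‖ₑ ^ 2 ≤ 2 * ‖b - a‖ₑ ^ 2 + 2 * ‖b‖ₑ ^ 2 := by
  have h (x : ℝ) : ‖x‖ₑ ^ 2 = ENNReal.ofReal (x ^ 2) := by
    rw [Real.enorm_eq_ofReal_abs, ← ENNReal.ofReal_pow (abs_nonneg _), sq_abs]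
  have h2 : (2 : ℝ≥0∞) = ENNReal.ofReal 2 := by simp
  rw [h, h, h, h2, ← ENNReal.ofReal_mul (by norm_num), ← ENNReal.ofReal_mul (by norm_num),
    ← ENNReal.ofReal_add (by positivity) (by positivity)]
  exact ENNReal.ofReal_le_ofReal (by nlinarith [sq_nonneg (a - 2 * b)])

/-- A function whose translates depend on the shift in a Lipschitz way in `L²` has little mass
where it is large. -/
lemma setLIntegral_large_le {u : E → ℝ} (hum : Measurable u) {C : ℝ≥0∞}
    (hC : ∀ y, ∫⁻ x, ‖u (x + y) - u x‖ₑ ^ 2 ∂μ ≤ C * ‖y‖ₑ ^ 2) {r : ℝ} (hr : 0 < r) :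
    ∫⁻ x in {x | 4 * ∫⁻ z, ‖u z‖ₑ ^ 2 ∂μ ≤ ‖u x‖ₑ ^ 2 * μ (Metric.ball 0 r)}, ‖u x‖ₑ ^ 2 ∂μ ≤
      4 * C * ENNReal.ofReal r ^ 2 := by
  set b := μ (Metric.ball (0 : E) r)
  set I := ∫⁻ z, ‖u z‖ₑ ^ 2 ∂μ
  have hb0 : b ≠ 0 := (Metric.measure_ball_pos μ 0 hr).ne'
  have hb1 : b ≠ ⊤ := measure_ball_lt_top.ne
  have hf : Measurable fun x => ‖u x‖ₑ ^ 2 := hum.enorm.pow_const 2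
  have hD : Measurable fun p : E × E => ‖u (p.1 + p.2) - u p.1‖ₑ ^ 2 :=
    ((hum.comp (measurable_fst.add measurable_snd)).sub (hum.comp measurable_fst)).enorm.pow_const 2
  -- The value at `x` is compared with the values on a ball around it.
  have h1 (x : E) : ‖u x‖ₑ ^ 2 * b ≤
      2 * ∫⁻ y in Metric.ball 0 r, ‖u (x + y) - u x‖ₑ ^ 2 ∂μ + 2 * I := by
    have hDx : Measurable fun y => ‖u (x + y) - u x‖ₑ ^ 2 :=
      ((hum.comp (measurable_const_add x)).sub measurable_const).enorm.pow_const 2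
    calc ‖u x‖ₑ ^ 2 * b = ∫⁻ _ in Metric.ball (0 : E) r, ‖u x‖ₑ ^ 2 ∂μ := by
          rw [setLIntegral_const]
      _ ≤ ∫⁻ y in Metric.ball 0 r, (2 * ‖u (x + y) - u x‖ₑ ^ 2 + 2 * ‖u (x + y)‖ₑ ^ 2) ∂μ :=
          lintegral_mono fun y => enorm_sq_le_two_mul _ _
      _ = 2 * ∫⁻ y in Metric.ball 0 r, ‖u (x + y) - u x‖ₑ ^ 2 ∂μ +
            2 * ∫⁻ y in Metric.ball 0 r, ‖u (x + y)‖ₑ ^ 2 ∂μ := by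
          rw [lintegral_add_left (hDx.const_mul 2), lintegral_const_mul' _ _ (by norm_num),
            lintegral_const_mul' _ _ (by norm_num)]
      _ ≤ _ := by
          gcongr
          refine (setLIntegral_le_lintegral _ _).trans (le_of_eq ?_)
          exact lintegral_add_left_eq_self (fun z => ‖u z‖ₑ ^ 2) x
  -- On the large set the contribution of the total mass is at most half of the left side and is
  -- absorbed; only the translation differences remain. Fubini and the Lipschitz hypothesis bound
  -- them after integration in `x`.
  have h2 (x : E) (hx : 4 * I ≤ ‖u x‖ₑ ^ 2 * b) : ‖u x‖ₑ ^ 2 * b ≤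
      4 * ∫⁻ y in Metric.ball 0 r, ‖u (x + y) - u x‖ₑ ^ 2 ∂μ := by
    have hfin : ‖u x‖ₑ ^ 2 * b ≠ ⊤ := ENNReal.mul_ne_top (by simp) hb1
    refine (ENNReal.add_le_add_iff_right hfin).1 ?_
    calc ‖u x‖ₑ ^ 2 * b + ‖u x‖ₑ ^ 2 * b = 2 * (‖u x‖ₑ ^ 2 * b) := (two_mul _).symm
      _ ≤ 2 * (2 * ∫⁻ y in Metric.ball 0 r, ‖u (x + y) - u x‖ₑ ^ 2 ∂μ + 2 * I) := by
          gcongr; exact h1 x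
      _ = 4 * ∫⁻ y in Metric.ball 0 r, ‖u (x + y) - u x‖ₑ ^ 2 ∂μ + 4 * I := by ring
      _ ≤ _ := by gcongr
  have hA : MeasurableSet {x | 4 * I ≤ ‖u x‖ₑ ^ 2 * b} :=
    measurableSet_le measurable_const (hf.mul_const b)
  have h3 : (∫⁻ x in {x | 4 * I ≤ ‖u x‖ₑ ^ 2 * b}, ‖u x‖ₑ ^ 2 ∂μ) * b ≤
      (4 * C * ENNReal.ofReal r ^ 2) * b := by
    calc (∫⁻ x in {x | 4 * I ≤ ‖u x‖ₑ ^ 2 * b}, ‖u x‖ₑ ^ 2 ∂μ) * b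
        = ∫⁻ x in {x | 4 * I ≤ ‖u x‖ₑ ^ 2 * b}, ‖u x‖ₑ ^ 2 * b ∂μ := by
          rw [lintegral_mul_const' _ _ hb1]
      _ ≤ ∫⁻ x in {x | 4 * I ≤ ‖u x‖ₑ ^ 2 * b},
            4 * ∫⁻ y in Metric.ball 0 r, ‖u (x + y) - u x‖ₑ ^ 2 ∂μ ∂μ :=
          setLIntegral_mono' hA h2
      _ ≤ ∫⁻ x, 4 * ∫⁻ y in Metric.ball 0 r, ‖u (x + y) - u x‖ₑ ^ 2 ∂μ ∂μ :=
          setLIntegral_le_lintegral _ _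
      _ = 4 * ∫⁻ y in Metric.ball 0 r, ∫⁻ x, ‖u (x + y) - u x‖ₑ ^ 2 ∂μ ∂μ := by
          rw [lintegral_const_mul' _ _ (by norm_num),
            lintegral_lintegral_swap hD.aemeasurable]
      _ ≤ 4 * ∫⁻ _ in Metric.ball (0 : E) r, C * ENNReal.ofReal r ^ 2 ∂μ := by
          gcongr 4 * ?_
          refine setLIntegral_mono' measurableSet_ball fun y hy => (hC y).trans ?_
          gcongr
          rw [← ofReal_norm]
          exact ENNReal.ofReal_le_ofReal (mem_ball_zero_iff.1 hy).le
      _ = _ := by rw [setLIntegral_const]; ring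
  exact (ENNReal.mul_le_mul_iff_left hb0 hb1).1 h3

end LogIntegrability

/-! ### Logarithmic integrability from geometric level sets. -/

section LogBound

variable {X : Type*} [MeasurableSpace X] {μ : Measure X}

/-- Above `M` the logarithm to base `a` of `z / M` is at most the number of levels `M * a ^ k` below
or at `z`; below `M` it suffices to use `|log M|`. -/
lemma ofReal_mul_log_le {a M z : ℝ} (ha : 1 < a) (hM : 0 < M) (hz : 0 ≤ z) :
    ENNReal.ofReal (z * Real.log z) ≤ ENNReal.ofReal |Real.log M| * ENNReal.ofReal z +
      ENNReal.ofReal (Real.log a) *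
        ∑' k : ℕ, {y : ℝ | M * a ^ k ≤ y}.indicator ENNReal.ofReal z := by
  have hla : 0 < Real.log a := Real.log_pos ha
  rw [← ENNReal.ofReal_mul (abs_nonneg _)]
  rcases le_or_gt z M with hzM | hzM
  · refine le_add_right (ENNReal.ofReal_le_ofReal ?_)
    rcases eq_or_lt_of_le hz with h0 | h0
    · simp [← h0]
    · rw [mul_comm]
      gcongr
      exact (Real.log_le_log h0 hzM).trans (le_abs_self _)
  · have hz0 : 0 < z := hM.trans hzM
    set w := Real.log (z / M) / Real.log a with hw
    have hw0 : 0 ≤ w := div_nonneg (Real.log_nonneg ((one_le_div hM).2 hzM.le)) hla.le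
    have h1 : ∑ k ∈ Finset.range (⌊w⌋₊ + 1), ENNReal.ofReal z ≤
        ∑' k : ℕ, {y : ℝ | M * a ^ k ≤ y}.indicator ENNReal.ofReal z := by
      refine le_trans (Finset.sum_le_sum fun k hk => ?_)
        (ENNReal.sum_le_tsum (Finset.range (⌊w⌋₊ + 1)))
      rw [indicator_of_mem]
      have hk' : (k : ℝ) ≤ w := (Nat.le_floor_iff hw0).1 (by simpa [Nat.lt_succ_iff] using hk)
      rw [hw, le_div_iff₀ hla, ← Real.log_pow, Real.log_le_log_iff (by positivity) (by positivity),
        le_div_iff₀ hM] at hk'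
      rw [mem_ofPred_eq, mul_comm]
      exact hk'
    refine le_trans ?_ (add_le_add_right (mul_le_mul_right h1 _) _)
    rw [Finset.sum_const, Finset.card_range, nsmul_eq_mul, ← ENNReal.ofReal_natCast,
      ← ENNReal.ofReal_mul (by positivity), ← ENNReal.ofReal_mul hla.le,
      ← ENNReal.ofReal_add (by positivity) (by positivity)]
    refine ENNReal.ofReal_le_ofReal ?_
    have h2 : Real.log z = Real.log M + w * Real.log a := by
      rw [hw, div_mul_cancel₀ _ hla.ne', Real.log_div hz0.ne' hM.ne']; ring
    have h3 : w ≤ ((⌊w⌋₊ + 1 : ℕ) : ℝ) := by push_cast; exact (Nat.lt_floor_add_one w).le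
    rw [h2, mul_add]
    have h4 := mul_le_mul_of_nonneg_left (le_abs_self (Real.log M)) hz
    have h5 := mul_le_mul_of_nonneg_left h3 (mul_nonneg hz hla.le)
    nlinarith

lemma lintegral_mul_log_ne_top {f : X → ℝ} (hfm : Measurable f) (hf0 : ∀ x, 0 ≤ f x)
    (hf : ∫⁻ x, ENNReal.ofReal (f x) ∂μ ≠ ⊤) {a M : ℝ} (ha : 1 < a) (hM : 0 < M)
    {K : ℕ → ℝ≥0∞} (hK : ∑' k, K k ≠ ⊤)
    (h : ∀ k : ℕ, ∫⁻ x in {x | M * a ^ k ≤ f x}, ENNReal.ofReal (f x) ∂μ ≤ K k) :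
    ∫⁻ x, ENNReal.ofReal (f x * Real.log (f x)) ∂μ ≠ ⊤ := by
  have hS (k : ℕ) : MeasurableSet {y : ℝ | M * a ^ k ≤ y} := measurableSet_Ici
  have hm (k : ℕ) : Measurable fun x => {y : ℝ | M * a ^ k ≤ y}.indicator ENNReal.ofReal (f x) :=
    (ENNReal.measurable_ofReal.indicator (hS k)).comp hfm
  have h1 : ∫⁻ x, ENNReal.ofReal (f x * Real.log (f x)) ∂μ ≤
      ENNReal.ofReal |Real.log M| * ∫⁻ x, ENNReal.ofReal (f x) ∂μ +
        ENNReal.ofReal (Real.log a) * ∑' k, K k := by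
    refine (lintegral_mono fun x => ofReal_mul_log_le ha hM (hf0 x)).trans ?_
    rw [lintegral_add_left (hfm.ennreal_ofReal.const_mul _),
      lintegral_const_mul' _ _ ENNReal.ofReal_ne_top,
      lintegral_const_mul' _ _ ENNReal.ofReal_ne_top, lintegral_tsum fun k => (hm k).aemeasurable]
    gcongr with k
    refine le_trans (le_of_eq ?_) (h k)
    have hS' : MeasurableSet {x | M * a ^ k ≤ f x} := hfm (hS k)
    rw [← lintegral_indicator hS']
    rfl
  refine ne_top_of_le_ne_top ?_ h1
  exact ENNReal.add_ne_top.2 ⟨ENNReal.mul_ne_top ENNReal.ofReal_ne_top hf,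
    ENNReal.mul_ne_top ENNReal.ofReal_ne_top hK⟩

end LogBound

/-! ### Finiteness of the positive part of `u² log u²`. -/

section SqLog

variable {E : Type*} [NormedAddCommGroup E] [NormedSpace ℝ E] [FiniteDimensional ℝ E]
  [MeasurableSpace E] [BorelSpace E] {μ : Measure E} [μ.IsAddHaarMeasure]

/-- With radii `2 ^ (-k)` the level `4 / μ (ball)` grows like `(2 ^ n) ^ k`, while the mass above it
decays like `4 ^ (-k)`, which is summable. This takes the place of a Sobolev or logarithmic Sobolev
inequality. Nontriviality of the space makes the ratio `2 ^ n` exceed `1`. -/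
lemma lintegral_sq_mul_log_sq_ne_top [Nontrivial E] {u : E → ℝ} (hum : Measurable u)
    (hu : ∫⁻ x, ENNReal.ofReal (u x ^ 2) ∂μ = 1) {C : ℝ≥0∞} (hC : C ≠ ⊤)
    (h : ∀ y, ∫⁻ x, ‖u (x + y) - u x‖ₑ ^ 2 ∂μ ≤ C * ‖y‖ₑ ^ 2) :
    ∫⁻ x, ENNReal.ofReal (u x ^ 2 * Real.log (u x ^ 2)) ∂μ ≠ ⊤ := by
  have hsq (x : ℝ) : ‖x‖ₑ ^ 2 = ENNReal.ofReal (x ^ 2) := by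
    rw [Real.enorm_eq_ofReal_abs, ← ENNReal.ofReal_pow (abs_nonneg _), sq_abs]
  set n := Module.finrank ℝ E
  have hn : 0 < n := Module.finrank_pos
  set b := μ.real (Metric.ball (0 : E) 1) with hb
  have hb0 : 0 < b := ENNReal.toReal_pos (Metric.measure_ball_pos μ 0 one_pos).ne'
    measure_ball_lt_top.ne
  have hball (k : ℕ) : μ (Metric.ball (0 : E) ((1 / 2) ^ k)) =
      ENNReal.ofReal (b / (2 ^ n) ^ k) := by
    rw [Measure.addHaar_ball μ 0 (by positivity), ← ofReal_measureReal measure_ball_lt_top.ne,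
      ← ENNReal.ofReal_mul (by positivity), ← hb]
    congr 1
    rw [← pow_mul, ← pow_mul, one_div, inv_pow, mul_comm n k]
    field_simp
    rfl
  refine lintegral_mul_log_ne_top (hum.pow_const 2) (fun x => sq_nonneg _) (by rw [hu]; simp)
    (a := 2 ^ n) (one_lt_pow₀ (by norm_num) hn.ne') (M := 4 / b) (by positivity)
    (K := fun k => 4 * C * ENNReal.ofReal (1 / 4) ^ k) ?_ fun k => ?_
  · rw [ENNReal.tsum_mul_left, ENNReal.tsum_geometric]
    refine ENNReal.mul_ne_top (ENNReal.mul_ne_top (by norm_num) hC) (ENNReal.inv_ne_top.2 ?_)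
    rw [← ENNReal.ofReal_one, ← ENNReal.ofReal_sub _ (by norm_num)]
    exact (ENNReal.ofReal_pos.2 (by norm_num)).ne'
  · have key := setLIntegral_large_le hum h (r := (1 / 2) ^ k) (by positivity)
    simp only [hsq, hu, mul_one, hball] at key
    have e1 : ENNReal.ofReal ((1 / 2) ^ k) ^ 2 = ENNReal.ofReal (1 / 4) ^ k := by
      rw [← ENNReal.ofReal_pow (by positivity), ← ENNReal.ofReal_pow (by positivity), ← pow_mul,
        mul_comm k 2, pow_mul]
      norm_num
    rw [e1] at key
    refine le_trans (lintegral_mono_set fun x hx => ?_) key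
    rw [mem_ofPred_eq] at hx ⊢
    rw [← ENNReal.ofReal_mul (sq_nonneg _)]
    have h4 : (4 : ℝ≥0∞) = ENNReal.ofReal 4 := by simp
    rw [h4]
    refine ENNReal.ofReal_le_ofReal ?_
    rw [mul_div_assoc', le_div_iff₀ (by positivity)]
    calc 4 * (2 ^ n) ^ k = (4 / b * (2 ^ n) ^ k) * b := by field_simp
      _ ≤ _ := by gcongr

end SqLog

/-! ### From weak partial derivatives to translations. -/

section Sobolev

variable {N d : ℕ}

lemma sum_smul_coordVector (y : Config N d) :
    ∑ p : Fin N × Fin d, y p.1 p.2 • coordVector p.1 p.2 = y := by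
  ext i k
  rw [Finset.sum_apply, Fintype.sum_prod_type, WithLp.ofLp_sum, Finset.sum_apply]
  simp only [WithLp.ofLp_sum, Pi.smul_apply, coordVector]
  rw [Finset.sum_eq_single i]
  · simp [Finset.sum_apply, Pi.single_apply]
  · intro j _ hj
    simp [Pi.single_eq_of_ne hj.symm]
  · simp

/-- Functions in `H¹` depend on translations in a Lipschitz way. -/
lemma MemH1.exists_translate_le {u : Config N d → ℝ} (hu : MemH1 u) :
    ∃ C : ℝ≥0∞, C ≠ ⊤ ∧ ∀ y, ∫⁻ x, ‖u (x + y) - u x‖ₑ ^ 2 ≤ C * ‖y‖ₑ ^ 2 := by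
  obtain ⟨hu2, hg⟩ := hu
  choose g hgL hgw using hg
  refine ⟨(∑ p : Fin N × Fin d, eLpNorm (g p.1 p.2) 2 volume) ^ 2,
    ENNReal.pow_ne_top (ENNReal.sum_ne_top.2 fun p _ => (hgL p.1 p.2).2.ne), fun y => ?_⟩
  -- By linearity this combination of the partial derivatives is the weak derivative in the
  -- direction `y`.
  have hGL : MemLp (fun x => ∑ p : Fin N × Fin d, y p.1 p.2 * g p.1 p.2 x) 2 volume :=
    memLp_finsetSum _ fun p _ => (hgL p.1 p.2).const_mul _
  have h1 := eLpNorm_translate_sub_le hu2 hGL (y := y) fun φ hφ hc => by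
    have hφL : MemLp φ 2 (volume : Measure (Config N d)) :=
      hφ.continuous.memLp_of_hasCompactSupport hc
    have hdL (w : Config N d) : MemLp (fun x => fderiv ℝ φ x w) 2 volume := by
      refine Continuous.memLp_of_hasCompactSupport ?_ (hc.fderiv_apply (𝕜 := ℝ) w)
      exact (hφ.continuous_fderiv (by simp)).clm_apply continuous_const
    have e1 (x : Config N d) : u x * fderiv ℝ φ x y =
        ∑ p : Fin N × Fin d, y p.1 p.2 * (u x * fderiv ℝ φ x (coordVector p.1 p.2)) := by
      conv_lhs => rw [← sum_smul_coordVector y, map_sum, Finset.mul_sum]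
      refine Finset.sum_congr rfl fun p _ => ?_
      rw [map_smul, smul_eq_mul]; ring
    have e2 (x : Config N d) : (∑ p : Fin N × Fin d, y p.1 p.2 * g p.1 p.2 x) * φ x =
        ∑ p : Fin N × Fin d, y p.1 p.2 * (g p.1 p.2 x * φ x) := by
      rw [Finset.sum_mul]
      exact Finset.sum_congr rfl fun p _ => by ring
    have i1 (p : Fin N × Fin d) : Integrable fun x =>
        y p.1 p.2 * (u x * fderiv ℝ φ x (coordVector p.1 p.2)) :=
      (hu2.integrable_mul (hdL _)).const_mul _
    have i2 (p : Fin N × Fin d) : Integrable fun x => y p.1 p.2 * (g p.1 p.2 x * φ x) :=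
      ((hgL p.1 p.2).integrable_mul hφL).const_mul _
    simp only [e1, e2]
    rw [integral_finsetSum _ fun p _ => i1 p, integral_finsetSum _ fun p _ => i2 p,
      ← Finset.sum_neg_distrib]
    refine Finset.sum_congr rfl fun p _ => ?_
    rw [integral_const_mul, integral_const_mul, hgw p.1 p.2 φ hφ hc, mul_neg]
  have h2 : eLpNorm (fun x => ∑ p : Fin N × Fin d, y p.1 p.2 * g p.1 p.2 x) 2 volume ≤
      (∑ p : Fin N × Fin d, eLpNorm (g p.1 p.2) 2 volume) * ‖y‖ₑ := by
    have e3 : (fun x => ∑ p : Fin N × Fin d, y p.1 p.2 * g p.1 p.2 x) =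
        ∑ p : Fin N × Fin d, y p.1 p.2 • g p.1 p.2 := by
      ext x; simp [Finset.sum_apply]
    rw [e3, Finset.sum_mul]
    refine (eLpNorm_sum_le (fun p _ => ((hgL p.1 p.2).const_smul _).1) (by norm_num)).trans ?_
    refine Finset.sum_le_sum fun p _ => ?_
    rw [eLpNorm_const_smul, mul_comm]
    gcongr
    rw [← ofReal_norm, ← ofReal_norm]
    exact ENNReal.ofReal_le_ofReal
      ((PiLp.norm_apply_le (y p.1) p.2).trans (norm_le_pi_norm y p.1))
  have h3 := eLpNorm_nnreal_pow_eq_lintegral (μ := volume) (p := 2)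
    (f := fun x => u (x + y) - u x) (by norm_num)
  simp only [NNReal.coe_ofNat, ENNReal.rpow_ofNat, ENNReal.coe_ofNat] at h3
  rw [← h3, ← mul_pow]
  exact pow_le_pow_left' (h1.trans h2) 2

end Sobolev

/-! ### Finiteness of the initial entropy and return to the integral definition. -/

section FiniteEntropy

open InformationTheory

variable {N d : ℕ} {β : ℝ}

lemma lintegral_mul_log_ne_top_of_memH1 (hd : 1 ≤ d) (hN : 1 ≤ N) {f : Config N d → ℝ}
    (hfm : Measurable f) (hf : IsProbabilityDensity f) (hH1 : MemH1 fun v => Real.sqrt (f v)) :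
    ∫⁻ v, ENNReal.ofReal (f v * Real.log (f v)) ≠ ⊤ := by
  have : Nonempty (Fin N) := ⟨⟨0, hN⟩⟩
  have : Nonempty (Fin d) := ⟨⟨0, hd⟩⟩
  have : Nontrivial (Config N d) := inferInstance
  obtain ⟨C, hC, h⟩ := hH1.exists_translate_le
  have hae : ∀ᵐ v, Real.sqrt (f v) ^ 2 = f v := by
    filter_upwards [hf.2.1] with v hv using Real.sq_sqrt hv
  have h1 : ∫⁻ v, ENNReal.ofReal (Real.sqrt (f v) ^ 2) = 1 := by
    rw [lintegral_congr_ae (hae.mono fun v hv => by rw [hv]),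
      ← ofReal_integral_eq_lintegral_ofReal hf.1 hf.2.1, hf.2.2, ENNReal.ofReal_one]
  have key := lintegral_sq_mul_log_sq_ne_top (Real.continuous_sqrt.measurable.comp hfm) h1 hC h
  refine fun htop => key ((lintegral_congr_ae (hae.mono fun v hv => ?_)).trans htop)
  simp only [Function.comp_apply, hv]

lemma log_maxwellN (hβ : 0 < β) (v : Config N d) :
    Real.log (maxwellN β v) =
      (d : ℝ) * N / 2 * Real.log (β / (2 * Real.pi)) - β / 2 * sqLength v := by
  have h : 0 < β / (2 * Real.pi) := by positivity
  rw [maxwellN, Real.log_mul (by positivity) (Real.exp_pos _).ne', Real.log_rpow h, Real.log_exp]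
  ring

/-- Expanding `γ klFun (f / γ) = f log f - f log γ + γ - f`, the logarithm of the Maxwell density is
a constant minus `β` times the kinetic energy. Only the positive part of `f log f` is needed,
because the whole integrand is nonnegative. -/
lemma klEntropy_rel_ne_top (hβ : 0 < β) {f : Config N d → ℝ}
    (hfm : Measurable f) (hf : IsProbabilityDensity f) (hE : kineticEnergy f < ⊤)
    (hlog : ∫⁻ v, ENNReal.ofReal (f v * Real.log (f v)) ≠ ⊤) :
    klEntropy (maxwellMeasureN N d β) (rel β f) ≠ ⊤ := by
  have := isProbabilityMeasure_maxwellMeasureN (N := N) (d := d) hβ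
  have hcm : Measurable (maxwellN β : Config N d → ℝ) := continuous_maxwellN.measurable
  set c : ℝ := |(d : ℝ) * N / 2 * Real.log (β / (2 * Real.pi))| with hc
  have hγ : ∫⁻ v : Config N d, ENNReal.ofReal (maxwellN β v) ≠ ⊤ := by
    have h1 : maxwellMeasureN N d β univ = 1 := measure_univ
    rw [maxwellMeasureN, withDensity_apply _ MeasurableSet.univ, Measure.restrict_univ] at h1
    rw [h1]; exact ENNReal.one_ne_top
  have hfi : ∫⁻ v, ENNReal.ofReal (f v) ≠ ⊤ := by
    rw [← ofReal_integral_eq_lintegral_ofReal hf.1 hf.2.1]; exact ENNReal.ofReal_ne_top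
  have hle : klEntropy (maxwellMeasureN N d β) (rel β f) ≤
      ∫⁻ v, (ENNReal.ofReal (f v * Real.log (f v)) +
        (ENNReal.ofReal β * ENNReal.ofReal (1 / 2 * sqLength v * f v) +
        (ENNReal.ofReal c * ENNReal.ofReal (f v) + ENNReal.ofReal (maxwellN β v)))) := by
    have hkm : Measurable fun v => ENNReal.ofReal (klFun (rel β f v)) :=
      (measurable_klFun.comp (hfm.div hcm)).ennreal_ofReal
    rw [klEntropy, maxwellMeasureN, lintegral_withDensity_eq_lintegral_mul₀
      hcm.ennreal_ofReal.aemeasurable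
      hkm.aemeasurable]
    refine lintegral_mono_ae ?_
    filter_upwards [hf.2.1] with v hv
    have hp := maxwellN_pos (N := N) (d := d) hβ v
    have hs : 0 ≤ sqLength v := Finset.sum_nonneg fun i _ => sq_nonneg _
    rw [Pi.mul_apply, ← ENNReal.ofReal_mul hp.le, ← ENNReal.ofReal_mul hβ.le,
      ← ENNReal.ofReal_mul (abs_nonneg _), ← ENNReal.ofReal_add (mul_nonneg (abs_nonneg _) hv) hp.le,
      ← ENNReal.ofReal_add (mul_nonneg hβ.le (mul_nonneg (by positivity) hv))
        (add_nonneg (mul_nonneg (abs_nonneg _) hv) hp.le)]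
    refine le_trans (ENNReal.ofReal_le_ofReal ?_) ENNReal.ofReal_add_le
    rw [klFun, rel]
    rcases eq_or_lt_of_le hv with h0 | h0
    · simp only [Pi.zero_apply] at h0
      simp [← h0]
    · simp only [Pi.zero_apply] at h0
      rw [Real.log_div h0.ne' hp.ne', log_maxwellN hβ]
      have h2 := neg_abs_le ((d : ℝ) * N / 2 * Real.log (β / (2 * Real.pi)))
      rw [← hc] at h2
      have h3 : maxwellN β v * (f v / maxwellN β v *
          (Real.log (f v) - ((d : ℝ) * N / 2 * Real.log (β / (2 * Real.pi)) -
            β / 2 * sqLength v)) + 1 - f v / maxwellN β v) =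
          f v * Real.log (f v) - f v * ((d : ℝ) * N / 2 * Real.log (β / (2 * Real.pi))) +
            β * (1 / 2 * sqLength v * f v) + maxwellN β v - f v := by
        field_simp
        ring
      rw [h3]
      nlinarith
  refine ne_top_of_le_ne_top ?_ hle
  have hsm : Measurable (sqLength : Config N d → ℝ) := by unfold sqLength; fun_prop
  rw [lintegral_add_left (by fun_prop), lintegral_add_left (by fun_prop),
    lintegral_add_left (by fun_prop), lintegral_const_mul' _ _ ENNReal.ofReal_ne_top,
    lintegral_const_mul' _ _ ENNReal.ofReal_ne_top]
  exact ENNReal.add_ne_top.2 ⟨hlog, ENNReal.add_ne_top.2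
    ⟨ENNReal.mul_ne_top ENNReal.ofReal_ne_top hE.ne, ENNReal.add_ne_top.2
      ⟨ENNReal.mul_ne_top ENNReal.ofReal_ne_top hfi, hγ⟩⟩⟩

lemma entropyDensity_eq (hβ : 0 < β) (f : Config N d → ℝ) (v : Config N d) :
    entropyDensity f (maxwellN β) v =
      maxwellN β v * (klFun (rel β f v) + rel β f v - 1) := by
  have hp := maxwellN_pos (N := N) (d := d) hβ v
  rw [entropyDensity, klFun, rel]
  field_simp
  ring

/-- A finite entropy bound gives an integrable entropy density and a bound of the relative
entropy. -/
lemma HasEntropyLE.integrable_entropyDensity (hβ : 0 < β) {E : ℝ≥0∞} (hE : E ≠ ⊤)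
    {f : ConfL1 N d} (hf : HasEntropyLE β E f) :
    Integrable (entropyDensity f (maxwellN β)) ∧
      relEntropy f (maxwellN β) = (klEntropy (maxwellMeasureN N d β) (rel β f)).toReal := by
  have := isProbabilityMeasure_maxwellMeasureN (N := N) (d := d) hβ
  have hm : Measurable (rel β f : Config N d → ℝ) :=
    (Lp.stronglyMeasurable f).measurable.div continuous_maxwellN.measurable
  have h0 : 0 ≤ᵐ[maxwellMeasureN N d β] fun v => klFun (rel β f v) := by
    unfold Filter.EventuallyLE
    rw [ae_maxwellMeasureN hβ]
    filter_upwards [hf.nonneg] with v hv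
    exact klFun_nonneg (div_nonneg hv (maxwellN_pos hβ v).le)
  have hkm : Measurable fun v => klFun (rel β f v) := measurable_klFun.comp hm
  have hk : Integrable (fun v => klFun (rel β f v)) (maxwellMeasureN N d β) :=
    ⟨hkm.aestronglyMeasurable, (hasFiniteIntegral_iff_ofReal h0).2 (hf.le.trans_lt hE.lt_top)⟩
  have hr := integrable_rel hβ (integrable_confL1 f)
  have hkr : Integrable (fun v => klFun (rel β f v) + rel β f v) (maxwellMeasureN N d β) :=
    hk.add hr
  have hi : Integrable (fun v => klFun (rel β f v) + rel β f v - 1) (maxwellMeasureN N d β) :=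
    hkr.sub (integrable_const 1)
  have he : entropyDensity f (maxwellN β) = fun v =>
      maxwellN β v * (klFun (rel β f v) + rel β f v - 1) := funext (entropyDensity_eq hβ f)
  refine ⟨?_, ?_⟩
  · rw [he]
    exact (integrable_maxwellMeasureN_iff hβ).1 hi
  · rw [relEntropy, he, ← integral_maxwellMeasureN hβ, integral_sub hkr
      (integrable_const 1), integral_add hk hr, integral_rel hβ, hf.mass, integral_const,
      integral_eq_lintegral_of_nonneg_ae h0 hkm.aestronglyMeasurable]
    simp [klEntropy]

end FiniteEntropy

end KacThermostat

theorem mainTheorem1 (d N : ℕ) (hd : 1 ≤ d) (hN : 1 ≤ N)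
    (lam μ β : ℝ) (hlam : 0 ≤ lam) (hμ : 0 ≤ μ) (hβ : 0 < β)
    (ρ : MeasureTheory.Measure (KacThermostat.Angle d))
    [MeasureTheory.IsProbabilityMeasure ρ]
    (hρ : KacThermostat.SymmetryCondition ρ)
    (f : ℝ → MeasureTheory.Lp ℝ 1
      (MeasureTheory.volume : MeasureTheory.Measure (KacThermostat.Config N d)))
    (hf : KacThermostat.IsSolution lam μ β ρ f)
    (hdens : KacThermostat.IsProbabilityDensity (f 0))
    (hH1 : KacThermostat.MemH1 (fun v => Real.sqrt (f 0 v)))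
    (hE : KacThermostat.kineticEnergy (f 0) < ⊤) :
    ∀ t : ℝ, 0 ≤ t →
      MeasureTheory.Integrable (KacThermostat.entropyDensity (f 0) (KacThermostat.maxwellN β)) ∧
      MeasureTheory.Integrable (KacThermostat.entropyDensity (f t) (KacThermostat.maxwellN β)) ∧
      KacThermostat.relEntropy (f t) (KacThermostat.maxwellN β) ≤
        Real.exp (-(1 / (d : ℝ)) * μ * t) *
          KacThermostat.relEntropy (f 0) (KacThermostat.maxwellN β) := by
  intro t ht
  have hfm : Measurable (f 0) := (Lp.stronglyMeasurable (f 0)).measurable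
  have hfin := KacThermostat.klEntropy_rel_ne_top hβ hfm hdens hE
    (KacThermostat.lintegral_mul_log_ne_top_of_memH1 hd hN hfm hdens hH1)
  -- The initial bound is the initial entropy itself, so the decay estimate loses nothing.
  have h0 : KacThermostat.HasEntropyLE β _ (f 0) := ⟨hdens.2.1, hdens.2.2, le_rfl⟩
  have h1 := hf.hasEntropyLE hd hN hlam hμ hβ hρ hfin h0 ht
  have hfin' := ENNReal.mul_ne_top
    (ENNReal.ofReal_ne_top (r := Real.exp (-(1 / (d : ℝ)) * μ * t))) hfin
  obtain ⟨i0, e0⟩ := h0.integrable_entropyDensity hβ hfin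
  obtain ⟨i1, e1⟩ := h1.integrable_entropyDensity hβ hfin'
  refine ⟨i0, i1, ?_⟩
  rw [e0, e1]
  have h2 := ENNReal.toReal_mono hfin' h1.le
  rwa [ENNReal.toReal_mul, ENNReal.toReal_ofReal (Real.exp_pos _).le] at h2
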